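/- **Setting.** Let $\mathbb K$ be an algebraically closed field of characteristic $0$, $a\in\mathbb K\setminus\{0,-1\}$, and let $\mathfrak g=\mathfrak g_0\oplus\mathfrak g_1=D(2,1;a)$ be the $17$-dimensional contragredient Lie superalgebra over $\mathbb K$ with Cartan matrix $\begin{pmatrix}0&1&a\\-1&2&0\\-1&0&2\end{pmatrix}$ (first simple root odd), realized as $\mathfrak g_0=\mathfrak{sl}_2^{\oplus3}$, $\mathfrak g_1=\mathbb K^2\otimes\mathbb K^2\otimes\mathbb K^2$. Its Cartan subalgebra is $\mathfrak h$; its even roots are $\Delta_0=\{\pm2\varepsilon_i\}_{i=1,2,3}$ and its odd roots are $\Delta_1=\{\pm\varepsilon_1\pm\varepsilon_2\pm\varepsilon_3\}$, where the $\varepsilon_i$ are orthogonal with $(\varepsilon_1,\varepsilon_1)=-\frac{1+a}2$, $(\varepsilon_2,\varepsilon_2)=\frac12$, $(\varepsilon_3,\varepsilon_3)=\frac a2$. The positive roots are $2\varepsilon_i$ and $\varepsilon_1\pm\varepsilon_2\pm\varepsilon_3$; $\Delta=\Delta_0\sqcup\Delta_1$ and $\Delta_j^\pm$ is the set of positive,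 respectively negative, roots in $\Delta_j$. The coroots are $H_\alpha\in\mathfrak h$, with $H_{-\alpha}=-H_\alpha$, $(2\varepsilon_i)(H_{2\varepsilon_j})=2\delta_{ij}$, and $H_\gamma=-\sum_i(\varepsilon_i,\varepsilon_i)\gamma_iH_{2\varepsilon_i}$ for an odd root $\gamma=\sum_i\gamma_i\varepsilon_i$. Let $\mathbb Z[a]\subseteq\mathbb K$ be the subring generated by $a$ and $\mathbb Z_a\subseteq\mathbb K$ the subring generated by all $\binom zn$, $z\in\mathbb Z[a]$, $n\in\mathbb N$. Fix a Chevalley basis $\{H_1,H_2,H_3\}\sqcup\{X_\alpha\}_{\alpha\in\Delta}$ of $\mathfrak g$, i.e. a homogeneous basis such that: $H_1,H_2,H_3$ is a basis of $\mathfrak h$ and $\mathfrak h_{\mathbb Z[a]}:=\mathrm{Span}_{\mathbb Z[a]}(H_i)=\mathrm{Span}_{\mathbb Z[a]}(H_\alpha:\alpha\in\Delta)$; $[H_i,H_j]=0$ and $[H_i,X_\alpha]=\alpha(H_i)X_\alpha$; $[X_\alpha,X_{-\alpha}]=\sigma_\alpha H_\alpha$ with $\sigma_\alpha=-1$ if $\alpha\in\Delta_1^-$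 and $\sigma_\alpha=1$ otherwise; for $\alpha,\beta\in\Delta$ with $\alpha+\beta\ne0$, $[X_\alpha,X_\beta]=c_{\alpha,\beta}X_{\alpha+\beta}$, where this is $0$ if $\alpha+\beta\notin\Delta$, while if $\alpha+\beta\in\Delta$ then $c_{\alpha,\beta}=\pm(r+1)$ when $\alpha$ or $\beta$ is non-isotropic ($r$ being the largest integer with $\beta-r\alpha\in\Delta\cup\{0\}$) and $c_{\alpha,\beta}=\pm\beta(H_\alpha)$ when both are isotropic. The Kostant superalgebra $K$ is the $\mathbb Z_a$-subalgebra of $U(\mathfrak g)$ generated by the divided powers $X_\alpha^{(n)}=X_\alpha^n/n!$ ($\alpha\in\Delta_0$, $n\in\mathbb N$), the $X_\gamma$ ($\gamma\in\Delta_1$) and the $\binom Hn$ ($H\in\mathfrak h_{\mathbb Z[a]}$, $n\in\mathbb N$). Let $V$ be a finite-dimensional rational $\mathfrak g$-module, i.e. $V=\bigoplus_{\mu\in\mathfrak h^*}V_\mu$ and every weight $\mu$ of $V$ satisfies $\mu(H_i)\in\mathbb Z[a]$ for all $i$ and $\mu(H_\alpha)\in\mathbb Z$ for all $\alpha\in\Delta_0$.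 Let $M\subseteq V$ be an admissible lattice, i.e. the $\mathbb Z_a$-span of a $\mathbb K$-basis of $V$ that is stable under $K$. Let $\Bbbk$ be a commutative $\mathbb Z_a$-algebra in which $2$ and $3$ are non-zero and are not zero divisors, and let $A=A_0\oplus A_1$ be a commutative $\Bbbk$-superalgebra (i.e. $xy=(-1)^{|x||y|}yx$ for homogeneous $x,y$) without $2$- and $3$-torsion. Put $V_\Bbbk=\Bbbk\otimes_{\mathbb Z_a}M$ and $V_\Bbbk(A)=A\otimes_\Bbbk V_\Bbbk$, on which $c\otimes f$ acts with the Koszul sign. Inside $\mathrm{GL}(V_\Bbbk(A))$ consider * $x_\alpha(t)=\sum_{n\ge0}t^nX_\alpha^{(n)}$ for $\alpha\in\Delta_0$, $t\in A_0$, and $x_\gamma(\vartheta)=1+\vartheta X_\gamma$ for $\gamma\in\Delta_1$, $\vartheta\in A_1$; * for $H\in\mathrm{Span}_{\mathbb Z}(H_\alpha:\alpha\in\Delta_0)$ and $t$ a unit of $A_0$, the operator $h_H(t)$ acting on each weight space of weight $\mu$ as $t^{\mu(H)}$; * for $H\in\mathfrak h_{\mathbb Z[a]}$ and $\varphi\in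 P_a(A)$, the operator $h^{[a]}_H(\varphi)$ acting on each weight space of weight $\mu$ as $\varphi(\ell^{\mu(H)})$. Here $\ell^{z}=\sum_{n\ge0}\binom zn(\ell-1)^n\in\mathbb Z_a[[\ell-1]]$ for $z\in\mathbb Z[a]$, and $P_a(A)$ is the set of $\Bbbk$-algebra morphisms $\varphi:\Bbbk\otimes_{\mathbb Z_a}\mathbb Z_a[\{\ell^{\pm a^n}\}_{n\in\mathbb N}]\to A$ with values in $A_0$, the source being the scalar extension of the subalgebra of $\mathbb Z_a[[\ell-1]]$ generated by the $\ell^{\pm a^n}$. Let $G_0(A)$ be the subgroup generated by all $x_\alpha(t)$ with $\alpha\in\Delta_0$, all $h_H(t)$ and all $h_H^{[a]}(\varphi)$, and let $G(A)$ be the subgroup generated by $G_0(A)$ and all $x_\gamma(\vartheta)$ with $\gamma\in\Delta_1$. Let $G_1(A)$, $G_0^\pm(A)$, $G_1^\pm(A)$ and $G^\pm(A)$ be the sets of finite products of elements $x_\beta(u)$ ($u\in A_0$ if $\beta$ is even, $u\in A_1$ if $\beta$ is odd) with $\beta$ ranging over $\Delta_1$, $\Delta_0^\pm$, $\Delta_1^\pm$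 and $\Delta_0^\pm\cup\Delta_1^\pm$, respectively. For a total order $\gamma_1\prec\dots\prec\gamma_8$ of $\Delta_1$ let $G_1^<(A)=\{x_{\gamma_1}(\vartheta_1)\cdots x_{\gamma_8}(\vartheta_8):\vartheta_1,\dots,\vartheta_8\in A_1\}$. **Theorem.** For every such $A$ one has the equalities of sets (a) $G(A)=G_0(A)\,G_1(A)$ and $G(A)=G_1(A)\,G_0(A)$; (b) $G^\pm(A)=G_0^\pm(A)\,G_1^\pm(A)$ and $G^\pm(A)=G_1^\pm(A)\,G_0^\pm(A)$, for both signs; (c) for every total order on $\Delta_1$, $G(A)=G_0(A)\,G_1^<(A)$ and $G(A)=G_1^<(A)\,G_0(A)$. -/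

import Mathlib

noncomputable section

namespace SuperD21

/-- The Koszul sign `(-1)^(i*j)` for parities `i`, `j`. -/
def koszul (i j : ZMod 2) : ℤ := if i = 1 ∧ j = 1 then -1 else 1

/-- A Lie superalgebra: a `ℤ/2`-graded module with an even super-skew-symmetric bracket
satisfying the super Jacobi identity. -/
class LieSuperalgebra (K : Type*) [CommRing K] (L : Type*) [AddCommGroup L] [Module K L] where
  grading : ZMod 2 → Submodule K L
  isInternal : DirectSum.IsInternal grading
  bracket : L →ₗ[K] L →ₗ[K] L
  bracket_mem : ∀ {i j : ZMod 2} {x y : L}, x ∈ grading i → y ∈ grading j →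
    bracket x y ∈ grading (i + j)
  bracket_skew : ∀ {i j : ZMod 2} {x y : L}, x ∈ grading i → y ∈ grading j →
    bracket x y + koszul i j • bracket y x = 0
  jacobi : ∀ {i j l : ZMod 2} {x y z : L}, x ∈ grading i → y ∈ grading j → z ∈ grading l →
    koszul i l • bracket x (bracket y z) + koszul j i • bracket y (bracket z x) +
      koszul l j • bracket z (bracket x y) = 0

abbrev SL2 (K : Type*) [Field K] : Type _ := LieAlgebra.SpecialLinear.sl (Fin 2) K

/-- The underlying space of the Lie superalgebra `D(2,1;a)`, in its standard realization: the even
part is `𝔰𝔩₂ ⊕ 𝔰𝔩₂ ⊕ 𝔰𝔩₂`, the odd part is `K² ⊗ K² ⊗ K²`, written as the space of functions of three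
indices in `{0, 1}` (coordinates in the tensor products of standard basis vectors). -/
def D21 (K : Type*) [Field K] (_a : K) : Type _ := (Fin 3 → SL2 K) × ((Fin 3 → Fin 2) → K)

section Construction
variable {K : Type*} [Field K] (a : K)

instance : AddCommGroup (D21 K a) :=
  inferInstanceAs (AddCommGroup ((Fin 3 → SL2 K) × ((Fin 3 → Fin 2) → K)))

instance : Module K (D21 K a) :=
  inferInstanceAs (Module K ((Fin 3 → SL2 K) × ((Fin 3 → Fin 2) → K)))

/-- The scalars `(ε₁, ε₁) = -(1+a)/2`, `(ε₂, ε₂) = 1/2`, `(ε₃, ε₃) = a/2` (of sum zero). -/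
def epsNorm : Fin 3 → K := ![-(1 + a) / 2, 1 / 2, a / 2]

/-- The standard symplectic form on `K²`. -/
def omega : Matrix (Fin 2) (Fin 2) K := !![0, 1; -1, 0]

/-- The operator `z ↦ ω(e_q, z) e_p + ω(e_p, z) e_q` on `K²`. -/
def symOp (p q : Fin 2) : Matrix (Fin 2) (Fin 2) K :=
  Matrix.of fun r t => (if r = p then omega q t else 0) + (if r = q then omega p t else 0)

lemma symOp_trace (p q : Fin 2) : (symOp (K := K) p q).trace = 0 := by
  fin_cases p <;> fin_cases q <;> simp [symOp, omega, Matrix.trace, Fin.sum_univ_two]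

def symOpSl (p q : Fin 2) : SL2 K :=
  ⟨symOp p q, by
    change Matrix.traceLinearMap (Fin 2) K K _ = 0
    exact symOp_trace p q⟩

/-- The bracket of two odd elements: on pure tensors, the `i`-th component of
`[u₁⊗u₂⊗u₃, w₁⊗w₂⊗w₃]` is
`(ε_i, ε_i) * (∏_{j ≠ i} ω(u_j, w_j)) * (z ↦ ω(w_i, z) u_i + ω(u_i, z) w_i)`. -/
def oddBracket : ((Fin 3 → Fin 2) → K) →ₗ[K] ((Fin 3 → Fin 2) → K) →ₗ[K] (Fin 3 → SL2 K) :=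
  LinearMap.mk₂ K
    (fun v w i => ∑ s : Fin 3 → Fin 2, ∑ t : Fin 3 → Fin 2,
      (v s * w t * epsNorm a i * ∏ j ∈ Finset.univ.erase i, omega (s j) (t j)) •
        symOpSl (s i) (t i))
    (fun v v' w => by
      funext i; simp only [Pi.add_apply, add_mul, add_smul, Finset.sum_add_distrib])
    (fun c v w => by
      funext i; simp only [Pi.smul_apply, smul_eq_mul, Finset.smul_sum, smul_smul, mul_assoc])
    (fun v w w' => by
      funext i
      simp only [Pi.add_apply, mul_add, add_mul, add_smul, Finset.sum_add_distrib])
    (fun c v w => by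
      funext i
      simp only [Pi.smul_apply, smul_eq_mul, Finset.smul_sum, smul_smul]
      refine Finset.sum_congr rfl fun s _ => Finset.sum_congr rfl fun t _ => ?_
      congr 1; ring)

/-- The natural action of `𝔰𝔩₂ ⊕ 𝔰𝔩₂ ⊕ 𝔰𝔩₂` on `K² ⊗ K² ⊗ K²`. -/
def tensorAct : (Fin 3 → SL2 K) →ₗ[K] ((Fin 3 → Fin 2) → K) →ₗ[K] ((Fin 3 → Fin 2) → K) :=
  LinearMap.mk₂ K
    (fun x v s => ∑ i : Fin 3, ∑ q : Fin 2, (x i).val (s i) q * v (Function.update s i q))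
    (fun x x' v => by
      funext s
      simp [add_mul, Finset.sum_add_distrib])
    (fun c x v => by
      funext s
      simp [Finset.mul_sum, mul_assoc, mul_add])
    (fun x v v' => by
      funext s
      simp only [Pi.add_apply, mul_add, Finset.sum_add_distrib])
    (fun c x v => by
      funext s
      simp only [Pi.smul_apply, smul_eq_mul, Finset.mul_sum]
      refine Finset.sum_congr rfl fun s _ => Finset.sum_congr rfl fun t _ => ?_
      ring)

/-- The componentwise bracket of `𝔰𝔩₂ ⊕ 𝔰𝔩₂ ⊕ 𝔰𝔩₂`. -/
def lie3 : (Fin 3 → SL2 K) →ₗ[K] (Fin 3 → SL2 K) →ₗ[K] (Fin 3 → SL2 K) :=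
  LinearMap.mk₂ K (fun x y i => ⁅x i, y i⁆)
    (fun x x' y => by funext i; simp) (fun c x y => by funext i; simp)
    (fun x y y' => by funext i; simp) (fun c x y => by funext i; simp)

@[simp] lemma lie3_apply (x y : Fin 3 → SL2 K) (i : Fin 3) : lie3 x y i = ⁅x i, y i⁆ := rfl

/-- The bracket of `D(2,1;a)`. -/
def d21Bracket : D21 K a →ₗ[K] D21 K a →ₗ[K] D21 K a :=
  LinearMap.mk₂ K
    (fun x y => ((lie3 x.1 y.1 + oddBracket a x.2 y.2, tensorAct x.1 y.2 - tensorAct y.1 x.2) :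
      (Fin 3 → SL2 K) × ((Fin 3 → Fin 2) → K)))
    (fun x x' y => by
      refine Prod.ext ?_ ?_
      · change lie3 (x.1 + x'.1) y.1 + oddBracket a (x.2 + x'.2) y.2 =
          lie3 x.1 y.1 + oddBracket a x.2 y.2 + (lie3 x'.1 y.1 + oddBracket a x'.2 y.2)
        rw [map_add, LinearMap.add_apply, map_add, LinearMap.add_apply]; abel
      · change tensorAct (x.1 + x'.1) y.2 - tensorAct y.1 (x.2 + x'.2) =
          tensorAct x.1 y.2 - tensorAct y.1 x.2 + (tensorAct x'.1 y.2 - tensorAct y.1 x'.2)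
        rw [map_add, map_add, LinearMap.add_apply]; abel)
    (fun c x y => by
      refine Prod.ext ?_ ?_
      · change lie3 (c • x.1) y.1 + oddBracket a (c • x.2) y.2 =
          c • (lie3 x.1 y.1 + oddBracket a x.2 y.2)
        rw [map_smul, LinearMap.smul_apply, map_smul, LinearMap.smul_apply, smul_add]
      · change tensorAct (c • x.1) y.2 - tensorAct y.1 (c • x.2) =
          c • (tensorAct x.1 y.2 - tensorAct y.1 x.2)
        rw [map_smul, map_smul, LinearMap.smul_apply, smul_sub])
    (fun x y y' => by
      refine Prod.ext ?_ ?_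
      · change lie3 x.1 (y.1 + y'.1) + oddBracket a x.2 (y.2 + y'.2) =
          lie3 x.1 y.1 + oddBracket a x.2 y.2 + (lie3 x.1 y'.1 + oddBracket a x.2 y'.2)
        rw [map_add, map_add]; abel
      · change tensorAct x.1 (y.2 + y'.2) - tensorAct (y.1 + y'.1) x.2 =
          tensorAct x.1 y.2 - tensorAct y.1 x.2 + (tensorAct x.1 y'.2 - tensorAct y'.1 x.2)
        rw [map_add, map_add, LinearMap.add_apply]; abel)
    (fun c x y => by
      refine Prod.ext ?_ ?_
      · change lie3 x.1 (c • y.1) + oddBracket a x.2 (c • y.2) =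
          c • (lie3 x.1 y.1 + oddBracket a x.2 y.2)
        rw [map_smul, map_smul, smul_add]
      · change tensorAct x.1 (c • y.2) - tensorAct (c • y.1) x.2 =
          c • (tensorAct x.1 y.2 - tensorAct y.1 x.2)
        rw [map_smul, map_smul, LinearMap.smul_apply, smul_sub])

def tripleEquiv : (Fin 3 → Fin 2) ≃ Fin 2 × Fin 2 × Fin 2 where
  toFun s := (s 0, s 1, s 2)
  invFun p := ![p.1, p.2.1, p.2.2]
  left_inv s := by funext i; fin_cases i <;> rfl
  right_inv p := rfl

lemma sum_triple {β : Type*} [AddCommMonoid β] (f : (Fin 3 → Fin 2) → β) :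
    ∑ s, f s = ∑ p, ∑ q, ∑ r, f ![p, q, r] := by
  rw [← Equiv.sum_comp tripleEquiv.symm f, Fintype.sum_prod_type]
  refine Finset.sum_congr rfl fun p _ => ?_
  rw [Fintype.sum_prod_type]; rfl

lemma forall_triple {P : (Fin 3 → Fin 2) → Prop} (h : ∀ p q r, P ![p, q, r]) (s) : P s := by
  have := h (s 0) (s 1) (s 2)
  convert this using 1
  funext i; fin_cases i <;> rfl

lemma upd0 (p q r t : Fin 2) : Function.update ![p, q, r] 0 t = ![t, q, r] := by
  funext i; fin_cases i <;> rfl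
lemma upd1 (p q r t : Fin 2) : Function.update ![p, q, r] 1 t = ![p, t, r] := by
  funext i; fin_cases i <;> rfl
lemma upd2 (p q r t : Fin 2) : Function.update ![p, q, r] 2 t = ![p, q, t] := by
  funext i; fin_cases i <;> rfl
lemma er0 : (Finset.univ.erase 0 : Finset (Fin 3)) = {1, 2} := by decide
lemma er1 : (Finset.univ.erase 1 : Finset (Fin 3)) = {0, 2} := by decide
lemma er2 : (Finset.univ.erase 2 : Finset (Fin 3)) = {0, 1} := by decide

lemma tensorAct_apply (x : Fin 3 → SL2 K) (v : (Fin 3 → Fin 2) → K) (p q r : Fin 2) :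
    tensorAct x v ![p, q, r] =
      ((x 0).val p 0 * v ![0, q, r] + (x 0).val p 1 * v ![1, q, r]) +
      ((x 1).val q 0 * v ![p, 0, r] + (x 1).val q 1 * v ![p, 1, r]) +
      ((x 2).val r 0 * v ![p, q, 0] + (x 2).val r 1 * v ![p, q, 1]) := by
  simp [tensorAct, Fin.sum_univ_three, upd0, upd1, upd2]

lemma tensorAct_lie (x y : Fin 3 → SL2 K) (v : (Fin 3 → Fin 2) → K) :
    tensorAct (lie3 x y) v = tensorAct x (tensorAct y v) - tensorAct y (tensorAct x v) := by
  funext s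
  revert s
  refine forall_triple fun p q r => ?_
  simp only [Pi.sub_apply, tensorAct_apply, lie3_apply, LieAlgebra.SpecialLinear.sl_bracket,
    Matrix.sub_apply, Matrix.mul_apply, Fin.sum_univ_two]
  ring

lemma tr_zero (x : SL2 K) : x.val 1 1 = - x.val 0 0 := by
  have : x.val.trace = 0 := x.2
  rw [Matrix.trace_fin_two] at this
  linear_combination this

lemma oddBracket_apply (v w : (Fin 3 → Fin 2) → K) (i : Fin 3) (m n : Fin 2) :
    (oddBracket a v w i).val m n = ∑ s : Fin 3 → Fin 2, ∑ t : Fin 3 → Fin 2,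
      (v s * w t * epsNorm a i * ∏ j ∈ Finset.univ.erase i, omega (s j) (t j)) *
        symOp (s i) (t i) m n := by
  simp [oddBracket, Matrix.sum_apply, symOpSl]

lemma oddBracket_symm (v w : (Fin 3 → Fin 2) → K) : oddBracket a v w = oddBracket a w v := by
  funext i
  refine Subtype.ext (Matrix.ext fun m n => ?_)
  rw [oddBracket_apply, oddBracket_apply, Finset.sum_comm]
  refine Finset.sum_congr rfl fun s _ => Finset.sum_congr rfl fun t _ => ?_
  have h1 : symOp (K := K) (t i) (s i) m n = symOp (s i) (t i) m n := by
    simp [symOp, add_comm]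
  have h0 : ∀ p q : Fin 2, omega (K := K) p q = - omega q p := by
    intro p q; fin_cases p <;> fin_cases q <;> simp [omega]
  have h2 : ∏ j ∈ Finset.univ.erase i, omega (K := K) (t j) (s j) =
      ∏ j ∈ Finset.univ.erase i, omega (s j) (t j) := by
    rw [Finset.prod_congr rfl fun j _ => h0 (t j) (s j), Finset.prod_neg,
      Finset.card_erase_of_mem (Finset.mem_univ _)]
    simp
  rw [h1, h2]; ring


lemma lie3_jacobi (x y z : Fin 3 → SL2 K) :
    lie3 x (lie3 y z) + lie3 y (lie3 z x) + lie3 z (lie3 x y) = 0 := by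
  funext i
  simp only [Pi.add_apply, lie3_apply, Pi.zero_apply]
  exact lie_jacobi _ _ _

lemma lie3_skew (x y : Fin 3 → SL2 K) : lie3 x y + lie3 y x = 0 := by
  funext i
  simp only [Pi.add_apply, lie3_apply, Pi.zero_apply]
  rw [← lie_skew, neg_add_cancel]

lemma omega_val : omega (K := K) 0 0 = 0 ∧ omega (K := K) 0 1 = 1 ∧ omega (K := K) 1 0 = -1 ∧
    omega (K := K) 1 1 = 0 := by simp [omega]

lemma symOp_val (p q : Fin 2) : symOp (K := K) p q 0 0 = (if p = q then 0 else -1) ∧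
    symOp (K := K) p q 0 1 = (if p = 0 ∧ q = 0 then 2 else 0) ∧
    symOp (K := K) p q 1 0 = (if p = 1 ∧ q = 1 then -2 else 0) := by
  fin_cases p <;> fin_cases q <;> refine ⟨?_, ?_, ?_⟩ <;> norm_num [symOp, omega]

lemma oddBracket_sum0 (v w : (Fin 3 → Fin 2) → K) (m n : Fin 2) :
    (oddBracket a v w 0).val m n = ∑ p, ∑ q, ∑ r, ∑ p', ∑ q', ∑ r',
      (v ![p, q, r] * w ![p', q', r'] * epsNorm a 0 * (omega q q' * omega r r')) *
        symOp p p' m n := by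
  simp only [oddBracket_apply, sum_triple, er0]
  refine Finset.sum_congr rfl fun p _ => Finset.sum_congr rfl fun q _ =>
    Finset.sum_congr rfl fun r _ => Finset.sum_congr rfl fun p' _ =>
    Finset.sum_congr rfl fun q' _ => Finset.sum_congr rfl fun r' _ => ?_
  rw [Finset.prod_pair (by decide)]; rfl

lemma oddBracket_sum1 (v w : (Fin 3 → Fin 2) → K) (m n : Fin 2) :
    (oddBracket a v w 1).val m n = ∑ p, ∑ q, ∑ r, ∑ p', ∑ q', ∑ r',
      (v ![p, q, r] * w ![p', q', r'] * epsNorm a 1 * (omega p p' * omega r r')) *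
        symOp q q' m n := by
  simp only [oddBracket_apply, sum_triple, er1]
  refine Finset.sum_congr rfl fun p _ => Finset.sum_congr rfl fun q _ =>
    Finset.sum_congr rfl fun r _ => Finset.sum_congr rfl fun p' _ =>
    Finset.sum_congr rfl fun q' _ => Finset.sum_congr rfl fun r' _ => ?_
  rw [Finset.prod_pair (by decide)]; rfl

lemma oddBracket_sum2 (v w : (Fin 3 → Fin 2) → K) (m n : Fin 2) :
    (oddBracket a v w 2).val m n = ∑ p, ∑ q, ∑ r, ∑ p', ∑ q', ∑ r',
      (v ![p, q, r] * w ![p', q', r'] * epsNorm a 2 * (omega p p' * omega q q')) *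
        symOp r r' m n := by
  simp only [oddBracket_apply, sum_triple, er2]
  refine Finset.sum_congr rfl fun p _ => Finset.sum_congr rfl fun q _ =>
    Finset.sum_congr rfl fun r _ => Finset.sum_congr rfl fun p' _ =>
    Finset.sum_congr rfl fun q' _ => Finset.sum_congr rfl fun r' _ => ?_
  rw [Finset.prod_pair (by decide)]; rfl

lemma oddBracket_entry0 (v w : (Fin 3 → Fin 2) → K) :
    (oddBracket a v w 0).val 0 0 = -epsNorm a 0 *
      ((v ![0, 0, 0] * w ![1, 1, 1] - v ![0, 0, 1] * w ![1, 1, 0] - v ![0, 1, 0] * w ![1, 0, 1] + v ![0, 1, 1] * w ![1, 0, 0]) +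
        (v ![1, 0, 0] * w ![0, 1, 1] - v ![1, 0, 1] * w ![0, 1, 0] - v ![1, 1, 0] * w ![0, 0, 1] + v ![1, 1, 1] * w ![0, 0, 0])) ∧
    (oddBracket a v w 0).val 0 1 = 2 * epsNorm a 0 *
      (v ![0, 0, 0] * w ![0, 1, 1] - v ![0, 0, 1] * w ![0, 1, 0] - v ![0, 1, 0] * w ![0, 0, 1] + v ![0, 1, 1] * w ![0, 0, 0]) ∧
    (oddBracket a v w 0).val 1 0 = -2 * epsNorm a 0 *
      (v ![1, 0, 0] * w ![1, 1, 1] - v ![1, 0, 1] * w ![1, 1, 0] - v ![1, 1, 0] * w ![1, 0, 1] + v ![1, 1, 1] * w ![1, 0, 0]) := by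
  refine ⟨?_, ?_, ?_⟩ <;>
  · rw [oddBracket_sum0]
    simp only [Fin.sum_univ_two, symOp_val, omega_val, mul_zero, zero_mul, add_zero, zero_add,
      if_true, if_false, zero_ne_one, one_ne_zero, and_true, and_false, mul_one]
    ring

lemma oddBracket_entry1 (v w : (Fin 3 → Fin 2) → K) :
    (oddBracket a v w 1).val 0 0 = -epsNorm a 1 *
      ((v ![0, 0, 0] * w ![1, 1, 1] - v ![0, 0, 1] * w ![1, 1, 0] - v ![1, 0, 0] * w ![0, 1, 1] + v ![1, 0, 1] * w ![0, 1, 0]) +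
        (v ![0, 1, 0] * w ![1, 0, 1] - v ![0, 1, 1] * w ![1, 0, 0] - v ![1, 1, 0] * w ![0, 0, 1] + v ![1, 1, 1] * w ![0, 0, 0])) ∧
    (oddBracket a v w 1).val 0 1 = 2 * epsNorm a 1 *
      (v ![0, 0, 0] * w ![1, 0, 1] - v ![0, 0, 1] * w ![1, 0, 0] - v ![1, 0, 0] * w ![0, 0, 1] + v ![1, 0, 1] * w ![0, 0, 0]) ∧
    (oddBracket a v w 1).val 1 0 = -2 * epsNorm a 1 *
      (v ![0, 1, 0] * w ![1, 1, 1] - v ![0, 1, 1] * w ![1, 1, 0] - v ![1, 1, 0] * w ![0, 1, 1] + v ![1, 1, 1] * w ![0, 1, 0]) := by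
  refine ⟨?_, ?_, ?_⟩ <;>
  · rw [oddBracket_sum1]
    simp only [Fin.sum_univ_two, symOp_val, omega_val, mul_zero, zero_mul, add_zero, zero_add,
      if_true, if_false, zero_ne_one, one_ne_zero, and_true, and_false, mul_one]
    ring

lemma oddBracket_entry2 (v w : (Fin 3 → Fin 2) → K) :
    (oddBracket a v w 2).val 0 0 = -epsNorm a 2 *
      ((v ![0, 0, 0] * w ![1, 1, 1] - v ![0, 1, 0] * w ![1, 0, 1] - v ![1, 0, 0] * w ![0, 1, 1] + v ![1, 1, 0] * w ![0, 0, 1]) +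
        (v ![0, 0, 1] * w ![1, 1, 0] - v ![0, 1, 1] * w ![1, 0, 0] - v ![1, 0, 1] * w ![0, 1, 0] + v ![1, 1, 1] * w ![0, 0, 0])) ∧
    (oddBracket a v w 2).val 0 1 = 2 * epsNorm a 2 *
      (v ![0, 0, 0] * w ![1, 1, 0] - v ![0, 1, 0] * w ![1, 0, 0] - v ![1, 0, 0] * w ![0, 1, 0] + v ![1, 1, 0] * w ![0, 0, 0]) ∧
    (oddBracket a v w 2).val 1 0 = -2 * epsNorm a 2 *
      (v ![0, 0, 1] * w ![1, 1, 1] - v ![0, 1, 1] * w ![1, 0, 1] - v ![1, 0, 1] * w ![0, 1, 1] + v ![1, 1, 1] * w ![0, 0, 1]) := by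
  refine ⟨?_, ?_, ?_⟩ <;>
  · rw [oddBracket_sum2]
    simp only [Fin.sum_univ_two, symOp_val, omega_val, mul_zero, zero_mul, add_zero, zero_add,
      if_true, if_false, zero_ne_one, one_ne_zero, and_true, and_false, mul_one]
    ring

lemma oddBracket_tensorAct (x : Fin 3 → SL2 K) (v w : (Fin 3 → Fin 2) → K) :
    lie3 x (oddBracket a v w) =
      oddBracket a (tensorAct x v) w + oddBracket a v (tensorAct x w) := by
  have key (y z : SL2 K) (h1 : y.val 0 0 = z.val 0 0) (h2 : y.val 0 1 = z.val 0 1)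
      (h3 : y.val 1 0 = z.val 1 0) : y = z := by
    refine Subtype.ext (Matrix.ext fun m n => ?_)
    have h4 : y.val 1 1 = z.val 1 1 := by rw [tr_zero, tr_zero, h1]
    fin_cases m <;> fin_cases n <;> assumption
  funext i
  have h0 := tr_zero (x i)
  have hh := tr_zero (oddBracket a v w i)
  have e (m n : Fin 2) : (lie3 x (oddBracket a v w) i).val m n =
      ((x i).val m 0 * (oddBracket a v w i).val 0 n + (x i).val m 1 * (oddBracket a v w i).val 1 n) -
      ((oddBracket a v w i).val m 0 * (x i).val 0 n +
        (oddBracket a v w i).val m 1 * (x i).val 1 n) := by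
    rw [lie3_apply, LieAlgebra.SpecialLinear.sl_bracket, Matrix.sub_apply, Matrix.mul_apply,
      Matrix.mul_apply, Fin.sum_univ_two, Fin.sum_univ_two]
  have f (m n : Fin 2) :
      ((oddBracket a (tensorAct x v) w + oddBracket a v (tensorAct x w)) i).val m n =
      (oddBracket a (tensorAct x v) w i).val m n + (oddBracket a v (tensorAct x w) i).val m n :=
    rfl
  have t0 := tr_zero (x 0)
  have t1 := tr_zero (x 1)
  have t2 := tr_zero (x 2)
  refine key _ _ ?_ ?_ ?_ <;> rw [e, f] <;> (try simp only [h0, hh]) <;> fin_cases i <;>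
  · simp only [Fin.zero_eta, Fin.mk_one, Fin.reduceFinMk, (oddBracket_entry0 a _ _).1,
      (oddBracket_entry0 a _ _).2.1, (oddBracket_entry0 a _ _).2.2, (oddBracket_entry1 a _ _).1,
      (oddBracket_entry1 a _ _).2.1, (oddBracket_entry1 a _ _).2.2, (oddBracket_entry2 a _ _).1,
      (oddBracket_entry2 a _ _).2.1, (oddBracket_entry2 a _ _).2.2, tensorAct_apply, t0, t1, t2]
    ring

lemma odd_jacobi (u v w : (Fin 3 → Fin 2) → K) :
    tensorAct (oddBracket a v w) u + tensorAct (oddBracket a w u) v +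
      tensorAct (oddBracket a u v) w = 0 := by
  funext s
  revert s
  refine forall_triple fun p q r => ?_
  have e : epsNorm a 0 = - epsNorm a 1 - epsNorm a 2 := by
    simp [epsNorm]; ring
  simp only [Pi.add_apply, Pi.zero_apply, tensorAct_apply]
  fin_cases p <;> fin_cases q <;> fin_cases r <;>
  · simp only [Fin.zero_eta, Fin.mk_one, tr_zero, (oddBracket_entry0 a _ _).1,
      (oddBracket_entry0 a _ _).2.1, (oddBracket_entry0 a _ _).2.2, (oddBracket_entry1 a _ _).1,
      (oddBracket_entry1 a _ _).2.1, (oddBracket_entry1 a _ _).2.2, (oddBracket_entry2 a _ _).1,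
      (oddBracket_entry2 a _ _).2.1, (oddBracket_entry2 a _ _).2.2, e]
    ring


/-- Even elements have zero odd component, odd elements have zero even component. -/
def d21Grading (i : ZMod 2) : Submodule K (D21 K a) where
  carrier := {x | if i = 0 then x.2 = 0 else x.1 = 0}
  add_mem' := by
    intro x y hx hy
    change if i = 0 then x.2 + y.2 = 0 else x.1 + y.1 = 0
    split_ifs with h <;> simp_all
  zero_mem' := by
    change if i = 0 then (0 : (Fin 3 → Fin 2) → K) = 0 else (0 : Fin 3 → SL2 K) = 0
    split_ifs <;> rfl
  smul_mem' := by
    intro c x hx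
    change if i = 0 then c • x.2 = 0 else c • x.1 = 0
    split_ifs with h <;> simp_all

lemma mem_d21Grading_zero {x : D21 K a} : x ∈ d21Grading a 0 ↔ x.2 = 0 := by
  change (if (0 : ZMod 2) = 0 then x.2 = 0 else x.1 = 0) ↔ _
  simp

lemma mem_d21Grading_one {x : D21 K a} : x ∈ d21Grading a 1 ↔ x.1 = 0 := by
  change (if (1 : ZMod 2) = 0 then x.2 = 0 else x.1 = 0) ↔ _
  simp

lemma d21Bracket_fst (x y : D21 K a) :
    (d21Bracket a x y).1 = lie3 x.1 y.1 + oddBracket a x.2 y.2 := rfl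

lemma d21Bracket_snd (x y : D21 K a) :
    (d21Bracket a x y).2 = tensorAct x.1 y.2 - tensorAct y.1 x.2 := rfl

lemma d21Grading_isInternal : DirectSum.IsInternal (d21Grading a) := by
  rw [DirectSum.isInternal_submodule_iff_isCompl (d21Grading a) (i := 0) (j := 1) (by decide)
    (by ext i; revert i; simp only [Set.mem_univ, Set.mem_insert_iff, Set.mem_singleton_iff]; decide)]
  constructor
  · rw [Submodule.disjoint_def]
    intro x h0 h1
    exact Prod.ext ((mem_d21Grading_one a).1 h1) ((mem_d21Grading_zero a).1 h0)
  · rw [codisjoint_iff, eq_top_iff]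
    intro x _
    refine Submodule.mem_sup.2 ⟨((x.1, 0) : (Fin 3 → SL2 K) × ((Fin 3 → Fin 2) → K)),
      (mem_d21Grading_zero a).2 rfl, ((0, x.2) : (Fin 3 → SL2 K) × ((Fin 3 → Fin 2) → K)),
      (mem_d21Grading_one a).2 rfl, Prod.ext ?_ ?_⟩
    · exact add_zero _
    · exact zero_add _

lemma d21_ext {x y : D21 K a} (h1 : x.1 = y.1) (h2 : x.2 = y.2) : x = y := Prod.ext h1 h2

lemma zmod2_cases (i : ZMod 2) : i = 0 ∨ i = 1 := by revert i; decide

lemma d21_add_fst (x y : D21 K a) : (x + y).1 = x.1 + y.1 := rfl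
lemma d21_add_snd (x y : D21 K a) : (x + y).2 = x.2 + y.2 := rfl
lemma d21_zsmul_fst (n : ℤ) (x : D21 K a) : (n • x).1 = n • x.1 := rfl
lemma d21_zsmul_snd (n : ℤ) (x : D21 K a) : (n • x).2 = n • x.2 := rfl
lemma d21_zero_fst : (0 : D21 K a).1 = 0 := rfl
lemma d21_zero_snd : (0 : D21 K a).2 = 0 := rfl

/-- `D(2,1;a)` is a Lie superalgebra. -/
instance : LieSuperalgebra K (D21 K a) where
  grading := d21Grading a
  isInternal := d21Grading_isInternal a
  bracket := d21Bracket a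
  bracket_mem := by
    intro i j x y hx hy
    rcases zmod2_cases i with rfl | rfl <;> rcases zmod2_cases j with rfl | rfl <;>
      simp only [mem_d21Grading_zero, mem_d21Grading_one] at hx hy
    · rw [add_zero, mem_d21Grading_zero, d21Bracket_snd, hx, hy]; simp
    · rw [zero_add, mem_d21Grading_one, d21Bracket_fst, hx, hy]; simp
    · rw [add_zero, mem_d21Grading_one, d21Bracket_fst, hx, hy]; simp
    · rw [show (1 + 1 : ZMod 2) = 0 from rfl, mem_d21Grading_zero, d21Bracket_snd, hx, hy]; simp
  bracket_skew := by
    intro i j x y hx hy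
    have k0 : koszul 0 0 = 1 := by decide
    have k1 : koszul 0 1 = 1 := by decide
    have k2 : koszul 1 0 = 1 := by decide
    have k3 : koszul 1 1 = -1 := by decide
    refine d21_ext a ?_ ?_ <;>
      simp only [d21_add_fst, d21_add_snd, d21_zsmul_fst, d21_zsmul_snd, d21Bracket_fst,
        d21Bracket_snd, d21_zero_fst, d21_zero_snd] <;>
      rcases zmod2_cases i with rfl | rfl <;> rcases zmod2_cases j with rfl | rfl <;>
      simp only [mem_d21Grading_zero, mem_d21Grading_one] at hx hy <;>
      simp [hx, hy, k0, k1, k2, k3, lie3_skew, oddBracket_symm a x.2 y.2]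
  jacobi := by
    intro i j l x y z hx hy hz
    have k0 : koszul 0 0 = 1 := by decide
    have k1 : koszul 0 1 = 1 := by decide
    have k2 : koszul 1 0 = 1 := by decide
    have k3 : koszul 1 1 = -1 := by decide
    refine d21_ext a ?_ ?_ <;>
      simp only [d21_add_fst, d21_add_snd, d21_zsmul_fst, d21_zsmul_snd, d21Bracket_fst,
        d21Bracket_snd, d21_zero_fst, d21_zero_snd] <;>
      rcases zmod2_cases i with rfl | rfl <;> rcases zmod2_cases j with rfl | rfl <;>
      rcases zmod2_cases l with rfl | rfl <;>
      simp only [mem_d21Grading_zero, mem_d21Grading_one] at hx hy hz <;>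
      simp only [hx, hy, hz, k0, k1, k2, k3, map_zero, LinearMap.zero_apply, add_zero, zero_add,
        sub_zero, zero_sub, smul_zero, map_neg, one_smul, neg_smul, neg_zero,
        neg_neg, tensorAct_lie, lie3_jacobi, oddBracket_tensorAct]
    · rw [oddBracket_symm a z.2 (tensorAct x.1 y.2)]; abel
    · rw [oddBracket_symm a x.2 (tensorAct y.1 z.2)]; abel
    · rw [oddBracket_symm a y.2 (tensorAct z.1 x.2)]; abel
    · abel
    · abel
    · abel
    · exact odd_jacobi a x.2 y.2 z.2

end Construction

section Roots
variable {K : Type*} [Field K]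

/-- Roots are given by their integer coordinates in the basis `ε₁, ε₂, ε₃`. The even positive
(`s = 1`) or negative (`s = -1`) roots `2sε₁, 2sε₂, 2sε₃`. -/
def evenRoots (s : ℤˣ) : Set (Fin 3 → ℤ) := {α | ∃ i, α = Pi.single i (2 * (s : ℤ))}

/-- The odd positive (`s = 1`) or negative (`s = -1`) roots `sε₁ ± ε₂ ± ε₃`. -/
def oddRoots (s : ℤˣ) : Set (Fin 3 → ℤ) := {γ | γ 0 = s ∧ ∀ i, γ i = 1 ∨ γ i = -1}

/-- The even roots. -/
def roots₀ : Set (Fin 3 → ℤ) := evenRoots 1 ∪ evenRoots (-1)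

/-- The odd roots. -/
def roots₁ : Set (Fin 3 → ℤ) := oddRoots 1 ∪ oddRoots (-1)

/-- All roots. -/
def roots : Set (Fin 3 → ℤ) := roots₀ ∪ roots₁

/-- The inner product for which `ε₁, ε₂, ε₃` are orthogonal of squares `epsNorm a`. -/
def rootForm (a : K) (α β : Fin 3 → ℤ) : K := ∑ i, epsNorm a i * (α i : K) * (β i : K)

/-- The matrix `diag(1, -1)`. -/
def diagSl : SL2 K :=
  ⟨!![1, 0; 0, -1], by
    change Matrix.traceLinearMap (Fin 2) K K _ = 0
    simp [Matrix.trace_fin_two]⟩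

/-- The Cartan subalgebra, in the coordinates given by the basis of the three even coroots
`H_{2ε₁}, H_{2ε₂}, H_{2ε₃}`; it is embedded in `D(2,1;a)` by `cartanIncl`. -/
abbrev Cartan (K : Type*) : Type _ := Fin 3 → K

/-- The embedding of the Cartan subalgebra, as the triples of diagonal matrices. -/
def cartanIncl (a : K) : Cartan K →ₗ[K] D21 K a where
  toFun c := ((fun i => c i • diagSl, 0) : (Fin 3 → SL2 K) × ((Fin 3 → Fin 2) → K))
  map_add' c d := Prod.ext (funext fun i => add_smul (c i) (d i) diagSl) (add_zero _).symm
  map_smul' r c := Prod.ext (funext fun i => mul_smul r (c i) diagSl) (smul_zero _).symm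

/-- A root as a linear functional on the Cartan subalgebra; `2ε_i` takes the value `2` on
`H_{2ε_i}` and `ε_j` vanishes on it for `j ≠ i`. -/
def rootEval (α : Fin 3 → ℤ) : Cartan K →ₗ[K] K :=
  ∑ i, (α i : K) • LinearMap.proj i

open Classical in
/-- The coroot `H_α`: `H_{±2ε_i} = ±H_{2ε_i}`, and for an odd root `γ`
`H_γ = -∑_i (ε_i, ε_i) γ_i H_{2ε_i}`, so that `H_{-α} = -H_α` for every root. For the simple odd root
`α₁ = ε₁ - ε₂ - ε₃` this is `h₁`, and for `ε₁ + ε₂ - ε₃`, `ε₁ - ε₂ + ε₃`, `ε₁ + ε₂ + ε₃` it is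
`h₁ - h₂`, `h₁ - a h₃`, `h₁ - h₂ - a h₃`, where `h₂ = H_{2ε₂}`, `h₃ = H_{2ε₃}` and
`2 h₁ - h₂ - a h₃ = (1 + a) H_{2ε₁}`. -/
def coroot (a : K) (α : Fin 3 → ℤ) : Cartan K :=
  if α ∈ roots₁ then fun i => -(epsNorm a i * (α i : K)) else fun i => (α i : K) / 2

/-- The subring `ℤ[a]` of `K`. -/
def adjoinZ (a : K) : Subring K := Subring.closure {a}

open LieSuperalgebra in
/-- A Chevalley basis of `D(2,1;a)`. The family `X` is extended by `0` outside the roots; `r` in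
`bracket_X_X` is the length of the descending part of the `α`-string through `β`. -/
structure ChevalleyBasis (a : K) where
  H : Module.Basis (Fin 3) K (Cartan K)
  X : (Fin 3 → ℤ) → D21 K a
  X_eq_zero : ∀ α, α ∉ roots → X α = 0
  X_even : ∀ α ∈ roots₀, X α ∈ grading (K := K) (L := D21 K a) 0
  X_odd : ∀ γ ∈ roots₁, X γ ∈ grading (K := K) (L := D21 K a) 1
  linearIndependent : LinearIndependent K
    (Sum.elim (fun i => cartanIncl a (H i)) (fun α : roots => X α))
  span_eq_top : Submodule.span K
    (Set.range (Sum.elim (fun i => cartanIncl a (H i)) (fun α : roots => X α))) = ⊤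
  span_coroots : Submodule.span (adjoinZ a) (Set.range H) =
    Submodule.span (adjoinZ a) (coroot a '' roots)
  bracket_H_H : ∀ i j, bracket (K := K) (cartanIncl a (H i)) (cartanIncl a (H j)) = 0
  bracket_H_X : ∀ i, ∀ α ∈ roots,
    bracket (K := K) (cartanIncl a (H i)) (X α) = rootEval α (H i) • X α
  bracket_X_neg : ∀ α ∈ roots, α ∉ oddRoots (-1) →
    bracket (K := K) (X α) (X (-α)) = cartanIncl a (coroot a α)
  bracket_X_neg_odd : ∀ α ∈ oddRoots (-1),
    bracket (K := K) (X α) (X (-α)) = -cartanIncl a (coroot a α)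
  bracket_X_X : ∀ α ∈ roots, ∀ β ∈ roots, α + β ≠ 0 → ∃ c : K,
    bracket (K := K) (X α) (X β) = c • X (α + β) ∧
    (α + β ∉ roots → c = 0) ∧
    (α + β ∈ roots → (rootForm a α α ≠ 0 ∨ rootForm a β β ≠ 0) → ∀ r : ℕ,
      IsGreatest {r : ℕ | β - (r : ℤ) • α ∈ roots ∪ {0}} r → c = r + 1 ∨ c = -(r + 1)) ∧
    (α + β ∈ roots → rootForm a α α = 0 → rootForm a β β = 0 →
      c = rootEval β (coroot a α) ∨ c = -rootEval β (coroot a α))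

end Roots

section Enveloping
variable (K : Type*) [CommRing K] (L : Type*) [AddCommGroup L] [Module K L] [LieSuperalgebra K L]

open LieSuperalgebra in
/-- The relations `x y - (-1)^(|x||y|) y x = [x, y]`, for homogeneous `x`, `y`. -/
inductive EnvRel : TensorAlgebra K L → TensorAlgebra K L → Prop
  | of_homogeneous {i j : ZMod 2} {x y : L} (hx : x ∈ grading (K := K) i)
      (hy : y ∈ grading (K := K) j) :
      EnvRel (TensorAlgebra.ι K x * TensorAlgebra.ι K y)
        (koszul i j • (TensorAlgebra.ι K y * TensorAlgebra.ι K x) +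
          TensorAlgebra.ι K (bracket (K := K) x y))

/-- The universal enveloping superalgebra. -/
def Enveloping : Type _ := RingQuot (EnvRel K L)

instance : Ring (Enveloping K L) := inferInstanceAs (Ring (RingQuot (EnvRel K L)))
instance : Algebra K (Enveloping K L) := inferInstanceAs (Algebra K (RingQuot (EnvRel K L)))

/-- The canonical map from the Lie superalgebra to its enveloping algebra. -/
def Enveloping.ι : L →ₗ[K] Enveloping K L :=
  (RingQuot.mkAlgHom K (EnvRel K L)).toLinearMap ∘ₗ TensorAlgebra.ι K

open LieSuperalgebra in
/-- A `ℤ/2`-graded module over a Lie superalgebra, with underlying space `V`. -/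
structure SuperRep (V : Type*) [AddCommGroup V] [Module K V] where
  gradingV : ZMod 2 → Submodule K V
  isInternal : DirectSum.IsInternal gradingV
  act : L →ₗ[K] Module.End K V
  act_mem : ∀ {i j : ZMod 2} {x : L} {v : V}, x ∈ grading (K := K) i → v ∈ gradingV j →
    act x v ∈ gradingV (i + j)
  act_bracket : ∀ {i j : ZMod 2} {x y : L}, x ∈ grading (K := K) i → y ∈ grading (K := K) j →
    act (bracket (K := K) x y) = act x * act y - koszul i j • (act y * act x)

variable {K L} {V : Type*} [AddCommGroup V] [Module K V]

/-- The action of the enveloping superalgebra. -/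
def SuperRep.lift (ρ : SuperRep K L V) : Enveloping K L →ₐ[K] Module.End K V :=
  RingQuot.liftAlgHom K ⟨TensorAlgebra.lift K ρ.act, by
    rintro _ _ ⟨hx, hy⟩
    simp [ρ.act_bracket hx hy]⟩

end Enveloping

section Kostant
variable {K : Type*} [Field K]

/-- The binomial coefficient `y (y - 1) ⋯ (y - n + 1) / n!`. -/
def binom (K : Type*) [Field K] {R : Type*} [Ring R] [Algebra K R] (y : R) (n : ℕ) : R :=
  ((n.factorial : K)⁻¹) • Polynomial.aeval y (descPochhammer K n)

/-- The divided power `y ^ n / n!`. -/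
def divPow (K : Type*) [Field K] {R : Type*} [Ring R] [Algebra K R] (y : R) (n : ℕ) : R :=
  ((n.factorial : K)⁻¹) • y ^ n

/-- The subring `ℤ_a` of `K` generated by the binomial coefficients of the elements of `ℤ[a]`. -/
def Za (a : K) : Subring K :=
  Subring.closure {y | ∃ z ∈ adjoinZ a, ∃ n : ℕ, y = binom K z n}

variable {a : K} (B : ChevalleyBasis a)

/-- `𝔥_{ℤ[a]}`, the `ℤ[a]`-span of `H₁, H₂, H₃`. -/
def ChevalleyBasis.cartanLattice : Submodule (adjoinZ a) (Cartan K) :=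
  Submodule.span (adjoinZ a) (Set.range B.H)

/-- The Kostant superalgebra, generated over `ℤ_a` by the divided powers of the even root vectors,
the odd root vectors, and the binomial coefficients of the elements of `𝔥_{ℤ[a]}`. -/
def ChevalleyBasis.kostant : Subalgebra (Za a) (Enveloping K (D21 K a)) :=
  Algebra.adjoin (Za a)
    ({u | ∃ α ∈ roots₀, ∃ n : ℕ, u = divPow K (Enveloping.ι K _ (B.X α)) n} ∪
     {u | ∃ γ ∈ roots₁, u = Enveloping.ι K _ (B.X γ)} ∪
     {u | ∃ c ∈ B.cartanLattice, ∃ n : ℕ, u = binom K (Enveloping.ι K _ (cartanIncl a c)) n})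

variable {V : Type*} [AddCommGroup V] [Module K V]

/-- The weight space `V_μ`. -/
def weightSpace (ρ : SuperRep K (D21 K a) V) (μ : Cartan K →ₗ[K] K) : Submodule K V where
  carrier := {v | ∀ c : Cartan K, ρ.act (cartanIncl a c) v = μ c • v}
  add_mem' := fun hv hw c => by rw [map_add, hv c, hw c, smul_add]
  zero_mem' := fun c => by rw [map_zero, smul_zero]
  smul_mem' := fun r v hv c => by rw [map_smul, hv c, smul_comm]

/-- Rational modules. -/
structure IsRational (ρ : SuperRep K (D21 K a) V) : Prop where
  iSup_weightSpace : ⨆ μ, weightSpace ρ μ = ⊤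
  weight_H : ∀ μ, weightSpace ρ μ ≠ ⊥ → ∀ i, μ (B.H i) ∈ adjoinZ a
  weight_coroot : ∀ μ, weightSpace ρ μ ≠ ⊥ → ∀ α ∈ roots₀, ∃ n : ℤ, μ (coroot a α) = n

/-- Admissible lattices: `ℤ_a`-spans of a `K`-basis that are stable under the Kostant
superalgebra. -/
structure IsAdmissible (ρ : SuperRep K (D21 K a) V) (M : Submodule (Za a) V) : Prop where
  isLattice : ∃ b : Module.Basis (Fin (Module.finrank K V)) K V,
    M = Submodule.span (Za a) (Set.range b)
  stable : ∀ u ∈ B.kostant, ∀ m ∈ M, ρ.lift u m ∈ M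

variable {B} {ρ : SuperRep K (D21 K a) V} {M : Submodule (Za a) V}

/-- The action of an element of the Kostant superalgebra on an admissible lattice. -/
def IsAdmissible.act (hM : IsAdmissible B ρ M) (u : B.kostant) : Module.End (Za a) M :=
  ((ρ.lift u).restrictScalars (Za a)).restrict fun m hm => hM.stable u u.2 m hm

lemma divPow_mem_kostant (α : roots₀) (n : ℕ) :
    divPow K (Enveloping.ι K _ (B.X α)) n ∈ B.kostant :=
  Algebra.subset_adjoin (Or.inl (Or.inl ⟨α, α.2, n, rfl⟩))

lemma odd_mem_kostant (γ : roots₁) : Enveloping.ι K _ (B.X γ) ∈ B.kostant :=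
  Algebra.subset_adjoin (Or.inl (Or.inr ⟨γ, γ.2, rfl⟩))

end Kostant

section Powers
variable {K : Type*} [Field K] (a : K)

/-- The power series `ℓ^z = ∑_n binom(z, n) (ℓ - 1)^n` over `ℤ_a`, in the variable `ℓ - 1`. -/
def ellPow (z : adjoinZ a) : PowerSeries (Za a) :=
  PowerSeries.mk fun n => ⟨binom K (z : K) n, Subring.subset_closure ⟨z, z.2, n, rfl⟩⟩

/-- `a` as an element of `ℤ[a]`. -/
def adjoinZ.gen : adjoinZ a := ⟨a, Subring.subset_closure rfl⟩

/-- The `ℤ_a`-subalgebra generated by the power series `ℓ^{±a^n}`, `n ≥ 0`. -/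
def ellAlgebra : Subalgebra (Za a) (PowerSeries (Za a)) :=
  Algebra.adjoin (Za a)
    {f | ∃ n : ℕ, f = ellPow a (adjoinZ.gen a ^ n) ∨ f = ellPow a (-(adjoinZ.gen a ^ n))}

variable {a}

lemma binom_eq_choose [CharZero K] (z : K) (n : ℕ) : binom K z n = Ring.choose z n := by
  rw [Ring.choose_eq_smul, binom, ← descPochhammer_map (algebraMap ℤ K),
    Polynomial.aeval_map_algebraMap,    Polynomial.aeval_eq_smeval]

lemma ellPow_add [CharZero K] (z w : adjoinZ a) : ellPow a (z + w) = ellPow a z * ellPow a w := by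
  apply PowerSeries.map_injective (Za a).subtype Subtype.val_injective
  have h (z : adjoinZ a) : PowerSeries.map (Za a).subtype (ellPow a z) =
      PowerSeries.binomialSeries K (z : K) := by
    ext n
    simp [ellPow, binom_eq_choose]
  rw [map_mul, h, h, h, ← PowerSeries.binomialSeries_add]; rfl

lemma ellPow_zero [CharZero K] : ellPow a 0 = 1 := by
  apply PowerSeries.map_injective (Za a).subtype Subtype.val_injective
  have h : PowerSeries.map (Za a).subtype (ellPow a 0) = PowerSeries.binomialSeries K (0 : K) := by
    ext n
    rw [PowerSeries.coeff_map, PowerSeries.binomialSeries_coeff, ← binom_eq_choose]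
    simp [ellPow]
  rw [h, PowerSeries.binomialSeries_zero, map_one]

lemma ellPow_mem [CharZero K] (z : adjoinZ a) : ellPow a z ∈ ellAlgebra a := by
  have hmul (w : adjoinZ a) (hw : ellPow a w ∈ ellAlgebra a) (n : ℕ) :
      ellPow a (n • w) ∈ ellAlgebra a := by
    induction n with
    | zero => rw [zero_smul, ellPow_zero]; exact one_mem _
    | succ n ih => rw [succ_nsmul, ellPow_add]; exact mul_mem ih hw
  have hpoly (p : Polynomial ℤ) : ellPow a (p.aeval (adjoinZ.gen a)) ∈ ellAlgebra a := by
    induction p using Polynomial.induction_on' with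
    | add p q h1 h2 => rw [map_add, ellPow_add]; exact mul_mem h1 h2
    | monomial n c =>
      have e : (Polynomial.monomial n c).aeval (adjoinZ.gen a) = c • adjoinZ.gen a ^ n := by
        rw [Polynomial.aeval_monomial]; simp
      rw [e]
      obtain ⟨m, rfl | rfl⟩ := c.eq_nat_or_neg
      · rw [natCast_zsmul]
        exact hmul _ (Algebra.subset_adjoin ⟨n, Or.inl rfl⟩) m
      · rw [neg_smul, natCast_zsmul, ← smul_neg]
        exact hmul _ (Algebra.subset_adjoin ⟨n, Or.inr rfl⟩) m
  obtain ⟨p, hp⟩ : ∃ p : Polynomial ℤ, p.aeval (adjoinZ.gen a) = z := by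
    obtain ⟨z, hz⟩ := z
    induction hz using Subring.closure_induction with
    | mem x hx => exact ⟨Polynomial.X, by rw [Polynomial.aeval_X]; exact Subtype.ext hx.symm⟩
    | zero => exact ⟨0, map_zero _⟩
    | one => exact ⟨1, map_one _⟩
    | add x y hx hy h1 h2 =>
      obtain ⟨p, hp⟩ := h1; obtain ⟨q, hq⟩ := h2
      exact ⟨p + q, by rw [map_add, hp, hq]; rfl⟩
    | neg x hx h1 => obtain ⟨p, hp⟩ := h1; exact ⟨-p, by rw [map_neg, hp]; rfl⟩
    | mul x y hx hy h1 h2 =>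
      obtain ⟨p, hp⟩ := h1; obtain ⟨q, hq⟩ := h2
      exact ⟨p * q, by rw [map_mul, hp, hq]; rfl⟩
  exact hp ▸ hpoly p

end Powers

section Supergroup
open TensorProduct

/-- `x y = (-1)^(|x||y|) y x` for homogeneous `x`, `y`. -/
def IsSupercommutative {k A : Type*} [CommRing k] [Ring A] [Algebra k A]
    (𝒜 : ZMod 2 → Submodule k A) : Prop :=
  ∀ i j, ∀ x ∈ 𝒜 i, ∀ y ∈ 𝒜 j, x * y = koszul i j • (y * x)

variable {K : Type*} [Field K] {a : K} {B : ChevalleyBasis a}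
  {V : Type*} [AddCommGroup V] [Module K V] {ρ : SuperRep K (D21 K a) V}
  {M : Submodule (Za a) V} (hM : IsAdmissible B ρ M)
  {k : Type*} [CommRing k] [Algebra (Za a) k] {A : Type*} [Ring A] [Algebra k A]
  (𝒜 : ZMod 2 → Submodule k A)

/-- `V_k(A) = A ⊗_k V_k`, where `V_k = k ⊗_{ℤ_a} M`. -/
abbrev IsAdmissible.Points (_hM : IsAdmissible B ρ M) (k : Type*) [CommRing k]
    [Algebra (Za a) k] (A : Type*) [Ring A] [Algebra k A] : Type _ :=
  A ⊗[k] (k ⊗[Za a] M)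

/-- The group of `A`-linear automorphisms of the left `A`-module `V_k(A)`. -/
abbrev IsAdmissible.GL (hM : IsAdmissible B ρ M) (k : Type*) [CommRing k]
    [Algebra (Za a) k] (A : Type*) [Ring A] [Algebra k A] : Type _ :=
  (Module.End A (hM.Points k A))ˣ

/-- The operator `c ⊗ f` on `V_k(A)`, that is, `b ⊗ v ↦ b c ⊗ f v`. When `c` and `f` are homogeneous
of the same parity and `A` is supercommutative, this is `b ⊗ v ↦ (-1)^(|f||b|) c b ⊗ f v`, the usual
action with Koszul sign (`op_koszul` below). -/
def IsAdmissible.op (k : Type*) [CommRing k] [Algebra (Za a) k] {A : Type*} [Ring A] [Algebra k A]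
    (c : A) (f : Module.End (Za a) M) : Module.End A (hM.Points k A) :=
  AlgebraTensorModule.map (LinearMap.toSpanSingleton A A c) (f.baseChange k)

lemma IsAdmissible.op_tmul (c b : A) (f : Module.End (Za a) M) (v : M) :
    hM.op k c f (b ⊗ₜ (1 ⊗ₜ v)) = (b * c) ⊗ₜ (1 ⊗ₜ f v) := by
  simp [IsAdmissible.op]


lemma IsAdmissible.op_koszul (h𝒜 : IsSupercommutative 𝒜) {i j : ZMod 2} {b c : A} (hc : c ∈ 𝒜 i)
    (hb : b ∈ 𝒜 j) (f : Module.End (Za a) M) (v : M) :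
    hM.op k c f (b ⊗ₜ (1 ⊗ₜ v)) = koszul i j • ((c * b) ⊗ₜ (1 ⊗ₜ f v)) := by
  have e : (koszul i j * koszul i j) = 1 := by rw [koszul]; split_ifs <;> rfl
  rw [hM.op_tmul, h𝒜 i j c hc b hb, smul_tmul', smul_smul, e, one_smul]

/-- `x_α(t) = exp(t X_α) = ∑_n t^n X_α^{(n)}` for an even root `α`; only finitely many terms are
nonzero because `X_α` is nilpotent on `V`. -/
def IsAdmissible.xEven (k : Type*) [CommRing k] [Algebra (Za a) k] {A : Type*} [Ring A]
    [Algebra k A] (α : roots₀) (t : A) : Module.End A (hM.Points k A) :=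
  ∑ᶠ n : ℕ, hM.op k (t ^ n) (hM.act ⟨_, divPow_mem_kostant α n⟩)

/-- `x_γ(ϑ) = exp(ϑ X_γ) = 1 + ϑ X_γ` for an odd root `γ`. -/
def IsAdmissible.xOdd (k : Type*) [CommRing k] [Algebra (Za a) k] {A : Type*} [Ring A]
    [Algebra k A] (γ : roots₁) (ϑ : A) : Module.End A (hM.Points k A) :=
  1 + hM.op k ϑ (hM.act ⟨_, odd_mem_kostant γ⟩)

/-- The subgroup `x_α(A)`, `α` an even root. -/
def IsAdmissible.evenOneParam (α : roots₀) : Set (hM.GL k A) :=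
  {g | ∃ t ∈ 𝒜 0, (g : Module.End A (hM.Points k A)) = hM.xEven k α t}

/-- The subgroup `x_γ(A)`, `γ` an odd root. -/
def IsAdmissible.oddOneParam (γ : roots₁) : Set (hM.GL k A) :=
  {g | ∃ ϑ ∈ 𝒜 1, (g : Module.End A (hM.Points k A)) = hM.xOdd k γ ϑ}

/-- The `ℤ`-span of the even coroots. -/
def cartanZ (a : K) : Submodule ℤ (Cartan K) := Submodule.span ℤ (coroot a '' roots₀)

/-- The subgroup `h_H(A)`, `H` in the `ℤ`-span of the even coroots: the operators acting on every
weight space `V_μ` as `t^{μ(H)}`, for a unit `t` of `A₀`. -/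
def IsAdmissible.torusOneParam (c : cartanZ a) : Set (hM.GL k A) :=
  {g | ∃ t : Aˣ, (t : A) ∈ 𝒜 0 ∧ ((t⁻¹ : Aˣ) : A) ∈ 𝒜 0 ∧
    ∀ (μ : Cartan K →ₗ[K] K) (n : ℤ), μ c = n → ∀ m : M, (m : V) ∈ weightSpace ρ μ →
      (g : Module.End A (hM.Points k A)) (1 ⊗ₜ (1 ⊗ₜ m)) = ((t ^ n : Aˣ) : A) ⊗ₜ (1 ⊗ₜ m)}

variable (a) in
/-- The `A`-points of the affine group `P_a`, represented by the scalar extension to `k` of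
`ellAlgebra a`: the morphisms of superalgebras from the latter (which is totally even) to `A`. -/
structure PaPoint where
  hom : k ⊗[Za a] ellAlgebra a →ₐ[k] A
  hom_mem : ∀ r, hom r ∈ 𝒜 0

/-- For a point of `P_a` with `ℓ ↦ t`, the power `t^z`, that is, the image of `ℓ^z`. -/
def PaPoint.pow [CharZero K] {𝒜 : ZMod 2 → Submodule k A} (t : PaPoint a 𝒜) (z : adjoinZ a) : A :=
  t.hom (1 ⊗ₜ ⟨ellPow a z, ellPow_mem z⟩)

/-- The subgroup `h_H^{[a]}(A)`, `H` in `𝔥_{ℤ[a]}`: the operators acting on every weight space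
`V_μ` as `t^{μ(H)}`, for a point `t` of `P_a(A)`. -/
def IsAdmissible.aTorusOneParam [CharZero K] (c : B.cartanLattice) : Set (hM.GL k A) :=
  {g | ∃ t : PaPoint a 𝒜,
    ∀ (μ : Cartan K →ₗ[K] K) (z : adjoinZ a), μ c = z → ∀ m : M, (m : V) ∈ weightSpace ρ μ →
      (g : Module.End A (hM.Points k A)) (1 ⊗ₜ (1 ⊗ₜ m)) = t.pow z ⊗ₜ (1 ⊗ₜ m)}

def IsAdmissible.G₀' : Subgroup (hM.GL k A) :=
  Subgroup.closure ((⋃ c, hM.torusOneParam 𝒜 c) ∪ ⋃ α, hM.evenOneParam 𝒜 α)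

def IsAdmissible.T' : Subgroup (hM.GL k A) :=
  Subgroup.closure (⋃ c, hM.torusOneParam 𝒜 c)

def IsAdmissible.T [CharZero K] : Subgroup (hM.GL k A) :=
  Subgroup.closure ((⋃ c, hM.aTorusOneParam 𝒜 c) ∪ hM.T' 𝒜)

def IsAdmissible.G₀ [CharZero K] : Subgroup (hM.GL k A) :=
  Subgroup.closure ((hM.G₀' 𝒜 : Set (hM.GL k A)) ∪ hM.T 𝒜)

/-- The group `G(A)` of `A`-points of the Chevalley supergroup functor. -/
def IsAdmissible.G [CharZero K] : Subgroup (hM.GL k A) :=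
  Subgroup.closure ((hM.G₀ 𝒜 : Set (hM.GL k A)) ∪ ⋃ γ, hM.oddOneParam 𝒜 γ)

/-- Products of finitely many elements of the odd one-parameter subgroups. -/
def IsAdmissible.G₁ : Set (hM.GL k A) :=
  Submonoid.closure (⋃ γ, hM.oddOneParam 𝒜 γ)

/-- `G₀⁺(A)` for `s = 1` and `G₀⁻(A)` for `s = -1`: finite products of elements `x_α(t)` with `α` even
of sign `s`. -/
def IsAdmissible.G₀pm (s : ℤˣ) : Set (hM.GL k A) :=
  Submonoid.closure (⋃ α, ⋃ (_ : α.1 ∈ evenRoots s), hM.evenOneParam 𝒜 α)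

/-- `G₁⁺(A)` for `s = 1` and `G₁⁻(A)` for `s = -1`. -/
def IsAdmissible.G₁pm (s : ℤˣ) : Set (hM.GL k A) :=
  Submonoid.closure (⋃ γ, ⋃ (_ : γ.1 ∈ oddRoots s), hM.oddOneParam 𝒜 γ)

/-- `G⁺(A)` for `s = 1` and `G⁻(A)` for `s = -1`. -/
def IsAdmissible.Gpm (s : ℤˣ) : Set (hM.GL k A) :=
  Submonoid.closure ((⋃ α, ⋃ (_ : α.1 ∈ evenRoots s), hM.evenOneParam 𝒜 α) ∪
    ⋃ γ, ⋃ (_ : γ.1 ∈ oddRoots s), hM.oddOneParam 𝒜 γ)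

/-- `G₁^<(A)` for the total order on the eight odd roots given by their enumeration `e`: the products
`x_{γ₁}(ϑ₁) ⋯ x_{γ₈}(ϑ₈)` in increasing order. -/
def IsAdmissible.G₁ord (e : Fin 8 ≃ roots₁) : Set (hM.GL k A) :=
  {g | ∃ ϑ : Fin 8 → A, (∀ i, ϑ i ∈ 𝒜 1) ∧
    (g : Module.End A (hM.Points k A)) = (List.ofFn fun i => hM.xOdd k (e i) (ϑ i)).prod}

end Supergroup
end SuperD21

end

open SuperD21
open scoped Pointwise

/-! For odd parameters, `ϑ² = 0` because `A` has no 2-torsion, and `X_γ² = 0` because `2γ` is never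
a root. Hence `x_γ(ϑ) x_γ(η) = x_γ(ϑ + η)`, every odd element is invertible within its own family,
and `G₁(A)` is the subgroup generated by the odd one-parameter elements.

Parts (a) and (b) are normalization statements. If `α` is even and `γ` odd, then `2α + γ` is not a
root, so the commutation formula stops after one term: `x_α(t) x_γ(ϑ) = x_γ(ϑ) x_{α+γ}(±ϑt) x_α(t)`
(`xEven_mul_xOdd`). A toral element only rescales `ϑ`, because `X_γ` shifts weights by `γ`
(`toral_mul_xOdd`); this is checked on weight vectors, which generate the lattice
(`closure_weightVectors`). So `G₀(A)` normalizes `G₁(A)`, which gives (a). For roots of one sign the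
roots `γ` and `α + γ` have the same sign, and the same computation gives (b).

Part (c) needs the commutators of odd elements. These are exact: `x_γ(ϑ) x_δ(η) = x_δ(η) x_γ(ϑ) (1 +
ηϑc X)`, where `X` is an even root vector or a coroot `H_γ`, and `ηϑ` has square zero. The last
factor lies in `G₀(A)` (`opUnit_mem_G₀`): for a root vector it is `x_α(d)`, and for a coroot it is
the toral element given by the point `ℓ ↦ 1 + d` of `P_a`, since `(1 + d)^z = 1 + zd`.

The straightening terminates by nilpotency. An element of `G₁(A)` involves a finite set `S` of odd
parameters, and a product of more than `|S|` of them vanishes. Filter by the spans `J m` of products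
of at least `m` elements of `S`. A generator with parameter in `J m`, multiplied on the right of
`G₀(A)` times an ordered product, either moves left into `G₀(A)` (even case) or is added to the
parameter of its own root (odd case). Both moves leave on the right only factors with parameters in
`J (m + 1)`. Descending induction on `m` (`mul_infinitesimal_subset`) absorbs everything. Inversion
exchanges the two sides and reverses the order. -/

noncomputable section
namespace SuperD21
open TensorProduct LieSuperalgebra

/-! ### Calculus of the operators `c ⊗ f` on `V_k(A)` -/

section Op
variable {K : Type*} [Field K] {a : K} {B : ChevalleyBasis a}
  {V : Type*} [AddCommGroup V] [Module K V] {ρ : SuperRep K (D21 K a) V}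
  {M : Submodule (Za a) V} (hM : IsAdmissible B ρ M)
  {k : Type*} [CommRing k] [Algebra (Za a) k] {A : Type*} [Ring A] [Algebra k A]

/-- The image in `A` of a scalar of `ℤ_a`. -/
def scal (k : Type*) [CommRing k] [Algebra (Za a) k] (A : Type*) [Ring A] [Algebra k A]
    (c : Za a) : A := algebraMap k A (algebraMap (Za a) k c)

lemma scal_commutes (c : Za a) (x : A) : scal k A c * x = x * scal k A c :=
  Algebra.commutes _ _

/-- Scalars multiply from the right, so the coefficient of the operator applied first stands on the
left. This reversal carries the Koszul sign. -/
lemma IsAdmissible.op_mul (c d : A) (f g : Module.End (Za a) M) :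
    hM.op k c f * hM.op k d g = hM.op k (d * c) (f * g) := by
  unfold IsAdmissible.op
  rw [← AlgebraTensorModule.map_mul, LinearMap.baseChange_mul]
  congr 1
  ext
  simp

lemma IsAdmissible.op_one_one : hM.op k (1 : A) 1 = 1 := by
  unfold IsAdmissible.op
  rw [LinearMap.baseChange_one]
  convert AlgebraTensorModule.map_one (R := k) (A := A) (M := A) (N := k ⊗[Za a] M)
  ext
  simp

lemma IsAdmissible.op_add_left (c d : A) (f : Module.End (Za a) M) :
    hM.op k (c + d) f = hM.op k c f + hM.op k d f := by
  unfold IsAdmissible.op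
  rw [← AlgebraTensorModule.map_add_left]
  congr 1
  ext
  simp

lemma IsAdmissible.op_add_right (c : A) (f g : Module.End (Za a) M) :
    hM.op k c (f + g) = hM.op k c f + hM.op k c g := by
  unfold IsAdmissible.op
  rw [← AlgebraTensorModule.map_add_right, LinearMap.baseChange_add]

lemma IsAdmissible.op_smul (c : A) (r : Za a) (f : Module.End (Za a) M) :
    hM.op k c (r • f) = hM.op k (c * scal k A r) f := by
  unfold IsAdmissible.op
  have h1 : (r • f).baseChange k = (algebraMap (Za a) k r) • f.baseChange k := by
    rw [LinearMap.baseChange_smul, algebraMap_smul]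
  have h2 : LinearMap.toSpanSingleton A A (c * scal k A r) =
      (algebraMap (Za a) k r) • LinearMap.toSpanSingleton A A c := by
    ext
    simp [scal, Algebra.smul_def, Algebra.commutes]
  rw [h1, h2, AlgebraTensorModule.map_smul_right, AlgebraTensorModule.map_smul_left]

/-- `op` is additive in the operator. -/
def IsAdmissible.opRight (k : Type*) [CommRing k] [Algebra (Za a) k] {A : Type*} [Ring A]
    [Algebra k A] (c : A) : Module.End (Za a) M →+ Module.End A (hM.Points k A) :=
  AddMonoidHom.mk' (fun f => hM.op k c f) fun f g => hM.op_add_right c f g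


@[simp] lemma IsAdmissible.op_zero_right (c : A) : hM.op k c 0 = 0 := map_zero (hM.opRight k c)

@[simp] lemma IsAdmissible.op_zero_left (f : Module.End (Za a) M) : hM.op k (0 : A) f = 0 := by
  have h := hM.op_smul (k := k) (0 : A) 0 f
  rwa [zero_smul, zero_mul, hM.op_zero_right, eq_comm] at h

lemma IsAdmissible.op_neg_right (c : A) (f : Module.End (Za a) M) :
    hM.op k c (-f) = -hM.op k c f := map_neg (hM.opRight k c) f

lemma IsAdmissible.op_neg_left (c : A) (f : Module.End (Za a) M) :
    hM.op k (-c) f = -hM.op k c f := by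
  have e : -f = (-1 : Za a) • f := LinearMap.ext fun m => by simp
  rw [← hM.op_neg_right, e, hM.op_smul]
  simp [scal]

/-- Additive generators of the lattice suffice, which is the form in which weight vectors are
available. -/
lemma IsAdmissible.hom_ext {φ ψ : Module.End A (hM.Points k A)} (S : Set M)
    (hS : AddSubgroup.closure S = ⊤)
    (h : ∀ m ∈ S, φ (1 ⊗ₜ (1 ⊗ₜ m)) = ψ (1 ⊗ₜ (1 ⊗ₜ m))) : φ = ψ := by
  have h' (m : M) : φ (1 ⊗ₜ (1 ⊗ₜ m)) = ψ (1 ⊗ₜ (1 ⊗ₜ m)) := by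
    have hm : m ∈ AddSubgroup.closure S := hS ▸ AddSubgroup.mem_top m
    induction hm using AddSubgroup.closure_induction with
    | mem x hx => exact h x hx
    | zero => simp
    | add x y _ _ hx hy => simp only [tmul_add, map_add, hx, hy]
    | neg x _ hx => simp only [tmul_neg, map_neg, hx]
  refine LinearMap.ext fun x => ?_
  induction x using TensorProduct.induction_on with
  | zero => simp
  | add x y hx hy => rw [map_add, map_add, hx, hy]
  | tmul b w =>
    induction w using TensorProduct.induction_on with
    | zero => simp
    | add x y hx hy => rw [tmul_add, map_add, map_add, hx, hy]
    | tmul r m =>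
      have e : (b ⊗ₜ[k] (r ⊗ₜ[Za a] m) : A ⊗[k] (k ⊗[Za a] M)) =
          (r • b) • (1 ⊗ₜ[k] (1 ⊗ₜ[Za a] m)) := by
        rw [TensorProduct.smul_tmul', smul_eq_mul, mul_one, TensorProduct.smul_tmul,
          TensorProduct.smul_tmul', smul_eq_mul, mul_one]
      rw [e, map_smul, map_smul, h']

end Op

/-! ### Odd and even elements of a supercommutative algebra -/

section Supercommutative
variable {k A : Type*} [CommRing k] [Ring A] [Algebra k A] {𝒜 : ZMod 2 → Submodule k A}

lemma koszul_zero_left (j : ZMod 2) : koszul 0 j = 1 := by revert j; decide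
lemma koszul_one_one : koszul 1 1 = -1 := by decide

lemma even_commute [GradedAlgebra 𝒜] (h𝒜 : IsSupercommutative 𝒜) {t : A} (ht : t ∈ 𝒜 0) (x : A) :
    t * x = x * t := by
  induction x using DirectSum.Decomposition.inductionOn 𝒜 with
  | zero => simp
  | homogeneous x =>
    rw [h𝒜 _ _ t ht x x.2, koszul_zero_left, one_smul]
  | add x y hx hy => rw [mul_add, add_mul, hx, hy]

lemma odd_anticommute (h𝒜 : IsSupercommutative 𝒜) {x y : A} (hx : x ∈ 𝒜 1) (hy : y ∈ 𝒜 1) :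
    x * y = -(y * x) := by
  rw [h𝒜 1 1 x hx y hy, koszul_one_one, neg_one_smul]

lemma odd_sq (h𝒜 : IsSupercommutative 𝒜) (hA2 : ∀ x : A, 2 * x = 0 → x = 0) {x : A}
    (hx : x ∈ 𝒜 1) : x * x = 0 := by
  refine hA2 _ ?_
  rw [two_mul]
  nth_rewrite 1 [odd_anticommute h𝒜 hx hx]
  exact neg_add_cancel _

lemma scal_mem_mul {K : Type*} [Field K] {a : K} [Algebra (Za a) k] {i : ZMod 2} {x : A}
    (hx : x ∈ 𝒜 i) (c : Za a) : x * scal k A c ∈ 𝒜 i := by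
  rw [← scal_commutes, scal, ← Algebra.smul_def]
  exact (𝒜 i).smul_mem _ hx

end Supercommutative

/-! ### Sums of roots and root strings -/

section RootCombinatorics

lemma mem_roots₁ {γ : Fin 3 → ℤ} : γ ∈ roots₁ ↔ ∀ i, γ i = 1 ∨ γ i = -1 := by
  constructor
  · rintro (h | h) <;> exact h.2
  · intro h
    rcases h 0 with h0 | h0
    · exact Or.inl ⟨by simpa using h0, h⟩
    · exact Or.inr ⟨by simpa using h0, h⟩

lemma mem_roots₀ {α : Fin 3 → ℤ} :
    α ∈ roots₀ ↔ ∃ i, ∃ s : ℤˣ, α = Pi.single i (2 * (s : ℤ)) := by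
  constructor
  · rintro (⟨i, h⟩ | ⟨i, h⟩)
    exacts [⟨i, 1, h⟩, ⟨i, -1, h⟩]
  · rintro ⟨i, s, h⟩
    rcases Int.units_eq_one_or s with rfl | rfl
    exacts [Or.inl ⟨i, h⟩, Or.inr ⟨i, h⟩]

lemma even_apply_of_mem_roots₀ {α : Fin 3 → ℤ} (h : α ∈ roots₀) (j : Fin 3) : Even (α j) := by
  obtain ⟨i, s, rfl⟩ := mem_roots₀.1 h
  by_cases hij : j = i
  · subst hij; simp
  · simp [hij]

lemma odd_apply_of_mem_roots₁ {γ : Fin 3 → ℤ} (h : γ ∈ roots₁) (j : Fin 3) : Odd (γ j) := by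
  rcases mem_roots₁.1 h j with h | h <;> rw [h] <;> decide

lemma mem_roots₁_of_odd {γ : Fin 3 → ℤ} (h : γ ∈ roots) (j : Fin 3) (hj : Odd (γ j)) :
    γ ∈ roots₁ :=
  h.resolve_left fun h0 => Int.not_even_iff_odd.2 hj (even_apply_of_mem_roots₀ h0 j)

lemma mem_roots₀_of_even {γ : Fin 3 → ℤ} (h : γ ∈ roots) (j : Fin 3) (hj : Even (γ j)) :
    γ ∈ roots₀ :=
  h.resolve_right fun h0 => Int.not_even_iff_odd.2 (odd_apply_of_mem_roots₁ h0 j) hj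

lemma notMem_roots₁_of_mem_roots₀ {α : Fin 3 → ℤ} (h : α ∈ roots₀) : α ∉ roots₁ := fun h1 =>
  Int.not_even_iff_odd.2 (odd_apply_of_mem_roots₁ h1 0) (even_apply_of_mem_roots₀ h 0)

lemma units_val_cases (s : ℤˣ) : (s : ℤ) = 1 ∨ (s : ℤ) = -1 := by
  rcases Int.units_eq_one_or s with rfl | rfl <;> simp

/-- If `γ` is an odd root and `α = ±2ε_i` is such that `γ + α` is a root, then the `i`-th
coordinates of `α` and `γ` have opposite signs. -/
lemma apply_eq_neg_of_add_mem_roots {γ : Fin 3 → ℤ} (hγ : γ ∈ roots₁) {i : Fin 3} {s : ℤˣ}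
    (h : Pi.single i (2 * (s : ℤ)) + γ ∈ roots₁) : γ i = -s := by
  have h1 := mem_roots₁.1 h i
  have h2 := mem_roots₁.1 hγ i
  simp only [Pi.add_apply, Pi.single_eq_same] at h1
  rcases units_val_cases s with hs | hs <;> rw [hs] at h1 ⊢ <;> omega

lemma add_mem_roots₁ {α γ : Fin 3 → ℤ} (hα : α ∈ roots₀) (hγ : γ ∈ roots₁)
    (h : α + γ ∈ roots) : α + γ ∈ roots₁ :=
  mem_roots₁_of_odd h 0 ((even_apply_of_mem_roots₀ hα 0).add_odd (odd_apply_of_mem_roots₁ hγ 0))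

lemma add_mem_roots₀ {γ δ : Fin 3 → ℤ} (hγ : γ ∈ roots₁) (hδ : δ ∈ roots₁)
    (h : γ + δ ∈ roots) : γ + δ ∈ roots₀ :=
  mem_roots₀_of_even h 0 ((odd_apply_of_mem_roots₁ hγ 0).add_odd (odd_apply_of_mem_roots₁ hδ 0))

/-- Adding `±2ε_i` to an odd root can only flip its `i`-th coordinate, and the same flip cannot be
made twice. -/
lemma add_add_notMem_roots {α γ : Fin 3 → ℤ} (hα : α ∈ roots₀) (hγ : γ ∈ roots₁)
    (h : α + γ ∈ roots) : α + (α + γ) ∉ roots := by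
  intro h2
  have h1 := add_mem_roots₁ hα hγ h
  have h3 := add_mem_roots₁ hα h1 h2
  obtain ⟨i, s, rfl⟩ := mem_roots₀.1 hα
  have e1 := apply_eq_neg_of_add_mem_roots hγ h1
  have e2 := apply_eq_neg_of_add_mem_roots h1 h3
  simp only [Pi.add_apply, Pi.single_eq_same] at e2
  rcases units_val_cases s with hs | hs <;> omega

/-- Here `γ_i = -s`, and subtracting `r` times `2sε_i` gives the coordinate `-(2r + 1)s`, which is
`±1` only for `r = 0`. -/
lemma isGreatest_zero {α γ : Fin 3 → ℤ} (hα : α ∈ roots₀) (hγ : γ ∈ roots₁)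
    (h : α + γ ∈ roots) :
    IsGreatest {r : ℕ | γ - (r : ℤ) • α ∈ roots ∪ {0}} 0 := by
  refine ⟨by simp [show γ ∈ roots from Or.inr hγ], fun r hr => ?_⟩
  have h1 := add_mem_roots₁ hα hγ h
  have h2 : γ - (r : ℤ) • α ∈ roots₁ := by
    have hodd : Odd ((γ - (r : ℤ) • α) 0) := by
      simp only [Pi.sub_apply, Pi.smul_apply, smul_eq_mul]
      exact (odd_apply_of_mem_roots₁ hγ 0).sub_even ((even_apply_of_mem_roots₀ hα 0).mul_left _)
    rcases hr with hr | hr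
    · exact mem_roots₁_of_odd hr 0 hodd
    · rw [Set.mem_singleton_iff] at hr
      rw [hr] at hodd
      simp at hodd
  obtain ⟨i, s, rfl⟩ := mem_roots₀.1 hα
  have e1 := apply_eq_neg_of_add_mem_roots hγ h1
  have e2 := mem_roots₁.1 h2 i
  simp only [Pi.sub_apply, Pi.smul_apply, Pi.single_eq_same, smul_eq_mul] at e2
  rcases units_val_cases s with hs | hs <;> rw [hs] at e1 e2 <;> omega

/-- The sign of an odd root is its first coordinate. Adding `2sε₁` would turn `s` into `3s`, and the
other even roots do not touch this coordinate. -/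
lemma add_mem_oddRoots {s : ℤˣ} {α γ : Fin 3 → ℤ} (hα : α ∈ evenRoots s) (hγ : γ ∈ oddRoots s)
    (h : α + γ ∈ roots₁) : α + γ ∈ oddRoots s := by
  refine ⟨?_, mem_roots₁.1 h⟩
  obtain ⟨i, rfl⟩ := hα
  have hγ' : γ ∈ roots₁ := mem_roots₁.2 hγ.2
  have e1 := apply_eq_neg_of_add_mem_roots hγ' h
  have hγ0 := hγ.1
  by_cases hi : i = 0
  · subst hi
    rcases units_val_cases s with hs | hs <;> omega
  · simp [Ne.symm hi, hγ.1]

end RootCombinatorics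

/-! ### Values of roots on coroots -/

section Integrality
variable {K : Type*} [Field K] {a : K}

lemma self_mem_adjoinZ : a ∈ adjoinZ a := Subring.subset_closure rfl

lemma adjoinZ_le_Za : adjoinZ a ≤ Za a := fun z hz =>
  Subring.subset_closure ⟨z, hz, 1, by simp [binom]⟩

lemma rootEval_apply (α : Fin 3 → ℤ) (c : Cartan K) : rootEval α c = ∑ i, (α i : K) * c i := by
  simp [rootEval]

variable [CharZero K]

lemma rootEval_coroot_mem_of_even (α : Fin 3 → ℤ) {β : Fin 3 → ℤ} (hβ : β ∈ roots₀) :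
    ∃ n : ℤ, rootEval α (coroot a β) = n := by
  obtain ⟨i, s, rfl⟩ := mem_roots₀.1 hβ
  refine ⟨α i * s, ?_⟩
  rw [rootEval_apply, coroot, if_neg (notMem_roots₁_of_mem_roots₀ hβ), Finset.sum_eq_single i]
  · simp
  · intro j _ hj
    simp [hj]
  · simp

/-- The products `γ_i δ_i` are odd and the squared norms of the `ε_i` sum to zero, so the
denominators 2 cancel. -/
lemma rootEval_coroot_mem_of_odd {γ δ : Fin 3 → ℤ} (hγ : γ ∈ roots₁) (hδ : δ ∈ roots₁) :
    rootEval γ (coroot a δ) ∈ adjoinZ a := by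
  have h (i : Fin 3) : ∃ n : ℤ, (γ i : K) * δ i = 1 + 2 * n := by
    rcases mem_roots₁.1 hγ i with h1 | h1 <;> rcases mem_roots₁.1 hδ i with h2 | h2 <;>
      rw [h1, h2]
    · exact ⟨0, by simp⟩
    · exact ⟨-1, by push_cast; ring⟩
    · exact ⟨-1, by push_cast; ring⟩
    · exact ⟨0, by simp⟩
  obtain ⟨n0, h0⟩ := h 0
  obtain ⟨n1, h1⟩ := h 1
  obtain ⟨n2, h2⟩ := h 2
  have e : rootEval γ (coroot a δ) = ((n0 - n1 : ℤ) : K) + ((n0 - n2 : ℤ) : K) * a := by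
    rw [rootEval_apply, coroot, if_pos hδ, Fin.sum_univ_three]
    simp only [epsNorm, Matrix.cons_val_zero, Matrix.cons_val_one, Matrix.cons_val]
    push_cast
    linear_combination ((1 + a) / 2) * h0 - (1 / 2) * h1 - (a / 2) * h2
  rw [e]
  exact add_mem (intCast_mem _ _) (mul_mem (intCast_mem _ _) self_mem_adjoinZ)

lemma rootEval_coroot_mem {γ β : Fin 3 → ℤ} (hγ : γ ∈ roots₁) (hβ : β ∈ roots) :
    rootEval γ (coroot a β) ∈ adjoinZ a := by
  rcases hβ with hβ | hβ
  · obtain ⟨n, hn⟩ := rootEval_coroot_mem_of_even (a := a) γ hβ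
    rw [hn]
    exact intCast_mem _ _
  · exact rootEval_coroot_mem_of_odd hγ hβ

end Integrality

/-! ### Structure constants of the Chevalley basis -/

section Brackets
variable {K : Type*} [Field K] {a : K} (B : ChevalleyBasis a)

lemma bracket_cartan_X (c : Cartan K) {α : Fin 3 → ℤ} (hα : α ∈ roots) :
    bracket (K := K) (cartanIncl a c) (B.X α) = rootEval α c • B.X α := by
  have h : (bracket (K := K) (L := D21 K a)).flip (B.X α) ∘ₗ cartanIncl a =
      (rootEval α).smulRight (B.X α) :=
    B.H.ext fun i => by simpa using B.bracket_H_X i α hα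
  simpa using LinearMap.congr_fun h c

lemma cartanIncl_mem_grading (c : Cartan K) :
    cartanIncl a c ∈ grading (K := K) (L := D21 K a) 0 := (mem_d21Grading_zero a).2 rfl

lemma coroot_mem_cartanLattice {α : Fin 3 → ℤ} (hα : α ∈ roots) :
    coroot a α ∈ B.cartanLattice := by
  rw [ChevalleyBasis.cartanLattice, B.span_coroots]
  exact Submodule.subset_span ⟨α, hα, rfl⟩

/-- The even root vectors and the coroots of the odd roots. -/
def ChevalleyBasis.evenVectors : Set (D21 K a) :=
  B.X '' roots₀ ∪ (fun γ => cartanIncl a (coroot a γ)) '' roots₁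

variable {B} in
lemma mem_grading_of_mem_evenVectors {x : D21 K a} (hx : x ∈ B.evenVectors) :
    x ∈ grading (K := K) (L := D21 K a) 0 := by
  rcases hx with ⟨α, hα, rfl⟩ | ⟨γ, -, rfl⟩
  · exact B.X_even α hα
  · exact cartanIncl_mem_grading _

variable [CharZero K]

lemma epsNorm_ne_zero (ha0 : a ≠ 0) (ha1 : a ≠ -1) (i : Fin 3) : epsNorm a i ≠ 0 := by
  fin_cases i
  · have : 1 + a ≠ 0 := fun h => ha1 (by linear_combination h)
    simpa [epsNorm, neg_add_eq_zero, div_eq_zero_iff] using fun h : -a + -1 = 0 =>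
      this (by linear_combination -h)
  · simp [epsNorm]
  · simpa [epsNorm] using ha0

lemma rootForm_self_ne_zero (ha0 : a ≠ 0) (ha1 : a ≠ -1) {α : Fin 3 → ℤ} (hα : α ∈ roots₀) :
    rootForm a α α ≠ 0 := by
  obtain ⟨i, s, rfl⟩ := mem_roots₀.1 hα
  rw [rootForm, Finset.sum_eq_single i]
  · have h := epsNorm_ne_zero ha0 ha1 i
    simpa using h
  · intro j _ hj
    simp [hj]
  · simp

/-- All `γ_i²` equal 1 and the squared norms of the `ε_i` sum to zero. -/
lemma rootForm_self_eq_zero {γ : Fin 3 → ℤ} (hγ : γ ∈ roots₁) : rootForm a γ γ = 0 := by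
  have h (i : Fin 3) : (γ i : K) * γ i = 1 := by
    rcases mem_roots₁.1 hγ i with h | h <;> simp [h]
  simp only [rootForm, mul_assoc, h, Fin.sum_univ_three, epsNorm]
  simp
  ring

/-- The bracket of an even and an odd root vector. -/
lemma bracket_even_odd (ha0 : a ≠ 0) (ha1 : a ≠ -1) {α γ : Fin 3 → ℤ} (hα : α ∈ roots₀)
    (hγ : γ ∈ roots₁) : ∃ δ ∈ roots₁, ∃ c : Za a,
      bracket (K := K) (B.X α) (B.X γ) = c • B.X δ ∧
      bracket (K := K) (B.X α) (B.X δ) = 0 ∧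
      ∀ s, α ∈ evenRoots s → γ ∈ oddRoots s → δ ∈ oddRoots s := by
  have hne {γ : Fin 3 → ℤ} (hγ : γ ∈ roots₁) : α + γ ≠ 0 := fun h => by
    have h1 : Odd ((α + γ) 0) :=
      (even_apply_of_mem_roots₀ hα 0).add_odd (odd_apply_of_mem_roots₁ hγ 0)
    rw [h] at h1
    simp at h1
  obtain ⟨c, hc, hc0, hc1, -⟩ := B.bracket_X_X α (Or.inl hα) γ (Or.inr hγ) (hne hγ)
  by_cases h : α + γ ∈ roots
  · have h1 := add_mem_roots₁ hα hγ h
    refine ⟨α + γ, h1, ?_⟩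
    obtain ⟨c', hc', hc'0, -⟩ := B.bracket_X_X α (Or.inl hα) (α + γ) (Or.inr h1) (hne h1)
    -- The descending string has length `r = 0`, so `c = ±1`.
    have e : c ∈ Za a := by
      rcases hc1 h (Or.inl (rootForm_self_ne_zero ha0 ha1 hα)) 0 (isGreatest_zero hα hγ h)
        with rfl | rfl
      · simp
      · simp
    refine ⟨⟨c, e⟩, hc, ?_, fun s hs hs' => add_mem_oddRoots hs hs' h1⟩
    rw [hc', hc'0 (add_add_notMem_roots hα hγ h), zero_smul]
  -- When `α + γ` is not a root the bracket vanishes. Taking `δ = γ` with coefficient 0 keeps the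
  -- sign condition and makes `[X_α, X_δ] = 0` the same fact.
  · refine ⟨γ, hγ, 0, ?_, ?_, fun s _ h => h⟩ <;>
    rw [hc, hc0 h] <;> simp

/-- Opposite roots give `±H_γ`. If `γ + δ` is a root it is even, and both `γ` and `δ` are isotropic,
so the structure constant is `±δ(H_γ)`, an element of `ℤ[a]`. Otherwise the bracket is zero. -/
lemma bracket_odd_odd {γ δ : Fin 3 → ℤ} (hγ : γ ∈ roots₁) (hδ : δ ∈ roots₁) :
    ∃ x ∈ B.evenVectors, ∃ c : Za a, bracket (K := K) (B.X γ) (B.X δ) = c • x := by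
  by_cases h0 : γ + δ = 0
  · obtain rfl : δ = -γ := (neg_eq_of_add_eq_zero_right h0).symm
    refine ⟨_, Or.inr ⟨γ, hγ, rfl⟩, ?_⟩
    by_cases hn : γ ∈ oddRoots (-1)
    · exact ⟨-1, by rw [B.bracket_X_neg_odd γ hn]; simp⟩
    · exact ⟨1, by rw [B.bracket_X_neg γ (Or.inr hγ) hn]; simp⟩
  · obtain ⟨c, hc, hc0, -, hc1⟩ := B.bracket_X_X γ (Or.inr hγ) δ (Or.inr hδ) h0
    by_cases h : γ + δ ∈ roots
    · refine ⟨_, Or.inl ⟨_, add_mem_roots₀ hγ hδ h, rfl⟩, ⟨c, ?_⟩, hc⟩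
      have hm := adjoinZ_le_Za (rootEval_coroot_mem_of_odd (a := a) hδ hγ)
      rcases hc1 h (rootForm_self_eq_zero hγ) (rootForm_self_eq_zero hδ) with rfl | rfl
      exacts [hm, neg_mem hm]
    · exact ⟨_, Or.inr ⟨γ, hγ, rfl⟩, 0, by rw [hc, hc0 h]; simp⟩

lemma bracket_evenVector_odd (ha0 : a ≠ 0) (ha1 : a ≠ -1) {x : D21 K a} (hx : x ∈ B.evenVectors)
    {γ : Fin 3 → ℤ} (hγ : γ ∈ roots₁) :
    ∃ δ ∈ roots₁, ∃ c : Za a, bracket (K := K) x (B.X γ) = c • B.X δ := by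
  rcases hx with ⟨α, hα, rfl⟩ | ⟨δ, hδ, rfl⟩
  · obtain ⟨δ, hδ, c, h, -⟩ := bracket_even_odd B ha0 ha1 hα hγ
    exact ⟨δ, hδ, c, h⟩
  · exact ⟨γ, hγ, ⟨_, adjoinZ_le_Za (rootEval_coroot_mem_of_odd (a := a) hγ hδ)⟩,
      bracket_cartan_X B _ (Or.inr hγ)⟩

end Brackets

/-! ### Root vectors and coroots as operators on the lattice -/

section Operators
variable {K : Type*} [Field K] {a : K} {B : ChevalleyBasis a}
  {V : Type*} [AddCommGroup V] [Module K V] {ρ : SuperRep K (D21 K a) V}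
  {M : Submodule (Za a) V} (hM : IsAdmissible B ρ M)

lemma SuperRep.lift_ι (ρ : SuperRep K (D21 K a) V) (x : D21 K a) :
    ρ.lift (Enveloping.ι K _ x) = ρ.act x := by
  simp only [SuperRep.lift, Enveloping.ι]
  erw [RingQuot.liftAlgHom_mkAlgHom_apply]
  simp

/-- The endomorphism `f` of the lattice is given by the action of `x`. -/
def ActsAs (ρ : SuperRep K (D21 K a) V) {M : Submodule (Za a) V} (f : Module.End (Za a) M)
    (x : D21 K a) : Prop := ∀ m : M, (f m : V) = ρ.act x m

lemma ActsAs.ext {f g : Module.End (Za a) M} {x : D21 K a} (hf : ActsAs ρ f x)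
    (hg : ActsAs ρ g x) : f = g :=
  LinearMap.ext fun m => Subtype.ext (by rw [hf m, hg m])

lemma IsAdmissible.act_apply (u : B.kostant) (m : M) : (hM.act u m : V) = ρ.lift u m := rfl

lemma IsAdmissible.actsAs_odd (γ : roots₁) : ActsAs ρ (hM.act ⟨_, odd_mem_kostant γ⟩) (B.X γ) :=
  fun m => by rw [hM.act_apply, ρ.lift_ι]

lemma IsAdmissible.divPow_apply (α : roots₀) (n : ℕ) (m : M) :
    (hM.act ⟨_, divPow_mem_kostant α n⟩ m : V) =
      ((n.factorial : K)⁻¹) • (ρ.act (B.X α) ^ n) m := by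
  rw [hM.act_apply]
  simp only [divPow, map_smul, map_pow, ρ.lift_ι, LinearMap.smul_apply]

lemma IsAdmissible.actsAs_even (α : roots₀) :
    ActsAs ρ (hM.act ⟨_, divPow_mem_kostant α 1⟩) (B.X α) :=
  fun m => by simp [hM.divPow_apply]

lemma binom_mem_kostant {c : Cartan K} (hc : c ∈ B.cartanLattice) (n : ℕ) :
    binom K (Enveloping.ι K _ (cartanIncl a c)) n ∈ B.kostant :=
  Algebra.subset_adjoin (Or.inr ⟨c, hc, n, rfl⟩)

lemma IsAdmissible.actsAs_cartan {c : Cartan K} (hc : c ∈ B.cartanLattice) :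
    ActsAs ρ (hM.act ⟨_, binom_mem_kostant hc 1⟩) (cartanIncl a c) :=
  fun m => by
    rw [hM.act_apply, ← ρ.lift_ι]
    simp [binom]

lemma IsAdmissible.exists_actsAs (hM : IsAdmissible B ρ M) {x : D21 K a} (hx : x ∈ B.evenVectors) :
    ∃ f : Module.End (Za a) M, ActsAs ρ f x := by
  rcases hx with ⟨α, hα, rfl⟩ | ⟨γ, hγ, rfl⟩
  · exact ⟨_, hM.actsAs_even ⟨α, hα⟩⟩
  · exact ⟨_, hM.actsAs_cartan (coroot_mem_cartanLattice B (Or.inr hγ))⟩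

/-- The module axiom on `V`, restricted to the lattice. The structure constant has to lie in `ℤ_a`
for the identity to make sense there, and it can then be extended to `k`. -/
lemma ActsAs.bracket_eq {f g h : Module.End (Za a) M} {x y z : D21 K a} (hf : ActsAs ρ f x)
    (hg : ActsAs ρ g y) (hh : ActsAs ρ h z) {i j : ZMod 2}
    (hx : x ∈ grading (K := K) i) (hy : y ∈ grading (K := K) j) {c : Za a}
    (hc : bracket (K := K) x y = c • z) : f * g = koszul i j • (g * f) + c • h := by
  refine LinearMap.ext fun m => Subtype.ext ?_
  have e := LinearMap.congr_fun (ρ.act_bracket hx hy) (m : V)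
  have e' : ρ.act (c • z) = (c : K) • ρ.act z := map_smul ρ.act (c : K) z
  rw [hc, e'] at e
  simp only [LinearMap.smul_apply, LinearMap.sub_apply, Module.End.mul_apply] at e
  simp only [Module.End.mul_apply, LinearMap.add_apply, LinearMap.smul_apply, Submodule.coe_add,
    Submodule.coe_smul, hf _, hg _, hh _]
  rw [show (c • ρ.act z (m : V)) = (c : K) • ρ.act z m from rfl, e]
  simp [hf _, hg _]

end Operators

/-! ### Commutation identities in an associative ring -/

section RingIdentities
variable {R : Type*} [Ring R]

/-- In the application `F = ϑX` and `G = dY` with `ϑ² = d² = 0`. Their commutator `Z` contains both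
`ϑ` and `d`, so it is annihilated by `F` and `G` and no higher terms appear. -/
lemma one_add_mul_one_add_of_comm (F G Z : R) (h : F * G = G * F + Z) (hF : F * Z = 0)
    (hG : G * Z = 0) : (1 + F) * (1 + G) = (1 + G) * (1 + F) * (1 + Z) := by
  have e : (1 + G) * (1 + F) * (1 + Z) = 1 + F + G + (G * F + Z) + F * Z + G * Z + G * (F * Z) := by
    noncomm_ring
  rw [e, hF, hG, ← h]
  noncomm_ring

lemma one_add_mul_one_add_of_mul_eq_zero (F G : R) (h : F * G = 0) :
    (1 + F) * (1 + G) = 1 + (F + G) := by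
  have e : (1 + F) * (1 + G) = 1 + (F + G) + F * G := by noncomm_ring
  rw [e, h, add_zero]

lemma pow_succ_mul_of_commute {x y z : R} (h : x * y = y * x + z) (hz : x * z = z * x) (n : ℕ) :
    x ^ (n + 1) * y = y * x ^ (n + 1) + (n + 1 : ℕ) • (z * x ^ n) := by
  induction n with
  | zero => simp [h]
  | succ n ih =>
    have hz' : x * (z * x ^ n) = z * x ^ (n + 1) := by
      rw [← mul_assoc, hz, mul_assoc, ← pow_succ']
    rw [pow_succ' x (n + 1), mul_assoc, ih, mul_add, ← mul_assoc x y, h, mul_smul_comm, hz',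
      succ_nsmul _ (n + 1), add_mul, mul_assoc]
    abel

/-- Model: `F n = tⁿ X_α^{(n)}`, `Y = ϑ X_γ`, and `Z` a multiple of `X_{α+γ}`. Summing the relations
yields `E Y = (Y + Z) E` for the exponential `E`. -/
lemma sum_mul_one_add {F : ℕ → R} {Y Z : R} (h0 : F 0 * Y = Y * F 0)
    (h : ∀ n, F (n + 1) * Y = Y * F (n + 1) + Z * F n) {N : ℕ} (hN : F N = 0) (hYZ : Y * Z = 0) :
    (∑ n ∈ Finset.range N, F n) * (1 + Y) =
      (1 + Y) * (1 + Z) * ∑ n ∈ Finset.range N, F n := by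
  -- The shift from `F (n + 1)` to `F n` costs one term. Both ranges give the same sum because `F N
  -- = 0`.
  have key : (∑ n ∈ Finset.range (N + 1), F n) * Y =
      Y * (∑ n ∈ Finset.range (N + 1), F n) + Z * ∑ n ∈ Finset.range N, F n := by
    rw [Finset.sum_range_succ', add_mul, Finset.sum_mul, h0]
    simp only [h, Finset.sum_add_distrib, mul_add, Finset.mul_sum]
    abel
  rw [Finset.sum_range_succ, hN, add_zero] at key
  rw [mul_add, mul_one, key, one_add_mul_one_add_of_mul_eq_zero _ _ hYZ]
  noncomm_ring

/-- The identity holds without finiteness assumption, as the sum is zero if it is not finite. -/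
lemma finsum_mul_one_add (F : ℕ → R) (Y Z : R) (h0 : F 0 * Y = Y * F 0)
    (h : ∀ n, F (n + 1) * Y = Y * F (n + 1) + Z * F n) (hYZ : Y * Z = 0) :
    (∑ᶠ n, F n) * (1 + Y) = (1 + Y) * (1 + Z) * ∑ᶠ n, F n := by
  by_cases hF : (Function.support F).Finite
  · obtain ⟨N, hN⟩ := hF.bddAbove
    have hsub : Function.support F ⊆ Finset.range (N + 1) := fun n hn => by
      simpa using Nat.lt_succ_of_le (hN hn)
    rw [finsum_eq_sum_of_support_subset F hsub]
    refine sum_mul_one_add h0 h ?_ hYZ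
    by_contra hne
    exact absurd (hN hne) (by omega)
  · rw [finsum_of_infinite_support hF, zero_mul, mul_zero]

end RingIdentities

lemma koszul_symm (i j : ZMod 2) : koszul i j = koszul j i := by
  revert i j; decide

/-! ### Commutation formulas for one-parameter elements -/

section OneParameter
variable {K : Type*} [Field K] {a : K} {B : ChevalleyBasis a}
  {V : Type*} [AddCommGroup V] [Module K V] {ρ : SuperRep K (D21 K a) V}
  {M : Submodule (Za a) V} (hM : IsAdmissible B ρ M)
  {k : Type*} [CommRing k] [Algebra (Za a) k] {A : Type*} [Ring A] [Algebra k A]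
  {𝒜 : ZMod 2 → Submodule k A}

lemma koszul_one_one_smul (f : Module.End (Za a) M) : koszul 1 1 • f = -f :=
  LinearMap.ext fun m => by rw [koszul_one_one]; simp

lemma koszul_zero_left_smul (j : ZMod 2) (f : Module.End (Za a) M) : koszul 0 j • f = f :=
  LinearMap.ext fun m => by rw [koszul_zero_left]; simp

/-- The sign in the superbracket matches the sign in the commutation of `ϑ` and `d`, so the
superbracket becomes an ordinary commutator of operators with coefficient `dϑ`. -/
lemma IsAdmissible.one_add_op_commutator [GradedAlgebra 𝒜] (h𝒜 : IsSupercommutative 𝒜)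
    (hA2 : ∀ x : A, 2 * x = 0 → x = 0)
    {f g h : Module.End (Za a) M} {c : Za a} {j : ZMod 2}
    (hfg : f * g = koszul 1 j • (g * f) + c • h) {ϑ d : A} (hϑ : ϑ ∈ 𝒜 1) (hd : d ∈ 𝒜 j)
    (hd2 : d * d = 0) :
    (1 + hM.op k ϑ f) * (1 + hM.op k d g) =
      (1 + hM.op k d g) * (1 + hM.op k ϑ f) * (1 + hM.op k (d * ϑ * scal k A c) h) := by
  have hcomm : d * ϑ = koszul 1 j • (ϑ * d) := by
    have h1 := h𝒜 j 1 d hd ϑ hϑ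
    rwa [koszul_symm] at h1
  refine one_add_mul_one_add_of_comm (hM.op k ϑ f) (hM.op k d g) _ ?_ ?_ ?_
  · rw [hM.op_mul, hM.op_mul, hfg, hM.op_add_right, hM.op_smul, hcomm]
    rcases zmod2_cases j with rfl | rfl
    · rw [koszul_symm, koszul_zero_left_smul, koszul_zero_left, one_smul]
    -- Both elements are odd: the sign from exchanging `f` and `g` cancels the one from exchanging
    -- `d` and `ϑ`.
    · rw [koszul_one_one_smul, koszul_one_one, neg_one_smul, hM.op_neg_right,
        ← hM.op_neg_left, neg_neg]
  · rw [hM.op_mul, mul_assoc, scal_commutes, ← mul_assoc, mul_assoc d, odd_sq h𝒜 hA2 hϑ, mul_zero,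
      zero_mul, hM.op_zero_left]
  · rw [hM.op_mul, mul_assoc, scal_commutes, ← mul_assoc, hcomm]
    simp only [smul_mul_assoc, mul_assoc, hd2, mul_zero, zero_mul, smul_zero, hM.op_zero_left]

/-- Since `2γ` is not a root, `2 X_γ² = [X_γ, X_γ] = 0`. The factor 2 is removed in `V`, a vector
space in characteristic zero, so no division in the lattice is needed. -/
lemma IsAdmissible.odd_mul_self [CharZero K] (γ : roots₁) :
    hM.act ⟨_, odd_mem_kostant γ⟩ * hM.act ⟨_, odd_mem_kostant γ⟩ = 0 := by
  have hγ := γ.2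
  have h0 : γ.1 + γ.1 ∉ roots := fun h => by
    obtain ⟨i, s, hs⟩ := mem_roots₀.1 (add_mem_roots₀ hγ hγ h)
    -- Any coordinate other than `i` contradicts `2γ = ±2ε_i`: it is `±2` on one side and 0 on the
    -- other.
    have h1 := congrFun hs (i + 1)
    have h2 := mem_roots₁.1 hγ (i + 1)
    rw [Pi.single_eq_of_ne (by simp), Pi.add_apply] at h1
    omega
  have h1 : γ.1 + γ.1 ≠ 0 := fun h => by
    have h1 := congrFun h 0
    have h2 := mem_roots₁.1 hγ 0
    simp only [Pi.add_apply, Pi.zero_apply] at h1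
    omega
  obtain ⟨c, hc, hc0, -⟩ := B.bracket_X_X γ (Or.inr hγ) γ (Or.inr hγ) h1
  have e : bracket (K := K) (B.X γ) (B.X γ) = (0 : Za a) • B.X γ := by
    rw [hc, hc0 h0]; simp
  have h2 := (hM.actsAs_odd γ).bracket_eq (hM.actsAs_odd γ) (hM.actsAs_odd γ) (B.X_odd γ hγ)
    (B.X_odd γ hγ) e
  rw [koszul_one_one_smul, zero_smul, add_zero] at h2
  refine LinearMap.ext fun m => Subtype.ext ?_
  have h3 := congrArg Subtype.val (LinearMap.congr_fun h2 m)
  simp only [LinearMap.neg_apply, Submodule.coe_neg] at h3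
  have h4 : (2 : K) • ((hM.act ⟨_, odd_mem_kostant γ⟩ * hM.act ⟨_, odd_mem_kostant γ⟩) m : V) = 0 := by
    rw [two_smul]
    nth_rewrite 1 [h3]
    exact neg_add_cancel _
  simpa using h4

lemma IsAdmissible.xOdd_mul [CharZero K] (γ : roots₁) (ϑ η : A) :
    hM.xOdd k γ ϑ * hM.xOdd k γ η = hM.xOdd k γ (ϑ + η) := by
  unfold IsAdmissible.xOdd
  rw [hM.op_add_left]
  refine one_add_mul_one_add_of_mul_eq_zero (R := Module.End A (hM.Points k A)) _ _ ?_
  rw [hM.op_mul, hM.odd_mul_self, hM.op_zero_right]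

lemma IsAdmissible.xOdd_zero (γ : roots₁) : hM.xOdd k γ (0 : A) = 1 := by
  unfold IsAdmissible.xOdd
  rw [hM.op_zero_left]
  exact add_zero (1 : Module.End A (hM.Points k A))

/-- `x_γ(ϑ)` as an element of the group `GL(V_k(A))`. -/
def IsAdmissible.xOddUnit [CharZero K] (γ : roots₁) (ϑ : A) : hM.GL k A where
  val := hM.xOdd k γ ϑ
  inv := hM.xOdd k γ (-ϑ)
  val_inv := by rw [hM.xOdd_mul, add_neg_cancel, hM.xOdd_zero]
  inv_val := by rw [hM.xOdd_mul, neg_add_cancel, hM.xOdd_zero]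

/-- The Leibniz rule has only one correction term, because `X_α` commutes with `X_δ`. Its factor `n
+ 1` turns `1/(n+1)!` into `1/n!`, so the identity is integral. -/
lemma IsAdmissible.divPow_succ_mul_odd {α : roots₀} {γ δ : roots₁} {c : Za a} [CharZero K]
    (h1 : bracket (K := K) (B.X α) (B.X γ) = c • B.X δ)
    (h2 : bracket (K := K) (B.X α) (B.X δ) = 0) (n : ℕ) :
    hM.act ⟨_, divPow_mem_kostant α (n + 1)⟩ * hM.act ⟨_, odd_mem_kostant γ⟩ =
      hM.act ⟨_, odd_mem_kostant γ⟩ * hM.act ⟨_, divPow_mem_kostant α (n + 1)⟩ +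
      c • (hM.act ⟨_, odd_mem_kostant δ⟩ * hM.act ⟨_, divPow_mem_kostant α n⟩) := by
  have e1 := ρ.act_bracket (B.X_even α α.2) (B.X_odd γ γ.2)
  have e2 := ρ.act_bracket (B.X_even α α.2) (B.X_odd δ δ.2)
  have e' : ρ.act (c • B.X δ) = (c : K) • ρ.act (B.X δ) := map_smul ρ.act (c : K) (B.X δ)
  rw [h1, e', koszul_zero_left, one_smul, eq_comm, sub_eq_iff_eq_add, add_comm] at e1
  rw [h2, map_zero, koszul_zero_left, one_smul, eq_comm, sub_eq_zero] at e2
  have e3 := pow_succ_mul_of_commute e1 (by rw [mul_smul_comm, smul_mul_assoc, e2]) n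
  refine LinearMap.ext fun m => Subtype.ext ?_
  have e4 := LinearMap.congr_fun e3 (m : V)
  simp only [Module.End.mul_apply, LinearMap.add_apply, LinearMap.smul_apply, Submodule.coe_add,
    Submodule.coe_smul, hM.divPow_apply, hM.actsAs_odd γ _, hM.actsAs_odd δ _, map_smul] at e4 ⊢
  rw [e4, smul_add]
  congr 1
  rw [show (c • ((n.factorial : K)⁻¹ • ρ.act (B.X δ) ((ρ.act (B.X α) ^ n) (m : V))) : V) =
    (c : K) • ((n.factorial : K)⁻¹ • ρ.act (B.X δ) ((ρ.act (B.X α) ^ n) (m : V))) from rfl,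
    ← Nat.cast_smul_eq_nsmul K, smul_smul, smul_smul, smul_smul]
  congr 1
  have hn : (n.factorial : K) ≠ 0 := by exact_mod_cast n.factorial_ne_zero
  have hn' : ((n + 1 : ℕ) : K) ≠ 0 := by exact_mod_cast n.succ_ne_zero
  rw [Nat.factorial_succ, Nat.cast_mul]
  field_simp

lemma IsAdmissible.divPow_zero (α : roots₀) : hM.act ⟨_, divPow_mem_kostant α 0⟩ = 1 :=
  LinearMap.ext fun m => Subtype.ext <| by simp [hM.divPow_apply]

/-- Conjugation by `x_α(t)` sends `X_γ` to `X_γ + t[X_α, X_γ]`, and the two odd factors can be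
separated because `ϑ² = 0`. With `γ = δ` and `c = 0` it says that `x_α(t)` commutes with `x_δ`. -/
lemma IsAdmissible.xEven_mul_xOdd [CharZero K] [GradedAlgebra 𝒜] (h𝒜 : IsSupercommutative 𝒜)
    (hA2 : ∀ x : A, 2 * x = 0 → x = 0) {α : roots₀} {γ δ : roots₁} {c : Za a}
    (h1 : bracket (K := K) (B.X α) (B.X γ) = c • B.X δ)
    (h2 : bracket (K := K) (B.X α) (B.X δ) = 0) {t ϑ : A} (ht : t ∈ 𝒜 0) (hϑ : ϑ ∈ 𝒜 1) :
    hM.xEven k α t * hM.xOdd k γ ϑ =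
      hM.xOdd k γ ϑ * hM.xOdd k δ (ϑ * t * scal k A c) * hM.xEven k α t := by
  have hcomm := even_commute h𝒜 ht
  refine finsum_mul_one_add (fun n : ℕ => hM.op k (t ^ n) (hM.act ⟨_, divPow_mem_kostant α n⟩))
    (hM.op k ϑ (hM.act ⟨_, odd_mem_kostant γ⟩)) _ ?_ (fun n => ?_) ?_
  · rw [hM.divPow_zero, hM.op_mul, hM.op_mul, pow_zero, one_mul, mul_one, one_mul, mul_one]
  · have e : ϑ * t ^ (n + 1) = t ^ (n + 1) * ϑ := (Commute.pow_left (hcomm ϑ) _).symm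
    have e' : t ^ n * (ϑ * t * scal k A c) = ϑ * t ^ (n + 1) * scal k A c := by
      rw [← mul_assoc, ← mul_assoc, (Commute.pow_left (hcomm ϑ) n : t ^ n * ϑ = ϑ * t ^ n),
        mul_assoc ϑ, ← pow_succ]
    rw [hM.op_mul, hM.op_mul, hM.op_mul, hM.divPow_succ_mul_odd h1 h2, hM.op_add_right, hM.op_smul,
      e', e]
  · rw [hM.op_mul, mul_assoc, scal_commutes, ← mul_assoc, mul_assoc ϑ, hcomm, ← mul_assoc,
      odd_sq h𝒜 hA2 hϑ, zero_mul, zero_mul, hM.op_zero_left]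

/-- This identifies the even factors `1 + dX_α` produced by odd commutators as elements of `x_α(A)`.
-/
lemma IsAdmissible.xEven_of_sq_eq_zero {α : roots₀} {d : A} (hd : d * d = 0) :
    hM.xEven k α d = 1 + hM.op k d (hM.act ⟨_, divPow_mem_kostant α 1⟩) := by
  unfold IsAdmissible.xEven
  rw [finsum_eq_sum_of_support_subset (s := Finset.range 2)]
  · rw [Finset.sum_range_succ, Finset.sum_range_one, pow_zero, pow_one, hM.divPow_zero,
      hM.op_one_one]
  · intro n hn
    by_contra h
    refine hn ?_
    obtain ⟨m, rfl⟩ : ∃ m, n = m + 2 := ⟨n - 2, by simp at h; omega⟩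
    beta_reduce
    rw [pow_add, pow_two, hd, mul_zero, hM.op_zero_left]

end OneParameter

/-! ### Splitting a lattice by binomial coefficients of commuting operators -/

section Eigenvectors
variable {K : Type*} [Field K] [CharZero K] {V : Type*} [AddCommGroup V] [Module K V]

lemma binom_apply_of_eigenvector {f : Module.End K V} {z : K} {v : V} (h : f v = z • v) (n : ℕ) :
    binom K f n v = Ring.choose z n • v := by
  rw [← binom_eq_choose, binom, LinearMap.smul_apply,
    Module.End.aeval_apply_of_mem_apply_eq_smul h, binom, smul_smul,
    smul_eq_mul, Polynomial.coe_aeval_eq_eval]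

/-- A combination of the binomial coefficients of `f` acting like `binom (f + c) n`. -/
lemma exists_shifted_binom (f : Module.End K V) (L : AddSubgroup V)
    (hL : ∀ n, ∀ m ∈ L, binom K f n m ∈ L) (c : ℤ) (n : ℕ) :
    ∃ T : V →+ V, (∀ m ∈ L, T m ∈ L) ∧
      ∀ (z : K) (v : V), f v = z • v → T v = Ring.choose (z + c) n • v := by
  -- Vandermonde's identity expands `binom(f + c, n)` in the `binom(f, p)`. The coefficients
  -- `binom(c, q)` are integers, so an additive subgroup is preserved.
  refine ⟨∑ p ∈ Finset.HasAntidiagonal.antidiagonal n, Ring.choose c p.2 • (binom K f p.1).toAddMonoidHom,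
    fun m hm => ?_, fun z v hv => ?_⟩
  · rw [AddMonoidHom.finsetSum_apply]
    exact sum_mem fun p _ => L.zsmul_mem (hL p.1 m hm) _
  · rw [AddMonoidHom.finsetSum_apply, Ring.add_choose_eq n (Commute.all z (c : K)), Finset.sum_smul]
    refine Finset.sum_congr rfl fun p _ => ?_
    have h1 : Ring.choose (c : K) p.2 = ((Ring.choose c p.2 : ℤ) : K) :=
      (Ring.map_choose (Int.castRingHom K) c p.2).symm
    have h2 : (Ring.choose c p.2 • (binom K f p.1).toAddMonoidHom) v =
        Ring.choose c p.2 • binom K f p.1 v := rfl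
    rw [h2, binom_apply_of_eigenvector hv, h1, mul_comm, mul_smul, Int.cast_smul_eq_zsmul]

/-- The operator `binom(f - c, N)` has eigenvalue `binom(j, N)` on `v j`: it kills `v j` for `j < N`
and fixes `v N`. So the top component can be split off, and the rest follows by induction. -/
lemma mem_of_sum_eigenvectors_mem (f : Module.End K V) (L : AddSubgroup V)
    (hL : ∀ n, ∀ m ∈ L, binom K f n m ∈ L) (c : ℤ) {v : ℕ → V}
    (hv : ∀ j : ℕ, f (v j) = ((c + j : ℤ) : K) • v j) (N : ℕ)
    (h : ∑ j ∈ Finset.range N, v j ∈ L) : ∀ j < N, v j ∈ L := by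
  induction N with
  | zero => intro j hj; omega
  | succ N ih =>
    obtain ⟨T, hT, hT'⟩ := exists_shifted_binom f L hL (-c) N
    have e (j : ℕ) : T (v j) = (j.choose N : K) • v j := by
      rw [hT' _ _ (hv j)]
      congr 1
      rw [← Ring.choose_natCast]
      congr 1
      push_cast
      ring
    have hN : v N ∈ L := by
      have := hT _ h
      rw [map_sum, Finset.sum_range_succ, Finset.sum_eq_zero, zero_add, e, Nat.choose_self,
        Nat.cast_one, one_smul] at this
      · exact this
      · intro j hj
        rw [e, Nat.choose_eq_zero_of_lt (Finset.mem_range.1 hj), Nat.cast_zero, zero_smul]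
    rw [Finset.sum_range_succ] at h
    have ih' := ih ((AddSubgroup.add_mem_cancel_right _ hN).1 h)
    intro j hj
    rcases Nat.lt_succ_iff_lt_or_eq.1 hj with hj | rfl
    exacts [ih' j hj, hN]

/-- An additive subgroup stable under the binomial coefficients of an operator that is
diagonalizable with integral eigenvalues is generated by eigenvectors. -/
lemma le_closure_eigenvectors (f : Module.End K V)
    (hf : ⨆ z : ℤ, f.eigenspace (z : K) = ⊤) (L : AddSubgroup V)
    (hL : ∀ n, ∀ m ∈ L, binom K f n m ∈ L) :
    L ≤ AddSubgroup.closure {v | v ∈ L ∧ ∃ z : ℤ, f v = (z : K) • v} := by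
  intro m hm
  have hm' : m ∈ ⨆ z : ℤ, f.eigenspace (z : K) := hf ▸ Submodule.mem_top
  obtain ⟨w, hw, rfl⟩ := (Submodule.mem_iSup_iff_exists_finsupp _ _).1 hm'
  obtain ⟨c, hc⟩ := w.support.bddBelow
  obtain ⟨C, hC⟩ := w.support.bddAbove
  have hv (j : ℕ) : f (w (c + j)) = ((c + j : ℤ) : K) • w (c + j) :=
    Module.End.mem_eigenspace_iff.1 (hw _)
  -- The finitely many eigenvalues lie in an interval starting at `c`; they are renumbered as `c +
  -- j`, with zero components where no eigenvalue occurs.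
  have e : (w.sum fun _ x => x) = ∑ j ∈ Finset.range (C - c + 1).toNat, w (c + j) := by
    rw [Finsupp.sum]
    refine Finset.sum_of_injOn (fun z => (z - c).toNat) ?_ ?_ ?_ ?_
    · intro x hx y hy hxy
      have := hc hx
      have := hc hy
      simp only at hxy
      omega
    · intro x hx
      have := hc hx
      have := hC hx
      simp only [Finset.coe_range, Set.mem_Iio]
      omega
    · intro j _ hj
      by_contra hne
      exact hj ⟨c + j, by simpa using hne, by simp⟩
    · intro x hx
      have := hc hx
      congr 1
      omega
  rw [e] at hm ⊢
  have key := mem_of_sum_eigenvectors_mem f L hL c hv _ hm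
  exact sum_mem fun j hj =>
    AddSubgroup.subset_closure ⟨key j (Finset.mem_range.1 hj), _, hv j⟩

/-- Induction on the set of operators: the vectors of `L` with prescribed eigenvalues for the
operators already treated form a subgroup, stable under the binomial coefficients of the next one by
commutativity. -/
lemma le_closure_joint_eigenvectors {ι : Type*} (f : ι → Module.End K V)
    (hcomm : ∀ i j, Commute (f i) (f j))
    (hf : ∀ i, ⨆ z : ℤ, (f i).eigenspace (z : K) = ⊤) (L : AddSubgroup V)
    (hL : ∀ i n, ∀ m ∈ L, binom K (f i) n m ∈ L) (s : Finset ι) :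
    L ≤ AddSubgroup.closure {v | v ∈ L ∧ ∀ i ∈ s, ∃ z : ℤ, f i v = (z : K) • v} := by
  classical
  induction s using Finset.induction_on with
  | empty => exact fun m hm => AddSubgroup.subset_closure ⟨hm, by simp⟩
  | insert i s _ ih =>
    refine ih.trans ((AddSubgroup.closure_le _).2 ?_)
    rintro v ⟨hv, hz⟩
    choose! z hz using hz
    let L' : AddSubgroup V :=
      { carrier := {v | v ∈ L ∧ ∀ j ∈ s, f j v = (z j : K) • v}
        add_mem' := fun hx hy => ⟨add_mem hx.1 hy.1, fun j hj => by
          rw [map_add, hx.2 j hj, hy.2 j hj, smul_add]⟩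
        zero_mem' := ⟨zero_mem _, fun j _ => by simp⟩
        neg_mem' := fun hx => ⟨neg_mem hx.1, fun j hj => by rw [map_neg, hx.2 j hj, smul_neg]⟩ }
    have hL' (n : ℕ) (m : V) (hm : m ∈ L') : binom K (f i) n m ∈ L' := by
      refine ⟨hL i n m hm.1, fun j hj => ?_⟩
      have h1 : Commute (f j) (binom K (f i) n) := by
        unfold binom
        refine Commute.smul_right ?_ _
        induction descPochhammer K n using Polynomial.induction_on' with
        | add p q hp hq => rw [map_add]; exact hp.add_right hq
        | monomial n c =>
          rw [Polynomial.aeval_monomial]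
          exact (Algebra.commute_algebraMap_right c (f j)).mul_right ((hcomm j i).pow_right n)
      rw [← Module.End.mul_apply, h1.eq, Module.End.mul_apply, hm.2 j hj, map_smul]
    refine AddSubgroup.closure_mono ?_ (le_closure_eigenvectors (f i) (hf i) L' hL' ⟨hv, hz⟩)
    rintro w ⟨hw, hw'⟩
    refine ⟨hw.1, fun j hj => ?_⟩
    rcases Finset.mem_insert.1 hj with rfl | hj
    exacts [hw', ⟨_, hw.2 j hj⟩]

end Eigenvectors

/-! ### Weight vectors generate an admissible lattice -/

section Weights
variable {K : Type*} [Field K] {a : K} {B : ChevalleyBasis a}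
  {V : Type*} [AddCommGroup V] [Module K V] {ρ : SuperRep K (D21 K a) V}
  {M : Submodule (Za a) V}

lemma bracket_cartan_cartan (c d : Cartan K) :
    bracket (K := K) (cartanIncl a c) (cartanIncl a d) = 0 := by
  have h1 (c : Cartan K) : (cartanIncl a c).1 = fun i => c i • diagSl := rfl
  have h2 (c : Cartan K) : (cartanIncl a c).2 = 0 := rfl
  change d21Bracket a _ _ = 0
  refine d21_ext a ?_ ?_
  · rw [d21Bracket_fst, h1, h1, h2, h2, map_zero, add_zero, d21_zero_fst]
    funext i
    simp
  · rw [d21Bracket_snd, h2, h2, map_zero, map_zero, sub_zero, d21_zero_snd]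

lemma lift_binom (x : D21 K a) (n : ℕ) :
    ρ.lift (binom K (Enveloping.ι K _ x) n) = binom K (ρ.act x) n := by
  rw [binom, map_smul, ← Polynomial.aeval_algHom_apply, ρ.lift_ι, binom]

variable [CharZero K]

lemma coroot_single (i : Fin 3) : coroot a (Pi.single i 2) = Pi.single i 1 := by
  rw [coroot, if_neg (notMem_roots₁_of_mem_roots₀ (mem_roots₀.2 ⟨i, 1, by simp⟩))]
  funext j
  by_cases h : j = i
  · subst h; simp
  · simp [h]

lemma single_mem_roots₀ (i : Fin 3) : (Pi.single i 2 : Fin 3 → ℤ) ∈ roots₀ :=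
  mem_roots₀.2 ⟨i, 1, by simp⟩

/-- An admissible lattice is generated by weight vectors. -/
lemma IsAdmissible.closure_weightVectors (hρ : IsRational B ρ) (hM : IsAdmissible B ρ M) :
    AddSubgroup.closure {m : M | ∃ μ, (m : V) ∈ weightSpace ρ μ} = ⊤ := by
  -- The coroots `H_{2ε_i}` form a basis of the Cartan subalgebra and have integral eigenvalues on
  -- `V`, so their joint eigenvectors are weight vectors.
  let f (i : Fin 3) : Module.End K V := ρ.act (cartanIncl a (Pi.single i 1))
  have h1 := le_closure_joint_eigenvectors f (fun i j => ?_) (fun i => ?_) M.toAddSubgroup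
    (fun i n m hm => ?_) Finset.univ
  · have h2 : (AddSubgroup.closure {m : M | ∃ μ, (m : V) ∈ weightSpace ρ μ}).map
        M.toAddSubgroup.subtype = M.toAddSubgroup := by
      refine le_antisymm ?_ (h1.trans ((AddSubgroup.closure_le _).2 ?_))
      · rintro _ ⟨m, -, rfl⟩
        exact m.2
      · rintro v ⟨hv, hz⟩
        choose! z hz using hz
        refine ⟨⟨v, hv⟩, AddSubgroup.subset_closure ⟨∑ i, (z i : K) • LinearMap.proj i, ?_⟩, rfl⟩
        intro c
        have hc : c = ∑ i, c i • (Pi.single i 1 : Cartan K) := by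
          simpa using (Pi.basisFun K (Fin 3)).sum_repr c |>.symm
        conv_lhs => rw [hc]
        simp only [map_sum, map_smul, LinearMap.sum_apply, LinearMap.smul_apply,
          LinearMap.proj_apply, Finset.sum_smul, smul_eq_mul]
        refine Finset.sum_congr rfl fun i _ => ?_
        have := hz i (Finset.mem_univ i)
        simp only [f] at this
        rw [this, smul_smul, mul_comm]
    rw [eq_top_iff]
    intro m _
    have h3 : (m : V) ∈ M.toAddSubgroup := m.2
    rw [← h2] at h3
    obtain ⟨m', hm', h4⟩ := h3
    rwa [← Subtype.ext h4]
  · have e := ρ.act_bracket (cartanIncl_mem_grading (a := a) (Pi.single i 1))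
      (cartanIncl_mem_grading (a := a) (Pi.single j 1))
    rw [bracket_cartan_cartan, map_zero, koszul_zero_left, one_smul, eq_comm, sub_eq_zero] at e
    exact e
  · rw [eq_top_iff, ← hρ.iSup_weightSpace]
    refine iSup_le fun μ => ?_
    by_cases hμ : weightSpace ρ μ = ⊥
    · rw [hμ]; exact bot_le
    · obtain ⟨n, hn⟩ := hρ.weight_coroot μ hμ _ (single_mem_roots₀ i)
      refine le_trans (fun v hv => ?_) (le_iSup _ n)
      rw [Module.End.mem_eigenspace_iff, ← hn, coroot_single]
      exact hv _
  · have h3 := hM.stable _ (binom_mem_kostant (c := Pi.single i 1) (by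
      rw [← coroot_single (a := a)]
      exact coroot_mem_cartanLattice B (Or.inl (single_mem_roots₀ i))) n) m hm
    rwa [lift_binom] at h3

end Weights

/-! ### Toral elements rescale odd parameters -/

section Torus
variable {K : Type*} [Field K] {a : K} {B : ChevalleyBasis a}
  {V : Type*} [AddCommGroup V] [Module K V] {ρ : SuperRep K (D21 K a) V}
  {M : Submodule (Za a) V} (hM : IsAdmissible B ρ M)
  {k : Type*} [CommRing k] [Algebra (Za a) k] {A : Type*} [Ring A] [Algebra k A]
  {𝒜 : ZMod 2 → Submodule k A}

lemma act_mem_weightSpace {γ : Fin 3 → ℤ} (hγ : γ ∈ roots₁) {μ : Cartan K →ₗ[K] K} {v : V}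
    (hv : v ∈ weightSpace ρ μ) : ρ.act (B.X γ) v ∈ weightSpace ρ (μ + rootEval γ) := by
  intro c
  have e := ρ.act_bracket (cartanIncl_mem_grading (a := a) c) (B.X_odd γ hγ)
  rw [bracket_cartan_X B c (Or.inr hγ), koszul_zero_left, one_smul, map_smul] at e
  have e' := LinearMap.congr_fun e v
  simp only [LinearMap.smul_apply, LinearMap.sub_apply, Module.End.mul_apply] at e'
  rw [hv c, map_smul, eq_sub_iff_add_eq] at e'
  rw [← e', LinearMap.add_apply, add_smul, add_comm]

lemma IsAdmissible.op_one_tmul (c b : A) (f : Module.End (Za a) M) (v : M) :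
    (1 + hM.op k c f) (b ⊗ₜ (1 ⊗ₜ v)) = b ⊗ₜ (1 ⊗ₜ v) + (b * c) ⊗ₜ (1 ⊗ₜ f v) := by
  rw [LinearMap.add_apply, hM.op_tmul]
  rfl

lemma zpow_mem_even [GradedAlgebra 𝒜] {t : Aˣ} (ht : (t : A) ∈ 𝒜 0)
    (ht' : ((t⁻¹ : Aˣ) : A) ∈ 𝒜 0) (n : ℤ) : ((t ^ n : Aˣ) : A) ∈ 𝒜 0 := by
  have h {s : A} (hs : s ∈ 𝒜 0) (m : ℕ) : s ^ m ∈ 𝒜 0 := by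
    simpa using SetLike.pow_mem_graded m hs
  obtain ⟨m, rfl | rfl⟩ := n.eq_nat_or_neg
  · simpa using h ht m
  · rw [zpow_neg, zpow_natCast, ← inv_pow, Units.val_pow_eq_pow_val]
    exact h ht' m

lemma mul_mem_odd [GradedAlgebra 𝒜] {ϑ w : A} (hϑ : ϑ ∈ 𝒜 1) (hw : w ∈ 𝒜 0) : ϑ * w ∈ 𝒜 1 := by
  simpa using SetLike.mul_mem_graded hϑ hw

lemma mul_mem_even [GradedAlgebra 𝒜] {ϑ η : A} (hϑ : ϑ ∈ 𝒜 1) (hη : η ∈ 𝒜 1) : ϑ * η ∈ 𝒜 0 :=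
  SetLike.mul_mem_graded hϑ hη

lemma exists_int_of_mem_cartanZ (hρ : IsRational B ρ) {c : Cartan K} (hc : c ∈ cartanZ a)
    {μ : Cartan K →ₗ[K] K} (hμ : weightSpace ρ μ ≠ ⊥) : ∃ n : ℤ, μ c = n := by
  induction hc using Submodule.span_induction with
  | mem x hx =>
    obtain ⟨α, hα, rfl⟩ := hx
    exact hρ.weight_coroot μ hμ α hα
  | zero => exact ⟨0, by simp⟩
  | add x y _ _ hx hy =>
    obtain ⟨n, hn⟩ := hx
    obtain ⟨m, hm⟩ := hy
    exact ⟨n + m, by rw [map_add, hn, hm]; push_cast; rfl⟩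
  | smul r x _ hx =>
    obtain ⟨n, hn⟩ := hx
    exact ⟨r * n, by rw [map_zsmul, hn, zsmul_eq_mul]; push_cast; rfl⟩

lemma weight_mem_adjoinZ (hρ : IsRational B ρ) {c : Cartan K} (hc : c ∈ B.cartanLattice)
    {μ : Cartan K →ₗ[K] K} (hμ : weightSpace ρ μ ≠ ⊥) : ∃ z : adjoinZ a, μ c = z := by
  induction hc using Submodule.span_induction with
  | mem x hx =>
    obtain ⟨i, rfl⟩ := hx
    exact ⟨⟨_, hρ.weight_H μ hμ i⟩, rfl⟩
  | zero => exact ⟨0, by simp⟩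
  | add x y _ _ hx hy =>
    obtain ⟨n, hn⟩ := hx
    obtain ⟨m, hm⟩ := hy
    exact ⟨n + m, by rw [map_add, hn, hm]; rfl⟩
  | smul r x _ hx =>
    obtain ⟨n, hn⟩ := hx
    exact ⟨r * n, by
      rw [show r • x = (r : K) • x from rfl, map_smul, hn]; rfl⟩

variable [CharZero K]

/-- On a vector of weight `μ` the two sides differ only in the component of weight `μ + γ`, with
coefficients `ϑ u(μ + γ)` and `u(μ) η`. These need to agree only when both weights occur. -/
lemma IsAdmissible.toral_mul_xOdd (hρ : IsRational B ρ) {g : Module.End A (hM.Points k A)}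
    {u : (Cartan K →ₗ[K] K) → A}
    (hg : ∀ μ, weightSpace ρ μ ≠ ⊥ → ∀ m : M, (m : V) ∈ weightSpace ρ μ →
      g (1 ⊗ₜ (1 ⊗ₜ m)) = u μ ⊗ₜ (1 ⊗ₜ m))
    (γ : roots₁) {ϑ η : A}
    (hu : ∀ μ, weightSpace ρ μ ≠ ⊥ → weightSpace ρ (μ + rootEval γ) ≠ ⊥ →
      ϑ * u (μ + rootEval γ) = u μ * η) :
    g * hM.xOdd k γ ϑ = hM.xOdd k γ η * g := by
  refine hM.hom_ext _ (hM.closure_weightVectors hρ) ?_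
  rintro m ⟨μ, hm⟩
  by_cases h0 : m = 0
  · subst h0; simp
  have hμ : weightSpace ρ μ ≠ ⊥ := fun h => h0 <| Subtype.ext <| by
    rw [h] at hm; simpa using hm
  have hg' (b : A) (ν) (hν : weightSpace ρ ν ≠ ⊥) (m : M) (hm : (m : V) ∈ weightSpace ρ ν) :
      g (b ⊗ₜ (1 ⊗ₜ m)) = (b * u ν) ⊗ₜ (1 ⊗ₜ m) := by
    have e : (b ⊗ₜ[k] (1 ⊗ₜ[Za a] m) : A ⊗[k] (k ⊗[Za a] M)) = b • (1 ⊗ₜ[k] (1 ⊗ₜ[Za a] m)) := by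
      rw [TensorProduct.smul_tmul', smul_eq_mul, mul_one]
    rw [e, map_smul, hg ν hν m hm, TensorProduct.smul_tmul', smul_eq_mul]
  rw [Module.End.mul_apply, Module.End.mul_apply, hg μ hμ m hm, IsAdmissible.xOdd,
    IsAdmissible.xOdd, hM.op_one_tmul, hM.op_one_tmul, map_add, hg μ hμ m hm, one_mul]
  congr 1
  have hm' := act_mem_weightSpace γ.2 hm (B := B)
  rw [← hM.actsAs_odd γ m] at hm'
  by_cases h1 : hM.act ⟨_, odd_mem_kostant γ⟩ m = 0
  · rw [h1]; simp
  · rw [hg' _ _ (fun h => h1 <| Subtype.ext <| by rw [h] at hm'; simpa using hm') _ hm', hu μ hμ]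
    exact fun h => h1 <| Subtype.ext <| by rw [h] at hm'; simpa using hm'

lemma exists_int_rootEval (γ : Fin 3 → ℤ) {c : Cartan K} (hc : c ∈ cartanZ a) :
    ∃ n : ℤ, rootEval γ c = n := by
  induction hc using Submodule.span_induction with
  | mem x hx =>
    obtain ⟨α, hα, rfl⟩ := hx
    exact rootEval_coroot_mem_of_even γ hα
  | zero => exact ⟨0, by simp⟩
  | add x y _ _ hx hy =>
    obtain ⟨n, hn⟩ := hx
    obtain ⟨m, hm⟩ := hy
    exact ⟨n + m, by rw [map_add, hn, hm]; push_cast; rfl⟩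
  | smul r x _ hx =>
    obtain ⟨n, hn⟩ := hx
    exact ⟨r * n, by rw [map_zsmul, hn, zsmul_eq_mul]; push_cast; rfl⟩

/-- The values of `γ` are known on coroots, so the lattice is first rewritten as the span of the
coroots. -/
lemma rootEval_mem_adjoinZ {γ : Fin 3 → ℤ} (hγ : γ ∈ roots₁) {c : Cartan K}
    (hc : c ∈ B.cartanLattice) : ∃ z : adjoinZ a, rootEval γ c = z := by
  rw [ChevalleyBasis.cartanLattice, B.span_coroots] at hc
  induction hc using Submodule.span_induction with
  | mem x hx =>
    obtain ⟨α, hα, rfl⟩ := hx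
    exact ⟨⟨_, rootEval_coroot_mem hγ hα⟩, rfl⟩
  | zero => exact ⟨0, by simp⟩
  | add x y _ _ hx hy =>
    obtain ⟨n, hn⟩ := hx
    obtain ⟨m, hm⟩ := hy
    exact ⟨n + m, by rw [map_add, hn, hm]; rfl⟩
  | smul r x _ hx =>
    obtain ⟨n, hn⟩ := hx
    exact ⟨r * n, by
      rw [show r • x = (r : K) • x from rfl, map_smul, hn]; rfl⟩

/-- The factor is `w = t^{γ(H)}`. Its inverse `w'` is recorded because conjugation by `g⁻¹` is
needed as well. -/
lemma IsAdmissible.torus_mul_xOdd (hρ : IsRational B ρ) [GradedAlgebra 𝒜]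
    (h𝒜 : IsSupercommutative 𝒜) {c : cartanZ a} {g : hM.GL k A} (hg : g ∈ hM.torusOneParam 𝒜 c)
    (γ : roots₁) : ∃ w ∈ 𝒜 0, ∃ w' ∈ 𝒜 0, w' * w = 1 ∧ ∀ ϑ,
      (g : Module.End A (hM.Points k A)) * hM.xOdd k γ ϑ = hM.xOdd k γ (ϑ * w) * g := by
  obtain ⟨t, ht, ht', hg⟩ := hg
  obtain ⟨j, hj⟩ := exists_int_rootEval γ.1 c.2
  refine ⟨_, zpow_mem_even ht ht' j, _, zpow_mem_even ht ht' (-j), ?_, fun ϑ => ?_⟩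
  · rw [← Units.val_mul, ← zpow_add, neg_add_cancel, zpow_zero, Units.val_one]
  -- For `μ` that is not a weight, `n μ` is an arbitrary value; `toral_mul_xOdd` only looks at
  -- weights that occur.
  · choose! n hn using fun μ (hμ : weightSpace ρ μ ≠ ⊥) => exists_int_of_mem_cartanZ hρ c.2 hμ
    refine hM.toral_mul_xOdd hρ (u := fun μ => ((t ^ n μ : Aˣ) : A))
      (fun μ hμ m hm => hg μ _ (hn μ hμ) m hm) γ fun μ hμ hμ' => ?_
    have e : n (μ + rootEval γ) = n μ + j := by
      have := hn _ hμ'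
      rw [LinearMap.add_apply, hn μ hμ, hj] at this
      exact_mod_cast this.symm
    rw [e, zpow_add, Units.val_mul, ← mul_assoc, ← mul_assoc,
      even_commute h𝒜 (zpow_mem_even ht ht' _)]

lemma PaPoint.pow_add (t : PaPoint a 𝒜) (z w : adjoinZ a) : t.pow (z + w) = t.pow z * t.pow w := by
  unfold PaPoint.pow
  rw [← map_mul, Algebra.TensorProduct.tmul_mul_tmul, one_mul]
  congr 3
  exact ellPow_add z w

lemma PaPoint.pow_zero (t : PaPoint a 𝒜) : t.pow 0 = 1 := by
  unfold PaPoint.pow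
  rw [← map_one t.hom, Algebra.TensorProduct.one_def]
  congr 3
  exact ellPow_zero

lemma PaPoint.pow_mem (t : PaPoint a 𝒜) (z : adjoinZ a) : t.pow z ∈ 𝒜 0 := t.hom_mem _

lemma IsAdmissible.aTorus_mul_xOdd (hρ : IsRational B ρ) [GradedAlgebra 𝒜]
    (h𝒜 : IsSupercommutative 𝒜) {c : B.cartanLattice} {g : hM.GL k A}
    (hg : g ∈ hM.aTorusOneParam 𝒜 c) (γ : roots₁) : ∃ w ∈ 𝒜 0, ∃ w' ∈ 𝒜 0, w' * w = 1 ∧ ∀ ϑ,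
      (g : Module.End A (hM.Points k A)) * hM.xOdd k γ ϑ = hM.xOdd k γ (ϑ * w) * g := by
  obtain ⟨t, hg⟩ := hg
  obtain ⟨j, hj⟩ := rootEval_mem_adjoinZ γ.2 c.2
  refine ⟨_, t.pow_mem j, _, t.pow_mem (-j), ?_, fun ϑ => ?_⟩
  · rw [← t.pow_add, neg_add_cancel, t.pow_zero]
  · choose! n hn using fun μ (hμ : weightSpace ρ μ ≠ ⊥) => weight_mem_adjoinZ hρ c.2 hμ
    refine hM.toral_mul_xOdd hρ (u := fun μ => t.pow (n μ))
      (fun μ hμ m hm => hg μ _ (hn μ hμ) m hm) γ fun μ hμ hμ' => ?_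
    have e : n (μ + rootEval γ) = n μ + j := by
      have := hn _ hμ'
      rw [LinearMap.add_apply, hn μ hμ, hj] at this
      exact Subtype.ext this.symm
    rw [e, t.pow_add, ← mul_assoc, ← mul_assoc, even_commute h𝒜 (t.pow_mem _)]

end Torus

/-! ### Points of `P_a` infinitely near the identity -/

section TangentPoint
variable {K : Type*} [Field K] {a : K}
  {k : Type*} [CommRing k] [Algebra (Za a) k] {A : Type*} [Ring A] [Algebra k A]
  {𝒜 : ZMod 2 → Submodule k A}

lemma scal_mul (c d : Za a) : scal k A (c * d) = scal k A c * scal k A d := by simp [scal]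
lemma scal_add (c d : Za a) : scal k A (c + d) = scal k A c + scal k A d := by simp [scal]

/-- The evaluation of power series at an element of square zero. -/
def evalSqZero (k : Type*) [CommRing k] [Algebra (Za a) k] {A : Type*} [Ring A] [Algebra k A]
    (d : A) (hd : d * d = 0) : PowerSeries (Za a) →+* A where
  toFun f := scal k A (PowerSeries.coeff 0 f) + scal k A (PowerSeries.coeff 1 f) * d
  map_one' := by simp [scal, PowerSeries.coeff_one]
  map_zero' := by simp [scal]
  map_add' f g := by simp only [map_add, scal_add, add_mul]; abel
  map_mul' f g := by
    have h1 : PowerSeries.coeff 1 (f * g) = PowerSeries.coeff 0 f * PowerSeries.coeff 1 g +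
        PowerSeries.coeff 1 f * PowerSeries.coeff 0 g := by
      rw [PowerSeries.coeff_mul]
      simp [Finset.Nat.antidiagonal_succ]
    have h0 : PowerSeries.coeff 0 (f * g) = PowerSeries.coeff 0 f * PowerSeries.coeff 0 g := by
      simp
    have h2 : scal k A (PowerSeries.coeff 1 f) * d * (scal k A (PowerSeries.coeff 1 g) * d) = 0 := by
      rw [mul_assoc, ← mul_assoc d, ← scal_commutes, mul_assoc, hd, mul_zero, mul_zero]
    rw [h0, h1, scal_add, scal_mul, scal_mul, scal_mul, mul_add, add_mul, add_mul, add_mul, h2,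
      add_zero, mul_assoc _ d, ← scal_commutes _ d]
    simp only [mul_assoc]
    abel

/-- The point `ℓ ↦ 1 + d` of `P_a(A)`, for an even element `d` of square zero. -/
def tangentPoint (d : A) (hd0 : d ∈ 𝒜 0) (hd : d * d = 0) [GradedAlgebra 𝒜] : PaPoint a 𝒜 :=
  letI : Algebra (Za a) A := Algebra.compHom A (algebraMap (Za a) k)
  haveI : IsScalarTower (Za a) k A := IsScalarTower.of_algebraMap_eq fun _ => rfl
  let φ : ellAlgebra a →ₐ[Za a] A :=
    AlgHom.comp { evalSqZero k d hd with
      commutes' := fun r => by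
        change scal k A _ + scal k A _ * d = scal k A r
        simp [scal, PowerSeries.coeff_C] } (ellAlgebra a).val
  { hom := Algebra.TensorProduct.lift (Algebra.ofId k A) φ fun _ _ => Algebra.commutes _ _
    hom_mem := fun r => by
      induction r using TensorProduct.induction_on with
      | zero => simp
      | add x y hx hy => rw [map_add]; exact add_mem hx hy
      | tmul x y =>
        change algebraMap k A x * (scal k A _ + scal k A _ * d) ∈ 𝒜 0
        rw [← Algebra.smul_def, scal_commutes]
        refine (𝒜 0).smul_mem _ ?_
        refine add_mem ?_ (scal_mem_mul hd0 _)
        simpa using scal_mem_mul (k := k) (SetLike.GradedOne.one_mem (A := 𝒜)) _ }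

/-- The series is cut off after its linear term, and `binom(z, 1) = z`. So this point acts on weight
`μ` by `1 + μ(H)d`, that is, as `1 + dH`. -/
lemma tangentPoint_pow [CharZero K] (d : A) (hd0 : d ∈ 𝒜 0) (hd : d * d = 0) [GradedAlgebra 𝒜]
    (z : adjoinZ a) : (tangentPoint d hd0 hd).pow z =
      1 + scal k A ⟨(z : K), adjoinZ_le_Za z.2⟩ * d := by
  have e : (tangentPoint d hd0 hd).pow z = algebraMap k A 1 *
      (scal k A (PowerSeries.coeff 0 (ellPow a z)) +
        scal k A (PowerSeries.coeff 1 (ellPow a z)) * d) := rfl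
  rw [e, map_one, one_mul]
  have h0 : PowerSeries.coeff 0 (ellPow a z) = 1 := Subtype.ext (by simp [ellPow, binom])
  have h1 : PowerSeries.coeff 1 (ellPow a z) = ⟨(z : K), adjoinZ_le_Za z.2⟩ :=
    Subtype.ext (by simp [ellPow, binom])
  rw [h0, h1]
  congr 1
  simp [scal]

end TangentPoint

/-! ### Products with a normalized subgroup -/

section Groups
variable {G : Type*} [Group G]

lemma submonoidClosure_eq_closure {S : Set G} (hS : ∀ s ∈ S, s⁻¹ ∈ S) :
    (Submonoid.closure S : Set G) = Subgroup.closure S := by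
  have h : S⁻¹ = S := Set.ext fun x =>
    ⟨fun hx => by simpa using hS _ hx, fun hx => hS _ hx⟩
  rw [← Subgroup.coe_toSubmonoid, Subgroup.closure_toSubmonoid, h, Set.union_self]

/-- Conjugation by `g` could map the subgroup strictly into itself, so generators are tested against
both `g` and `g⁻¹`. -/
lemma mem_normalizer_closure {S : Set G} {g : G}
    (h1 : ∀ s ∈ S, g * s * g⁻¹ ∈ Subgroup.closure S)
    (h2 : ∀ s ∈ S, g⁻¹ * s * g ∈ Subgroup.closure S) :
    g ∈ Subgroup.normalizer (Subgroup.closure S : Set G) := by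
  have key {g : G} (h : ∀ s ∈ S, g * s * g⁻¹ ∈ Subgroup.closure S) {n : G}
      (hn : n ∈ Subgroup.closure S) : g * n * g⁻¹ ∈ Subgroup.closure S := by
    have : Subgroup.closure S ≤ (Subgroup.closure S).comap (MulAut.conj g).toMonoidHom :=
      (Subgroup.closure_le _).2 fun s hs => by simpa using h s hs
    simpa using this hn
  rw [Subgroup.mem_normalizer_iff]
  refine fun n => ⟨key h1, fun hn => ?_⟩
  have := key (g := g⁻¹) (by simpa using h2) hn
  simpa [mul_assoc] using this

/-- Only `S` is closed under inverses, so `E` generates just a monoid. This fits `G₀^±(A)`, which is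
defined by finite products. -/
lemma closure_union_eq_mul {E S : Set G} (hS : ∀ s ∈ S, s⁻¹ ∈ S)
    (hE : E ⊆ (Subgroup.normalizer (Subgroup.closure S : Set G) : Set G)) :
    (Submonoid.closure (E ∪ S) : Set G) =
        (Submonoid.closure E : Set G) * (Submonoid.closure S : Set G) ∧
      (Submonoid.closure (E ∪ S) : Set G) =
        (Submonoid.closure S : Set G) * (Submonoid.closure E : Set G) := by
  have hE' {e : G} (he : e ∈ Submonoid.closure E) : e ∈ Subgroup.normalizer (Subgroup.closure S : Set G) :=
    (Submonoid.closure_le (S := (Subgroup.normalizer (Subgroup.closure S : Set G)).toSubmonoid)).2 hE he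
  have hN {n : G} : n ∈ Submonoid.closure S ↔ n ∈ Subgroup.closure S := by
    have := Set.ext_iff.1 (submonoidClosure_eq_closure hS) n
    exact this
  have h1 : (Submonoid.closure E : Set G) * (Submonoid.closure S : Set G) ⊆
      Submonoid.closure (E ∪ S) := by
    rintro _ ⟨e, he, n, hn, rfl⟩
    exact mul_mem (Submonoid.closure_mono Set.subset_union_left he)
      (Submonoid.closure_mono Set.subset_union_right hn)
  have h2 : (Submonoid.closure S : Set G) * (Submonoid.closure E : Set G) ⊆
      Submonoid.closure (E ∪ S) := by
    rintro _ ⟨e, he, n, hn, rfl⟩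
    exact mul_mem (Submonoid.closure_mono Set.subset_union_right he)
      (Submonoid.closure_mono Set.subset_union_left hn)
  have h3 : (Submonoid.closure (E ∪ S) : Set G) ⊆
      (Submonoid.closure E : Set G) * (Submonoid.closure S : Set G) := by
    intro x hx
    induction hx using Submonoid.closure_induction with
    | mem x hx =>
      rcases hx with hx | hx
      · exact ⟨x, Submonoid.subset_closure hx, 1, one_mem _, mul_one x⟩
      · exact ⟨1, one_mem _, x, Submonoid.subset_closure hx, one_mul x⟩
    | one => exact ⟨1, one_mem _, 1, one_mem _, mul_one 1⟩
    | mul x y _ _ hx hy =>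
      obtain ⟨e, he, n, hn, rfl⟩ := hx
      obtain ⟨e', he', n', hn', rfl⟩ := hy
      -- Regrouping: `e n e' n' = (e e') (e'⁻¹ n e') n'`.
      refine ⟨e * e', mul_mem he he', e'⁻¹ * n * e' * n', mul_mem ?_ hn', by simp [mul_assoc]⟩
      have h4 := (Subgroup.mem_normalizer_iff.1 (inv_mem (hE' he')) n).1 (hN.1 hn)
      rw [inv_inv] at h4
      exact hN.2 h4
  refine ⟨h3.antisymm h1, Set.Subset.antisymm (h3.trans ?_) h2⟩
  rintro _ ⟨e, he, n, hn, rfl⟩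
  exact ⟨e * n * e⁻¹, hN.2 ((Subgroup.mem_normalizer_iff.1 (hE' he) n).1 (hN.1 hn)), e, he,
    by simp⟩

end Groups

/-! ### `G₀(A)` normalizes `G₁(A)`: parts (a) and (b) -/

section Normalization
variable {K : Type*} [Field K] [CharZero K] {a : K} {B : ChevalleyBasis a}
  {V : Type*} [AddCommGroup V] [Module K V] {ρ : SuperRep K (D21 K a) V}
  {M : Submodule (Za a) V} (hM : IsAdmissible B ρ M)
  {k : Type*} [CommRing k] [Algebra (Za a) k] {A : Type*} [Ring A] [Algebra k A]
  (𝒜 : ZMod 2 → Submodule k A)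

/-- The odd one-parameter elements for the roots in `P`. -/
def IsAdmissible.oddElements (P : Set (Fin 3 → ℤ)) : Set (hM.GL k A) :=
  {g | ∃ γ : roots₁, γ.1 ∈ P ∧ ∃ ϑ ∈ 𝒜 1, g = hM.xOddUnit γ ϑ}

lemma IsAdmissible.mem_oddOneParam {γ : roots₁} {g : hM.GL k A} :
    g ∈ hM.oddOneParam 𝒜 γ ↔ ∃ ϑ ∈ 𝒜 1, g = hM.xOddUnit γ ϑ :=
  ⟨fun ⟨ϑ, hϑ, h⟩ => ⟨ϑ, hϑ, Units.ext h⟩, fun ⟨ϑ, hϑ, h⟩ => ⟨ϑ, hϑ, congrArg Units.val h⟩⟩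

lemma IsAdmissible.iUnion_oddOneParam_pm (s : ℤˣ) :
    (⋃ γ, ⋃ (_ : γ.1 ∈ oddRoots s), hM.oddOneParam 𝒜 γ : Set (hM.GL k A)) =
      hM.oddElements 𝒜 (oddRoots s) := by
  ext g
  simp only [Set.mem_iUnion, hM.mem_oddOneParam, exists_prop]
  rfl

lemma IsAdmissible.iUnion_oddOneParam :
    (⋃ γ, hM.oddOneParam 𝒜 γ : Set (hM.GL k A)) = hM.oddElements 𝒜 Set.univ := by
  ext g
  simp only [Set.mem_iUnion, hM.mem_oddOneParam, oddElements, Set.mem_univ, true_and,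
    Set.mem_ofPred_eq]

lemma IsAdmissible.xOddUnit_inv (γ : roots₁) (ϑ : A) :
    (hM.xOddUnit (k := k) γ ϑ)⁻¹ = hM.xOddUnit γ (-ϑ) := Units.ext rfl

lemma IsAdmissible.xOddUnit_mul (γ : roots₁) (ϑ η : A) :
    hM.xOddUnit (k := k) γ ϑ * hM.xOddUnit γ η = hM.xOddUnit γ (ϑ + η) :=
  Units.ext (hM.xOdd_mul γ ϑ η)

variable {𝒜}

lemma IsAdmissible.inv_mem_oddElements {P : Set (Fin 3 → ℤ)} {g : hM.GL k A}
    (hg : g ∈ hM.oddElements 𝒜 P) : g⁻¹ ∈ hM.oddElements 𝒜 P := by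
  obtain ⟨γ, hγ, ϑ, hϑ, rfl⟩ := hg
  exact ⟨γ, hγ, -ϑ, neg_mem hϑ, hM.xOddUnit_inv γ ϑ⟩

/-- The roots `γ` and `α + γ` both belong to `P`, either trivially or because adding an even root of
sign `s` preserves the sign of an odd root. -/
lemma IsAdmissible.even_mem_normalizer [GradedAlgebra 𝒜] (h𝒜 : IsSupercommutative 𝒜)
    (hA2 : ∀ x : A, 2 * x = 0 → x = 0) (ha0 : a ≠ 0) (ha1 : a ≠ -1) {P : Set (Fin 3 → ℤ)}
    {α : roots₀} (hP : P = Set.univ ∨ ∃ s, P = oddRoots s ∧ α.1 ∈ evenRoots s)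
    {g : hM.GL k A} (hg : g ∈ hM.evenOneParam 𝒜 α) :
    g ∈ Subgroup.normalizer (Subgroup.closure (hM.oddElements 𝒜 P) : Set (hM.GL k A)) := by
  obtain ⟨t, ht, hg⟩ := hg
  have key {γ : roots₁} (hγ : γ.1 ∈ P) {ϑ : A} (hϑ : ϑ ∈ 𝒜 1) : ∃ δ : roots₁, δ.1 ∈ P ∧ ∃ η ∈ 𝒜 1,
      g * hM.xOddUnit γ ϑ = hM.xOddUnit γ ϑ * hM.xOddUnit δ η * g ∧
      g * hM.xOddUnit δ η = hM.xOddUnit δ η * g := by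
    obtain ⟨δ, hδ, c, h1, h2, h3⟩ := bracket_even_odd B ha0 ha1 α.2 γ.2
    refine ⟨⟨δ, hδ⟩, ?_, ϑ * t * scal k A c, scal_mem_mul (mul_mem_odd hϑ ht) c, ?_, ?_⟩
    · rcases hP with rfl | ⟨s, rfl, hs⟩
      · trivial
      · exact h3 s hs hγ
    · refine Units.ext ?_
      rw [Units.val_mul, Units.val_mul, Units.val_mul, hg]
      exact hM.xEven_mul_xOdd h𝒜 hA2 (δ := ⟨δ, hδ⟩) h1 h2 ht hϑ
    · refine Units.ext ?_
      rw [Units.val_mul, Units.val_mul, hg]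
      have := hM.xEven_mul_xOdd (k := k) h𝒜 hA2 (α := α) (γ := ⟨δ, hδ⟩) (δ := ⟨δ, hδ⟩) (c := 0)
        (by rw [h2, zero_smul]) h2 ht (scal_mem_mul (mul_mem_odd hϑ ht) c)
      rw [show scal k A (0 : Za a) = 0 by simp [scal], mul_zero, hM.xOdd_zero, mul_one] at this
      exact this
  refine mem_normalizer_closure ?_ ?_
  · rintro _ ⟨γ, hγ, ϑ, hϑ, rfl⟩
    obtain ⟨δ, hδ, η, hη, h1, -⟩ := key hγ hϑ
    rw [h1, mul_inv_cancel_right]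
    exact mul_mem (Subgroup.subset_closure ⟨γ, hγ, ϑ, hϑ, rfl⟩)
      (Subgroup.subset_closure ⟨δ, hδ, η, hη, rfl⟩)
  · rintro _ ⟨γ, hγ, ϑ, hϑ, rfl⟩
    obtain ⟨δ, hδ, η, hη, h1, h2⟩ := key hγ hϑ
    -- Since `g` commutes with `x_δ(η)`, the formula for `g` can be solved for the conjugate by
    -- `g⁻¹`.
    have e : g⁻¹ * hM.xOddUnit γ ϑ * g = hM.xOddUnit γ ϑ * (hM.xOddUnit δ η)⁻¹ := by
      rw [eq_mul_inv_iff_mul_eq, mul_assoc, mul_assoc, inv_mul_eq_iff_eq_mul, h2, h1, ← mul_assoc]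
    rw [e]
    exact mul_mem (Subgroup.subset_closure ⟨γ, hγ, ϑ, hϑ, rfl⟩)
      (inv_mem (Subgroup.subset_closure ⟨δ, hδ, η, hη, rfl⟩))

lemma IsAdmissible.toral_mem_normalizer [GradedAlgebra 𝒜] {g : hM.GL k A}
    (hg : ∀ γ : roots₁, ∃ w ∈ 𝒜 0, ∃ w' ∈ 𝒜 0, w' * w = 1 ∧ ∀ ϑ,
      (g : Module.End A (hM.Points k A)) * hM.xOdd k γ ϑ = hM.xOdd k γ (ϑ * w) * g) :
    g ∈ Subgroup.normalizer (Subgroup.closure (hM.oddElements 𝒜 Set.univ) : Set (hM.GL k A)) := by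
  refine mem_normalizer_closure ?_ ?_ <;> rintro _ ⟨γ, -, ϑ, hϑ, rfl⟩ <;>
    obtain ⟨w, hw, w', hw', hww, h⟩ := hg γ
  · refine Subgroup.subset_closure ⟨γ, trivial, ϑ * w, mul_mem_odd hϑ hw, ?_⟩
    rw [mul_inv_eq_iff_eq_mul]
    exact Units.ext (h ϑ)
  · refine Subgroup.subset_closure ⟨γ, trivial, ϑ * w', mul_mem_odd hϑ hw', ?_⟩
    rw [mul_assoc, inv_mul_eq_iff_eq_mul]
    refine Units.ext (Eq.symm ?_)
    have := h (ϑ * w')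
    rwa [mul_assoc, hww, mul_one] at this

lemma IsAdmissible.G₀_le_normalizer (hρ : IsRational B ρ) [GradedAlgebra 𝒜]
    (h𝒜 : IsSupercommutative 𝒜) (hA2 : ∀ x : A, 2 * x = 0 → x = 0) (ha0 : a ≠ 0) (ha1 : a ≠ -1) :
    hM.G₀ 𝒜 ≤ Subgroup.normalizer (Subgroup.closure (hM.oddElements (k := k) 𝒜 Set.univ) : Set (hM.GL k A)) := by
  have htorus (c) : hM.torusOneParam 𝒜 c ⊆
      (Subgroup.normalizer (Subgroup.closure (hM.oddElements (k := k) 𝒜 Set.univ) : Set (hM.GL k A)) : Set (hM.GL k A)) := fun g hg =>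
    hM.toral_mem_normalizer (hM.torus_mul_xOdd hρ h𝒜 hg)
  refine (Subgroup.closure_le _).2 (Set.union_subset ?_ ?_)
  · refine SetLike.coe_subset_coe.2 ((Subgroup.closure_le _).2
      (Set.union_subset (Set.iUnion_subset htorus) (Set.iUnion_subset fun α g hg => ?_)))
    exact hM.even_mem_normalizer h𝒜 hA2 ha0 ha1 (Or.inl rfl) hg
  · refine SetLike.coe_subset_coe.2 ((Subgroup.closure_le _).2
      (Set.union_subset (Set.iUnion_subset fun c g hg => ?_) ?_))
    · exact hM.toral_mem_normalizer (hM.aTorus_mul_xOdd hρ h𝒜 hg)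
    · exact SetLike.coe_subset_coe.2 ((Subgroup.closure_le _).2 (Set.iUnion_subset htorus))

lemma IsAdmissible.G₁_eq :
    hM.G₁ 𝒜 = (Subgroup.closure (hM.oddElements (k := k) 𝒜 Set.univ) : Set (hM.GL k A)) := by
  rw [IsAdmissible.G₁, hM.iUnion_oddOneParam]
  exact submonoidClosure_eq_closure fun g hg => hM.inv_mem_oddElements hg

theorem IsAdmissible.G_eq_G₀_mul_G₁ (hρ : IsRational B ρ) [GradedAlgebra 𝒜]
    (h𝒜 : IsSupercommutative 𝒜) (hA2 : ∀ x : A, 2 * x = 0 → x = 0) (ha0 : a ≠ 0) (ha1 : a ≠ -1) :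
    (hM.G 𝒜 : Set (hM.GL k A)) = (hM.G₀ 𝒜 : Set (hM.GL k A)) * hM.G₁ 𝒜 ∧
      (hM.G 𝒜 : Set (hM.GL k A)) = hM.G₁ 𝒜 * (hM.G₀ 𝒜 : Set (hM.GL k A)) := by
  have h := hM.G₀_le_normalizer (k := k) hρ h𝒜 hA2 ha0 ha1
  have e : hM.G 𝒜 = hM.G₀ 𝒜 ⊔ Subgroup.closure (hM.oddElements (k := k) 𝒜 Set.univ) := by
    rw [IsAdmissible.G, Subgroup.closure_union, Subgroup.closure_eq, hM.iUnion_oddOneParam]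
  rw [hM.G₁_eq, e]
  refine ⟨Subgroup.coe_mul_of_left_le_normalizer_right _ _ h, ?_⟩
  rw [sup_comm]
  exact Subgroup.coe_mul_of_right_le_normalizer_left _ _ h

theorem IsAdmissible.Gpm_eq_G₀pm_mul_G₁pm [GradedAlgebra 𝒜]
    (h𝒜 : IsSupercommutative 𝒜) (hA2 : ∀ x : A, 2 * x = 0 → x = 0) (ha0 : a ≠ 0) (ha1 : a ≠ -1)
    (s : ℤˣ) : hM.Gpm (k := k) 𝒜 s = hM.G₀pm 𝒜 s * hM.G₁pm 𝒜 s ∧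
      hM.Gpm (k := k) 𝒜 s = hM.G₁pm 𝒜 s * hM.G₀pm 𝒜 s := by
  unfold IsAdmissible.Gpm IsAdmissible.G₀pm IsAdmissible.G₁pm
  rw [hM.iUnion_oddOneParam_pm]
  refine closure_union_eq_mul (fun g hg => hM.inv_mem_oddElements hg) ?_
  refine Set.iUnion_subset fun α => Set.iUnion_subset fun hα g hg => ?_
  exact hM.even_mem_normalizer h𝒜 hA2 ha0 ha1 (Or.inr ⟨s, rfl, hα⟩) hg

end Normalization

/-! ### Nilpotency of finitely many odd parameters -/

section Filtration
variable {k A : Type*} [CommRing k] [Ring A] [Algebra k A] {𝒜 : ZMod 2 → Submodule k A}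

/-- The span of the products of at least `m` elements of `S`. -/
def prodFiltration (k : Type*) {A : Type*} [CommRing k] [Ring A] [Algebra k A] (S : Set A) (m : ℕ) :
    Submodule k A :=
  Submodule.span k {x | ∃ l : List A, (∀ y ∈ l, y ∈ S) ∧ m ≤ l.length ∧ l.prod = x}

lemma prodFiltration_antitone (S : Set A) : Antitone (prodFiltration k S) := fun _ _ h =>
  Submodule.span_mono fun _ ⟨l, hl, hl', e⟩ => ⟨l, hl, h.trans hl', e⟩

lemma subset_prodFiltration_one (S : Set A) : S ⊆ prodFiltration k S 1 := fun x hx =>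
  Submodule.subset_span ⟨[x], by simpa using hx, by simp, by simp⟩

lemma mul_mem_prodFiltration {S : Set A} {m n : ℕ} {x y : A} (hx : x ∈ prodFiltration k S m)
    (hy : y ∈ prodFiltration k S n) : x * y ∈ prodFiltration k S (m + n) := by
  have h := Submodule.mul_mem_mul hx hy
  rw [prodFiltration, prodFiltration, Submodule.span_mul_span] at h
  refine Submodule.span_mono ?_ h
  rintro _ ⟨_, ⟨l, hl, hl', rfl⟩, _, ⟨l', h1, h2, rfl⟩, rfl⟩
  refine ⟨l ++ l', fun y hy => ?_, by rw [List.length_append]; omega, by simp⟩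
  rcases List.mem_append.1 hy with hy | hy
  exacts [hl y hy, h1 y hy]

lemma mul_prod_eq_zero_of_mem (h𝒜 : IsSupercommutative 𝒜) (hA2 : ∀ x : A, 2 * x = 0 → x = 0)
    {x : A} (hx : x ∈ 𝒜 1) {l : List A} (hl : ∀ y ∈ l, y ∈ 𝒜 1) (hxl : x ∈ l) :
    x * l.prod = 0 := by
  induction l with
  | nil => simp at hxl
  | cons y l ih =>
    rw [List.prod_cons, ← mul_assoc]
    rcases List.mem_cons.1 hxl with rfl | h
    · rw [odd_sq h𝒜 hA2 hx, zero_mul]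
    · rw [odd_anticommute h𝒜 hx (hl y (by simp)), neg_mul, mul_assoc,
        ih (fun z hz => hl z (by simp [hz])) h, mul_zero, neg_zero]

lemma prod_eq_zero_of_not_nodup (h𝒜 : IsSupercommutative 𝒜) (hA2 : ∀ x : A, 2 * x = 0 → x = 0)
    {l : List A} (hl : ∀ y ∈ l, y ∈ 𝒜 1) (h : ¬ l.Nodup) : l.prod = 0 := by
  induction l with
  | nil => simp at h
  | cons y l ih =>
    have hl' : ∀ z ∈ l, z ∈ 𝒜 1 := fun z hz => hl z (by simp [hz])
    rw [List.prod_cons]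
    by_cases hy : y ∈ l
    · exact mul_prod_eq_zero_of_mem h𝒜 hA2 (hl y (by simp)) hl' hy
    · rw [ih hl' (fun hn => h (List.nodup_cons.2 ⟨hy, hn⟩)), mul_zero]

/-- By the pigeonhole principle a product of more than `|S|` factors repeats one. Anticommutation
brings the two copies together, and odd squares vanish. -/
lemma prodFiltration_eq_bot (h𝒜 : IsSupercommutative 𝒜) (hA2 : ∀ x : A, 2 * x = 0 → x = 0)
    (S : Finset A) (hS : ∀ x ∈ S, x ∈ 𝒜 1) : prodFiltration k (S : Set A) (S.card + 1) = ⊥ := by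
  rw [eq_bot_iff, prodFiltration, Submodule.span_le]
  rintro _ ⟨l, hl, hl', rfl⟩
  refine prod_eq_zero_of_not_nodup h𝒜 hA2 (fun y hy => hS y (hl y hy)) fun hn => ?_
  classical
  have h1 : l.toFinset ⊆ S := fun y hy => hl y (List.mem_toFinset.1 hy)
  have h2 := Finset.card_le_card h1
  rw [List.toFinset_card_of_nodup hn] at h2
  omega

lemma scal_mem_mul' {K : Type*} [Field K] {a : K} [Algebra (Za a) k] {J : Submodule k A} {x : A}
    (hx : x ∈ J) (c : Za a) : x * scal k A c ∈ J := by
  rw [← scal_commutes, scal, ← Algebra.smul_def]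
  exact J.smul_mem _ hx

end Filtration

/-! ### Straightening odd products into a prescribed order: part (c) -/

section Straightening
variable {K : Type*} [Field K] [CharZero K] {a : K} {B : ChevalleyBasis a}
  {V : Type*} [AddCommGroup V] [Module K V] {ρ : SuperRep K (D21 K a) V}
  {M : Submodule (Za a) V} (hM : IsAdmissible B ρ M)
  {k : Type*} [CommRing k] [Algebra (Za a) k] {A : Type*} [Ring A] [Algebra k A]
  (𝒜 : ZMod 2 → Submodule k A)

/-- The elements `x_γ(ϑ)` with `γ` odd and `ϑ ∈ J`. -/
def IsAdmissible.oddPart (J : Submodule k A) : Set (hM.GL k A) :=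
  {g | ∃ γ : roots₁, ∃ ϑ ∈ 𝒜 1, ϑ ∈ J ∧ g = hM.xOddUnit γ ϑ}

/-- The elements `1 + d X` of `G₀(A)` with `X` an even root vector or a coroot and `d ∈ J` of
square zero. -/
def IsAdmissible.evenPart (J : Submodule k A) : Set (hM.GL k A) :=
  {g | g ∈ hM.G₀ 𝒜 ∧ ∃ x ∈ B.evenVectors, ∃ f : Module.End (Za a) M, ActsAs ρ f x ∧
    ∃ d ∈ 𝒜 0, d ∈ J ∧ d * d = 0 ∧ (g : Module.End A (hM.Points k A)) = 1 + hM.op k d f}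

/-- The subgroup generated by the elements with parameters in `J`. -/
def IsAdmissible.infinitesimal (J : Submodule k A) : Subgroup (hM.GL k A) :=
  Subgroup.closure (hM.evenPart 𝒜 J ∪ hM.oddPart 𝒜 J)

variable {𝒜}

lemma IsAdmissible.inv_mem_oddPart {J : Submodule k A} {g : hM.GL k A} (hg : g ∈ hM.oddPart 𝒜 J) :
    g⁻¹ ∈ hM.oddPart 𝒜 J := by
  obtain ⟨γ, ϑ, hϑ, hJ, rfl⟩ := hg
  exact ⟨γ, -ϑ, neg_mem hϑ, neg_mem hJ, hM.xOddUnit_inv γ ϑ⟩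

lemma one_add_mul_one_sub {R : Type*} [Ring R] (x : R) (hx : x * x = 0) : (1 + x) * (1 + -x) = 1 := by
  have e : (1 + x) * (1 + -x) = 1 - x * x := by noncomm_ring
  rw [e, hx, sub_zero]

/-- The invertible operator `1 + d f`, for `d` of square zero. -/
def IsAdmissible.opUnit (d : A) (hd : d * d = 0) (f : Module.End (Za a) M) : hM.GL k A where
  val := 1 + hM.op k d f
  inv := 1 + hM.op k (-d) f
  val_inv := by
    rw [hM.op_neg_left]
    exact one_add_mul_one_sub (hM.op k d f) (by rw [hM.op_mul, hd, hM.op_zero_left])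
  inv_val := by
    have h := one_add_mul_one_sub (hM.op k (-d) f)
      (by rw [hM.op_mul, neg_mul_neg, hd, hM.op_zero_left])
    rwa [← hM.op_neg_left, neg_neg] at h

lemma IsAdmissible.inv_mem_evenPart {J : Submodule k A} {g : hM.GL k A}
    (hg : g ∈ hM.evenPart 𝒜 J) : g⁻¹ ∈ hM.evenPart 𝒜 J := by
  obtain ⟨hg, x, hx, f, hf, d, hd0, hJ, hd, e⟩ := hg
  obtain rfl : g = hM.opUnit d hd f := Units.ext e
  exact ⟨inv_mem hg, x, hx, f, hf, -d, neg_mem hd0, neg_mem hJ, by rw [neg_mul_neg, hd], rfl⟩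

lemma IsAdmissible.evenOneParam_subset_G₀ (α : roots₀) :
    hM.evenOneParam 𝒜 α ⊆ (hM.G₀ 𝒜 : Set (hM.GL k A)) := fun _ hg =>
  Subgroup.subset_closure (Or.inl (Subgroup.subset_closure (Or.inr (Set.mem_iUnion.2 ⟨α, hg⟩))))

lemma IsAdmissible.aTorusOneParam_subset_G₀ (c : B.cartanLattice) :
    hM.aTorusOneParam 𝒜 c ⊆ (hM.G₀ 𝒜 : Set (hM.GL k A)) := fun _ hg =>
  Subgroup.subset_closure (Or.inr (Subgroup.subset_closure (Or.inl (Set.mem_iUnion.2 ⟨c, hg⟩))))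

/-- For a root vector the element is `x_α(d)`. For the coroot of an odd root the weights take values
in `ℤ[a]`, not necessarily integers, so the element is found in the torus of `P_a`, at the point `ℓ
↦ 1 + d`. -/
lemma IsAdmissible.opUnit_mem_G₀ [GradedAlgebra 𝒜] {x : D21 K a}
    (hx : x ∈ B.evenVectors) {f : Module.End (Za a) M} (hf : ActsAs ρ f x) {d : A}
    (hd0 : d ∈ 𝒜 0) (hd : d * d = 0) : hM.opUnit d hd f ∈ hM.G₀ 𝒜 := by
  rcases hx with ⟨α, hα, rfl⟩ | ⟨γ, hγ, rfl⟩
  · refine hM.evenOneParam_subset_G₀ ⟨α, hα⟩ ⟨d, hd0, ?_⟩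
    rw [hM.xEven_of_sq_eq_zero hd, ← hf.ext (hM.actsAs_even ⟨α, hα⟩)]
    rfl
  · refine hM.aTorusOneParam_subset_G₀ ⟨_, coroot_mem_cartanLattice B (Or.inr hγ)⟩
      ⟨tangentPoint d hd0 hd, fun μ z hz m hm => ?_⟩
    have h1 : f m = (⟨(z : K), adjoinZ_le_Za z.2⟩ : Za a) • m := Subtype.ext <| by
      rw [hf m, hm, hz]; rfl
    have h2 : (1 ⊗ₜ[Za a] ((⟨(z : K), adjoinZ_le_Za z.2⟩ : Za a) • m) : k ⊗[Za a] M) =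
        algebraMap (Za a) k ⟨(z : K), adjoinZ_le_Za z.2⟩ • (1 ⊗ₜ m) := by
      rw [TensorProduct.tmul_smul, algebraMap_smul]
    rw [tangentPoint_pow, IsAdmissible.opUnit, hM.op_one_tmul, one_mul, h1, h2, add_tmul,
      ← TensorProduct.smul_tmul, Algebra.smul_def]
    rfl

lemma IsAdmissible.opUnit_mem_infinitesimal [GradedAlgebra 𝒜] {J : Submodule k A} {x : D21 K a}
    (hx : x ∈ B.evenVectors) {f : Module.End (Za a) M} (hf : ActsAs ρ f x) {d : A}
    (hd0 : d ∈ 𝒜 0) (hJ : d ∈ J) (hd : d * d = 0) : hM.opUnit d hd f ∈ hM.infinitesimal 𝒜 J :=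
  Subgroup.subset_closure
    (Or.inl ⟨hM.opUnit_mem_G₀ hx hf hd0 hd, x, hx, f, hf, d, hd0, hJ, hd, rfl⟩)

/-- Commuting an element with parameter in `I` past a generator with parameter in `J` produces
parameters in `J'`, if `J I ⊆ J'`. -/
lemma IsAdmissible.exists_commutator [GradedAlgebra 𝒜] (h𝒜 : IsSupercommutative 𝒜)
    (hA2 : ∀ x : A, 2 * x = 0 → x = 0) (ha0 : a ≠ 0) (ha1 : a ≠ -1) {I J J' : Submodule k A}
    (hJ : ∀ x ∈ J, ∀ y ∈ I, x * y ∈ J') {p q : hM.GL k A} (hp : p ∈ hM.oddPart 𝒜 I)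
    (hq : q ∈ hM.evenPart 𝒜 J ∪ hM.oddPart 𝒜 J) :
    ∃ n ∈ hM.infinitesimal 𝒜 J', p * q = q * p * n := by
  obtain ⟨γ, ϑ, hϑ, hϑI, rfl⟩ := hp
  rcases hq with ⟨-, x, hx, f, hf, d, hd0, hdJ, hd, e⟩ | ⟨δ, η, hη, hηJ, rfl⟩
  · obtain rfl : q = hM.opUnit d hd f := Units.ext e
    obtain ⟨δ, hδ, c, hc⟩ := bracket_evenVector_odd B ha0 ha1 hx γ.2
    have h1 := hf.bracket_eq (hM.actsAs_odd γ) (hM.actsAs_odd ⟨δ, hδ⟩)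
      (mem_grading_of_mem_evenVectors hx) (B.X_odd γ γ.2) hc
    -- The odd operator must come first here, opposite to the bracket at hand; hence the coefficient
    -- `-c`.
    have h2 : hM.act ⟨_, odd_mem_kostant γ⟩ * f = koszul 1 0 • (f * hM.act ⟨_, odd_mem_kostant γ⟩) +
        (-c) • hM.act ⟨_, odd_mem_kostant ⟨δ, hδ⟩⟩ := by
      rw [h1, koszul_zero_left_smul, koszul_symm, koszul_zero_left_smul]
      exact LinearMap.ext fun m => by simp
    refine ⟨hM.xOddUnit ⟨δ, hδ⟩ (d * ϑ * scal k A (-c)), Subgroup.subset_closure (Or.inr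
      ⟨⟨δ, hδ⟩, _, scal_mem_mul ?_ _, scal_mem_mul' (hJ d hdJ ϑ hϑI) _, rfl⟩), Units.ext ?_⟩
    · rw [even_commute h𝒜 hd0]
      exact mul_mem_odd hϑ hd0
    · exact hM.one_add_op_commutator h𝒜 hA2 h2 hϑ hd0 hd
  · obtain ⟨x, hx, c, hc⟩ := bracket_odd_odd B γ.2 δ.2
    obtain ⟨f, hf⟩ := hM.exists_actsAs hx
    have h1 := (hM.actsAs_odd γ).bracket_eq (hM.actsAs_odd δ) hf (B.X_odd γ γ.2) (B.X_odd δ δ.2) hc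
    have hsq : η * ϑ * scal k A c * (η * ϑ * scal k A c) = 0 := by
      have e1 : η * ϑ * (η * ϑ) = 0 := by
        rw [mul_assoc, ← mul_assoc ϑ, odd_anticommute h𝒜 hϑ hη, neg_mul, mul_assoc,
          odd_sq h𝒜 hA2 hϑ, mul_zero, neg_zero, mul_zero]
      rw [mul_assoc, ← mul_assoc (scal k A c), scal_commutes, ← mul_assoc, ← mul_assoc, e1, zero_mul,
        zero_mul]
    exact ⟨hM.opUnit _ hsq f, hM.opUnit_mem_infinitesimal hx hf
      (scal_mem_mul (mul_mem_even hη hϑ) c) (scal_mem_mul' (hJ η hηJ ϑ hϑI) c) hsq,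
      Units.ext (hM.one_add_op_commutator h𝒜 hA2 h1 hϑ hη (odd_sq h𝒜 hA2 hη))⟩

/-- For a generator `q`, the relation `p q = q p n` reads `p⁻¹ q p = q n⁻¹`, and both factors have
parameters in `J`. -/
lemma IsAdmissible.conj_mem_infinitesimal [GradedAlgebra 𝒜] (h𝒜 : IsSupercommutative 𝒜)
    (hA2 : ∀ x : A, 2 * x = 0 → x = 0) (ha0 : a ≠ 0) (ha1 : a ≠ -1) {I J : Submodule k A}
    (hJ : ∀ x ∈ J, ∀ y ∈ I, x * y ∈ J) {p : hM.GL k A} (hp : p ∈ hM.oddPart 𝒜 I) {n : hM.GL k A}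
    (hn : n ∈ hM.infinitesimal 𝒜 J) : p⁻¹ * n * p ∈ hM.infinitesimal 𝒜 J := by
  have h : hM.infinitesimal 𝒜 J ≤ (hM.infinitesimal 𝒜 J).comap (MulAut.conj p⁻¹).toMonoidHom := by
    refine (Subgroup.closure_le _).2 fun q hq => ?_
    obtain ⟨n, hn, e⟩ := hM.exists_commutator h𝒜 hA2 ha0 ha1 hJ hp hq
    have h1 : p⁻¹ * q * p = q * n⁻¹ := by
      rw [mul_assoc, inv_mul_eq_iff_eq_mul, ← mul_assoc, e, mul_inv_cancel_right]
    have h2 : q * n⁻¹ ∈ hM.infinitesimal 𝒜 J := mul_mem (Subgroup.subset_closure hq) (inv_mem hn)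
    simpa [h1] using h2
  simpa using h hn


/-- The product `x_{γ₁}(ϑ₁) x_{γ₂}(ϑ₂) ⋯` for a list of pairs `(γ_i, ϑ_i)`. -/
def IsAdmissible.word (k : Type*) [CommRing k] [Algebra (Za a) k] {A : Type*} [Ring A]
    [Algebra k A] (L : List (roots₁ × A)) : hM.GL k A :=
  (L.map fun p => hM.xOddUnit p.1 p.2).prod

lemma IsAdmissible.word_cons (p : roots₁ × A) (L : List (roots₁ × A)) :
    hM.word k (p :: L) = hM.xOddUnit p.1 p.2 * hM.word k L := by
  simp [word]

variable (𝒜) in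
/-- The products `x_{γ₁}(ϑ₁) x_{γ₂}(ϑ₂) ⋯` with `(γ₁, γ₂, …)` the given list of roots and
parameters in `J`. -/
def IsAdmissible.ordered (l : List roots₁) (J : Submodule k A) : Set (hM.GL k A) :=
  {g | ∃ L : List (roots₁ × A), L.map Prod.fst = l ∧ (∀ p ∈ L, p.2 ∈ 𝒜 1 ∧ p.2 ∈ J) ∧
    g = hM.word k L}

lemma IsAdmissible.one_mem_ordered (l : List roots₁) (J : Submodule k A) :
    1 ∈ hM.ordered 𝒜 l J := by
  refine ⟨l.map fun γ => (γ, 0), by simp [Function.comp_def], ?_, ?_⟩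
  · intro p hp
    obtain ⟨γ, -, rfl⟩ := List.mem_map.1 hp
    exact ⟨zero_mem _, zero_mem _⟩
  · induction l with
    | nil => rfl
    | cons γ l ih =>
      rw [List.map_cons, hM.word_cons, ← ih, mul_one]
      exact Units.ext (hM.xOdd_zero γ).symm

variable [GradedAlgebra 𝒜] (h𝒜 : IsSupercommutative 𝒜) (hA2 : ∀ x : A, 2 * x = 0 → x = 0)
  (ha0 : a ≠ 0) (ha1 : a ≠ -1)

include h𝒜 hA2 ha0 ha1

/-- Moving `q` past one letter leaves a commutator in the middle of the word. The statement about
conjugation is carried along so that the induction can push this commutator to the right end. -/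
lemma IsAdmissible.word_mul_comm {I J J' : Submodule k A}
    (hJ : ∀ x ∈ J, ∀ y ∈ I, x * y ∈ J') (hJ' : ∀ x ∈ J', ∀ y ∈ I, x * y ∈ J')
    {L : List (roots₁ × A)} (hL : ∀ p ∈ L, p.2 ∈ 𝒜 1 ∧ p.2 ∈ I) {q : hM.GL k A}
    (hq : q ∈ hM.evenPart 𝒜 J ∪ hM.oddPart 𝒜 J) :
    ∃ n ∈ hM.infinitesimal 𝒜 J', hM.word k L * q = q * hM.word k L * n ∧
      ∀ n' ∈ hM.infinitesimal 𝒜 J',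
        (hM.word k L)⁻¹ * n' * hM.word k L ∈ hM.infinitesimal 𝒜 J' := by
  induction L with
  | nil => exact ⟨1, one_mem _, by simp [word], by simp [word]⟩
  | cons p L ih =>
    obtain ⟨n, hn, e, hconj⟩ := ih fun p hp => hL p (by simp [hp])
    have hp : hM.xOddUnit p.1 p.2 ∈ hM.oddPart 𝒜 I :=
      ⟨p.1, p.2, (hL p (by simp)).1, (hL p (by simp)).2, rfl⟩
    obtain ⟨n1, hn1, e1⟩ := hM.exists_commutator h𝒜 hA2 ha0 ha1 hJ hp hq
    refine ⟨(hM.word k L)⁻¹ * n1 * hM.word k L * n, mul_mem (hconj _ hn1) hn, ?_, fun n' hn' => ?_⟩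
    · rw [hM.word_cons, mul_assoc, e, ← mul_assoc, ← mul_assoc, e1]
      group
    · rw [hM.word_cons, mul_inv_rev]
      have := hconj _ (hM.conj_mem_infinitesimal h𝒜 hA2 ha0 ha1 hJ' hp hn')
      simpa only [mul_assoc] using this

/-- The new factor travels left to the first position with root `γ`, where its parameter is added to
the one already there. The word keeps its roots, and the commutators remain on the right. -/
lemma IsAdmissible.ordered_mul_odd {I J J' : Submodule k A} (hJI : J ≤ I)
    (hJ : ∀ x ∈ J, ∀ y ∈ I, x * y ∈ J') (hJ' : ∀ x ∈ J', ∀ y ∈ I, x * y ∈ J')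
    {l : List roots₁} {w : hM.GL k A} (hw : w ∈ hM.ordered 𝒜 l I) {γ : roots₁} (hγ : γ ∈ l)
    {ϑ : A} (hϑ : ϑ ∈ 𝒜 1) (hϑJ : ϑ ∈ J) :
    ∃ w' ∈ hM.ordered 𝒜 l I, ∃ n ∈ hM.infinitesimal 𝒜 J', w * hM.xOddUnit γ ϑ = w' * n := by
  obtain ⟨L, rfl, hL, rfl⟩ := hw
  induction L with
  | nil => simp at hγ
  | cons p L ih =>
    have hL' : ∀ p ∈ L, p.2 ∈ 𝒜 1 ∧ p.2 ∈ I := fun p hp => hL p (by simp [hp])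
    have hp := hL p (by simp)
    by_cases h : γ = p.1
    · subst h
      obtain ⟨n, hn, e, -⟩ := hM.word_mul_comm h𝒜 hA2 ha0 ha1 hJ hJ' hL'
        (Or.inr ⟨p.1, ϑ, hϑ, hϑJ, rfl⟩ : hM.xOddUnit p.1 ϑ ∈ _)
      refine ⟨_, ⟨(p.1, p.2 + ϑ) :: L, by simp, ?_, rfl⟩, n, hn, ?_⟩
      · intro p' hp'
        rcases List.mem_cons.1 hp' with rfl | hp'
        exacts [⟨add_mem hp.1 hϑ, add_mem hp.2 (hJI hϑJ)⟩, hL' p' hp']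
      · rw [hM.word_cons, hM.word_cons, mul_assoc, e, ← hM.xOddUnit_mul]
        simp only [mul_assoc]
    · obtain ⟨w', ⟨L', e1, hL1, rfl⟩, n, hn, e⟩ := ih (by simpa [h] using hγ) hL'
      refine ⟨_, ⟨p :: L', by simp [e1], ?_, rfl⟩, n, hn, ?_⟩
      · intro p' hp'
        rcases List.mem_cons.1 hp' with rfl | hp'
        exacts [hp, hL1 p' hp']
      · rw [hM.word_cons, hM.word_cons, mul_assoc, e, mul_assoc]

/-- Descending induction on the filtration level `m`, with `j` bounding the number of levels left
before `J` vanishes. Each generator is absorbed at the cost of factors of level `m + 1`, and `m ≥ 1`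
ensures that merged parameters stay in `J 1`. -/
lemma IsAdmissible.mul_infinitesimal_subset {l : List roots₁} (hl : ∀ γ, γ ∈ l)
    {J : ℕ → Submodule k A} (hanti : Antitone J)
    (hmul : ∀ m, ∀ x ∈ J m, ∀ y ∈ J 1, x * y ∈ J (m + 1)) {N : ℕ} (hN : J N = ⊥) (j m : ℕ)
    (hm : 1 ≤ m) (hj : N ≤ m + j) :
    ∀ n ∈ hM.infinitesimal 𝒜 (J m),
      ∀ x ∈ (hM.G₀ 𝒜 : Set (hM.GL k A)) * hM.ordered 𝒜 l (J 1),
        x * n ∈ (hM.G₀ 𝒜 : Set (hM.GL k A)) * hM.ordered 𝒜 l (J 1) := by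
  induction j generalizing m with
  | zero =>
    have h0 : J m = ⊥ := eq_bot_iff.2 (hN ▸ hanti hj)
    have h1 : hM.infinitesimal 𝒜 (J m) = ⊥ := by
      rw [infinitesimal, Subgroup.closure_eq_bot_iff, h0]
      rintro q (⟨-, x, hx, f, hf, d, hd0, hdJ, hd, e⟩ | ⟨γ, ϑ, -, hJ, rfl⟩)
      · obtain rfl := (Submodule.mem_bot k).1 hdJ
        rw [hM.op_zero_left] at e
        exact Units.ext (e.trans (add_zero (1 : Module.End A (hM.Points k A))))
      · obtain rfl := (Submodule.mem_bot k).1 hJ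
        exact Units.ext (hM.xOdd_zero γ)
    intro n hn x hx
    rw [h1, Subgroup.mem_bot] at hn
    rwa [hn, mul_one]
  | succ j ih =>
    have ih' := ih (m + 1) (by omega) (by omega)
    have hJ' : ∀ x ∈ J (m + 1), ∀ y ∈ J 1, x * y ∈ J (m + 1) := fun x hx y hy =>
      hanti (Nat.le_succ (m + 1)) (hmul _ x hx y hy)
    have gen : ∀ q ∈ hM.evenPart 𝒜 (J m) ∪ hM.oddPart 𝒜 (J m),
        ∀ x ∈ (hM.G₀ 𝒜 : Set (hM.GL k A)) * hM.ordered 𝒜 l (J 1),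
          x * q ∈ (hM.G₀ 𝒜 : Set (hM.GL k A)) * hM.ordered 𝒜 l (J 1) := by
      rintro q hq _ ⟨g, hg, w, hw, rfl⟩
      rcases hq with hq | ⟨γ, ϑ, hϑ, hϑJ, rfl⟩
      · obtain ⟨L, hLl, hL, rfl⟩ := hw
        obtain ⟨n, hn, e, -⟩ := hM.word_mul_comm h𝒜 hA2 ha0 ha1 (hmul m) hJ' hL (Or.inl hq)
        have := ih' n hn (g * q * hM.word k L) ⟨g * q, mul_mem hg hq.1, _, ⟨L, hLl, hL, rfl⟩, rfl⟩
        simp only [mul_assoc] at this e ⊢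
        rwa [e]
      · obtain ⟨w', hw', n, hn, e⟩ := hM.ordered_mul_odd h𝒜 hA2 ha0 ha1 (hanti hm) (hmul m) hJ' hw
          (hl γ) hϑ hϑJ
        have := ih' n hn (g * w') ⟨g, hg, w', hw', rfl⟩
        simp only [mul_assoc] at this ⊢
        rwa [e]
    intro n hn
    induction hn using Subgroup.closure_induction'' with
    | mem q hq => exact gen q hq
    | inv_mem q hq =>
      exact gen _ (hq.imp (fun h => hM.inv_mem_evenPart h) fun h => hM.inv_mem_oddPart h)
    | one => intro x hx; rwa [mul_one]
    | mul y z _ _ hy hz => intro x hx; rw [← mul_assoc]; exact hz _ (hy _ hx)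

omit [GradedAlgebra 𝒜] h𝒜 hA2 ha0 ha1 in
-- A group element uses only finitely many generators. Collecting their parameters gives the finite
-- set on which the filtration is nilpotent.
lemma IsAdmissible.exists_finset_of_mem_closure {g : hM.GL k A}
    (hg : g ∈ Subgroup.closure (hM.oddElements 𝒜 Set.univ)) :
    ∃ S : Finset A, (∀ x ∈ S, x ∈ 𝒜 1) ∧
      g ∈ Subgroup.closure (hM.oddPart 𝒜 (prodFiltration k (S : Set A) 1)) := by
  classical
  induction hg using Subgroup.closure_induction with
  | mem x hx =>
    obtain ⟨γ, -, ϑ, hϑ, rfl⟩ := hx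
    exact ⟨{ϑ}, by simpa using hϑ, Subgroup.subset_closure
      ⟨γ, ϑ, hϑ, subset_prodFiltration_one _ (by simp), rfl⟩⟩
  | one => exact ⟨∅, by simp, one_mem _⟩
  | inv x _ hx =>
    obtain ⟨S, hS, h⟩ := hx
    exact ⟨S, hS, inv_mem h⟩
  | mul x y _ _ hx hy =>
    obtain ⟨S, hS, h⟩ := hx
    obtain ⟨S', hS', h'⟩ := hy
    have mono {S S' : Finset A} (hSS : S ⊆ S') :
        Subgroup.closure (hM.oddPart 𝒜 (prodFiltration k (S : Set A) 1)) ≤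
          Subgroup.closure (hM.oddPart 𝒜 (prodFiltration k (S' : Set A) 1)) :=
      Subgroup.closure_mono <| by
        rintro _ ⟨γ, ϑ, h1, h2, rfl⟩
        refine ⟨γ, ϑ, h1, Submodule.span_mono ?_ h2, rfl⟩
        rintro _ ⟨l, hl, hl'⟩
        exact ⟨l, fun y hy => hSS (hl y hy), hl'⟩
    refine ⟨S ∪ S', fun x hx => ?_, mul_mem (mono Finset.subset_union_left h)
      (mono Finset.subset_union_right h')⟩
    rcases Finset.mem_union.1 hx with hx | hx
    exacts [hS x hx, hS' x hx]

/-- Every element of `G(A)` is the product of an element of `G₀(A)` and an ordered product. -/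
theorem IsAdmissible.G_eq_G₀_mul_ordered (hρ : IsRational B ρ) {l : List roots₁}
    (hl : ∀ γ, γ ∈ l) :
    (hM.G 𝒜 : Set (hM.GL k A)) = (hM.G₀ 𝒜 : Set (hM.GL k A)) * hM.ordered 𝒜 l ⊤ := by
  rw [(hM.G_eq_G₀_mul_G₁ hρ h𝒜 hA2 ha0 ha1).1, hM.G₁_eq]
  refine Set.Subset.antisymm ?_ (Set.mul_subset_mul_left ?_)
  · rintro _ ⟨g, hg, n, hn, rfl⟩
    obtain ⟨S, hS, hn⟩ := hM.exists_finset_of_mem_closure hn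
    have hn' : n ∈ hM.infinitesimal 𝒜 (prodFiltration k (S : Set A) 1) :=
      Subgroup.closure_mono Set.subset_union_right hn
    -- The absorption starts at level 1 from `g · 1`, the empty product being the ordered word with
    -- all parameters 0.
    have := hM.mul_infinitesimal_subset h𝒜 hA2 ha0 ha1 hl
      (prodFiltration_antitone (k := k) (S : Set A)) (fun m x hx y hy => mul_mem_prodFiltration hx hy)
      (prodFiltration_eq_bot h𝒜 hA2 S hS) _ 1 le_rfl (Nat.le_add_left _ _) n hn' g
      ⟨g, hg, 1, hM.one_mem_ordered l _, mul_one g⟩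
    obtain ⟨g', hg', w, ⟨L, hLl, hL, rfl⟩, e⟩ := this
    exact ⟨g', hg', _, ⟨L, hLl, fun p hp => ⟨(hL p hp).1, trivial⟩, rfl⟩, e⟩
  · rintro _ ⟨L, -, hL, rfl⟩
    refine list_prod_mem fun x hx => ?_
    obtain ⟨p, hp, rfl⟩ := List.mem_map.1 hx
    exact Subgroup.subset_closure ⟨p.1, trivial, p.2, (hL p hp).1, rfl⟩

omit [GradedAlgebra 𝒜] h𝒜 hA2 ha0 ha1 in
lemma IsAdmissible.inv_mem_ordered {l : List roots₁} {J : Submodule k A} {w : hM.GL k A}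
    (hw : w ∈ hM.ordered 𝒜 l J) : w⁻¹ ∈ hM.ordered 𝒜 l.reverse J := by
  obtain ⟨L, rfl, hL, rfl⟩ := hw
  refine ⟨(L.map fun p => (p.1, -p.2)).reverse, by simp [Function.comp_def], fun p hp => ?_, ?_⟩
  · obtain ⟨p, hp', rfl⟩ := List.mem_map.1 (List.mem_reverse.1 hp)
    exact ⟨neg_mem (hL p hp').1, neg_mem (hL p hp').2⟩
  · rw [word, word, List.prod_inv_reverse, ← List.map_reverse, ← List.map_reverse,
      ← List.map_reverse, List.map_map, List.map_map]
    congr 2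
    funext p
    exact hM.xOddUnit_inv p.1 p.2

/-- Inversion reverses an ordered word, so this is the previous factorization for the reversed list,
applied to `x⁻¹`. -/
theorem IsAdmissible.G_eq_ordered_mul_G₀ (hρ : IsRational B ρ) {l : List roots₁}
    (hl : ∀ γ, γ ∈ l) :
    (hM.G 𝒜 : Set (hM.GL k A)) = hM.ordered 𝒜 l ⊤ * (hM.G₀ 𝒜 : Set (hM.GL k A)) := by
  have h (l : List roots₁) (hl : ∀ γ, γ ∈ l) :=
    hM.G_eq_G₀_mul_ordered (k := k) h𝒜 hA2 ha0 ha1 hρ hl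
  have hr : ∀ γ, γ ∈ l.reverse := fun γ => List.mem_reverse.2 (hl γ)
  ext x
  constructor
  · intro hx
    have hx' : x⁻¹ ∈ (hM.G 𝒜 : Set (hM.GL k A)) := inv_mem hx
    rw [h _ hr] at hx'
    obtain ⟨g, hg, w, hw, e⟩ := hx'
    refine ⟨w⁻¹, by simpa using hM.inv_mem_ordered hw, g⁻¹, inv_mem hg, ?_⟩
    rw [← inv_inj, ← e]
    simp
  · rintro ⟨w, hw, g, hg, rfl⟩
    have h1 : (w * g)⁻¹ ∈ (hM.G 𝒜 : Set (hM.GL k A)) := by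
      rw [h _ hr]
      exact ⟨g⁻¹, inv_mem hg, w⁻¹, hM.inv_mem_ordered hw, (mul_inv_rev w g).symm⟩
    simpa using inv_mem h1

omit [GradedAlgebra 𝒜] h𝒜 hA2 ha0 ha1 in
lemma IsAdmissible.G₁ord_eq (e : Fin 8 ≃ roots₁) :
    hM.G₁ord (k := k) 𝒜 e = hM.ordered 𝒜 (List.ofFn e) ⊤ := by
  have hval (ϑ : Fin 8 → A) : ((hM.word k (List.ofFn fun i => (e i, ϑ i)) : hM.GL k A) :
      Module.End A (hM.Points k A)) = (List.ofFn fun i => hM.xOdd k (e i) (ϑ i)).prod := by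
    rw [word, List.map_ofFn, ← Units.coeHom_apply, map_list_prod, List.map_ofFn]
    rfl
  ext g
  constructor
  · rintro ⟨ϑ, hϑ, hg⟩
    refine ⟨List.ofFn fun i => (e i, ϑ i), by rw [List.map_ofFn]; rfl, fun p hp => ?_,
      Units.ext (hg.trans (hval ϑ).symm)⟩
    obtain ⟨i, rfl⟩ := List.mem_ofFn.1 hp
    exact ⟨hϑ i, trivial⟩
  · rintro ⟨L, hLe, hL, rfl⟩
    have hofFn : ∀ (n : ℕ) (L : List (roots₁ × A)), L.length = n →
        ∃ f : Fin n → roots₁ × A, L = List.ofFn f := by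
      rintro _ L rfl
      exact ⟨L.get, (List.ofFn_get L).symm⟩
    obtain ⟨f, rfl⟩ := hofFn 8 L (by simpa using congrArg List.length hLe)
    rw [List.map_ofFn] at hLe
    have hf := List.ofFn_injective hLe
    refine ⟨fun i => (f i).2, fun i => (hL (f i) (List.mem_ofFn.2 ⟨i, rfl⟩)).1, ?_⟩
    rw [← hval]
    congr 3
    funext i
    exact Prod.ext (congrFun hf i) rfl

end Straightening

end SuperD21
end

/-! ### The three factorizations together -/

theorem mainTheorem7 {K : Type*} [Field K] [IsAlgClosed K] [CharZero K]
    {a : K} (ha0 : a ≠ 0) (ha1 : a ≠ -1) (B : ChevalleyBasis a)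
    {V : Type*} [AddCommGroup V] [Module K V] [FiniteDimensional K V]
    {ρ : SuperRep K (D21 K a) V} (hρ : IsRational B ρ)
    {M : Submodule (Za a) V} (hM : IsAdmissible B ρ M)
    {k : Type*} [CommRing k] [Algebra (Za a) k]
    (hk2 : (2 : k) ≠ 0 ∧ (2 : k) ∈ nonZeroDivisors k)
    (hk3 : (3 : k) ≠ 0 ∧ (3 : k) ∈ nonZeroDivisors k)
    {A : Type*} [Ring A] [Algebra k A] (𝒜 : ZMod 2 → Submodule k A) [GradedAlgebra 𝒜]
    (h𝒜 : IsSupercommutative 𝒜)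
    (hA2 : ∀ x : A, 2 * x = 0 → x = 0) (hA3 : ∀ x : A, 3 * x = 0 → x = 0) :
    ((hM.G 𝒜 : Set (hM.GL k A)) = (hM.G₀ 𝒜 : Set (hM.GL k A)) * hM.G₁ 𝒜 ∧
      (hM.G 𝒜 : Set (hM.GL k A)) = hM.G₁ 𝒜 * (hM.G₀ 𝒜 : Set (hM.GL k A))) ∧
    (∀ s : ℤˣ, hM.Gpm 𝒜 s = hM.G₀pm 𝒜 s * hM.G₁pm 𝒜 s ∧
      hM.Gpm 𝒜 s = hM.G₁pm 𝒜 s * hM.G₀pm 𝒜 s) ∧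
    (∀ e : Fin 8 ≃ roots₁,
      (hM.G 𝒜 : Set (hM.GL k A)) = (hM.G₀ 𝒜 : Set (hM.GL k A)) * hM.G₁ord 𝒜 e ∧
      (hM.G 𝒜 : Set (hM.GL k A)) = hM.G₁ord 𝒜 e * (hM.G₀ 𝒜 : Set (hM.GL k A))) := by
  refine ⟨hM.G_eq_G₀_mul_G₁ hρ h𝒜 hA2 ha0 ha1, hM.Gpm_eq_G₀pm_mul_G₁pm h𝒜 hA2 ha0 ha1,
    fun e => ?_⟩
  have he : ∀ γ, γ ∈ List.ofFn e := fun γ => (List.mem_ofFn' _ _).2 (e.surjective γ)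
  rw [hM.G₁ord_eq]
  exact ⟨hM.G_eq_G₀_mul_ordered h𝒜 hA2 ha0 ha1 hρ he,
    hM.G_eq_ordered_mul_G₀ h𝒜 hA2 ha0 ha1 hρ he⟩
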